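/- Let $\Omega\subset\mathbb R^d$, $T>0$, $q\in\{1,2,3,4,5\}$, $\theta>0$ and $m=\lceil\theta\rceil$, so that $m-1<\theta\le m$. Let $\mathbf x\in\Omega$ and let $u(\mathbf x,t)$ be smooth enough in $t$, namely $u(\mathbf x,\cdot)\in C^{q+m}[0,T]$ (with one-sided derivatives at the end points; $u^{(l)}_t$ denotes the $l$-th derivative in $t$). For $N\in\mathbb Z^+$ put $\tau=T/N$ and $t_n=n\tau$, $0\le n\le N$. The Caputo derivative is $${}^C_0D^\theta_tu(\mathbf x,t)=\frac1{\Gamma(m-\theta)}\int_0^t\frac{u^{(m)}_t(\mathbf x,\xi)}{(t-\xi)^{\theta-m+1}}\,d\xi\quad(m-1<\theta<m),\qquad {}^C_0D^\theta_tu(\mathbf x,t)=u^{(m)}_t(\mathbf x,t)\quad(\theta=m).$$ Let $\omega^{q,\theta}_k$ be Lubich's coefficients, given near $z=0$ by $\bigl(\sum_{j=1}^q\frac1j(1-z)^j\bigr)^\theta=\sum_{k\ge0}\omega_k^{q,\theta}z^k$, and set $$\mathscr A^\theta_qu(\mathbf x,t_n)=\frac1{\tau^\theta}\sum_{k=0}^n\omega^{q,\theta}_ku(\mathbf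 x,t_{n-k})-\frac1{\tau^\theta}\sum_{l=0}^{m-1}\sum_{k=0}^n\frac{\omega^{q,\theta}_k\,u^{(l)}_t(\mathbf x,0)\,t_{n-k}^l}{l!}.$$ Then $${}^C_0D^\theta_tu(\mathbf x,t_n)=\mathscr A^\theta_qu(\mathbf x,t_n)+\mathscr O(\tau^q)$$ in the following sense. 1. (Away from $t=0$.) If $u^{(l)}_t(\mathbf x,0)=0$ for all integers $l$ with $m\le l\le q-2$ (no condition when $q\le m+1$, in particular when $q\le2$), then for every $\delta>0$ there is a constant $C$ such that for all $N\ge1$ and all $n\le N$ with $t_n\ge\delta$ $$\bigl|{}^C_0D^\theta_tu(\mathbf x,t_n)-\mathscr A^\theta_qu(\mathbf x,t_n)\bigr|\le C\tau^q.$$ 2. (On the whole grid.) If $u^{(l)}_t(\mathbf x,0)=0$ for all integers $l$ with $m\le l<\theta+q$, then there is a constant $C$ such that this bound holds for all $N\ge1$ and all $1\le n\le N$. 3. (Integer order.) If $\theta=m$ is an integer, then, without any condition on the derivatives at $t=0$, there is a constant $C$ such that this bound holds for all $N\ge1$ and all $n$ with $mq\le n\le N$. The constants $C$ do not depend on $N$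 and $n$ (they may depend on $q$, $\theta$, $T$, $u(\mathbf x,\cdot)$ and, in part 1, on $\delta$). -/

import Mathlib

noncomputable section

namespace CaputoLubich

/-- Left Riemann-Liouville fractional integral of order `α ≥ 0` based at `a`, with the convention
that the integral of order `0` is the identity. -/
def rlIntegral (a α : ℝ) (f : ℝ → ℝ) (t : ℝ) : ℝ :=
  if α = 0 then f t
  else (1 / Real.Gamma α) * ∫ ξ in a..t, (t - ξ) ^ (α - 1) * f ξ

/-- The `l`-th derivative at `t` of a function given on `[0, T]` (one-sided at the end points). -/
def timeDeriv (T : ℝ) (l : ℕ) (f : ℝ → ℝ) (t : ℝ) : ℝ :=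
  iteratedDerivWithin l f (Set.Icc 0 T) t

/-- Left Caputo derivative of order `θ > 0` based at `0` of a function given on `[0, T]`: the
Riemann-Liouville integral of order `m - θ` of the `m`-th derivative, where `m = ⌈θ⌉`, that is
`m - 1 < θ ≤ m`. For `θ = m` it is the `m`-th derivative. -/
def caputo (T θ : ℝ) (f : ℝ → ℝ) (t : ℝ) : ℝ :=
  rlIntegral 0 ((⌈θ⌉₊ : ℝ) - θ) (timeDeriv T ⌈θ⌉₊ f) t

/-- Generating polynomial `δ_q(z) = ∑_{j=1}^q (1 - z)^j / j` of the `q`-step backward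
difference formula. -/
def bdfPoly (q : ℕ) (z : ℝ) : ℝ :=
  ∑ j ∈ Finset.Icc 1 q, (1 - z) ^ j / (j : ℝ)

/-- Lubich's coefficients: `lubichCoeff q θ k` is the coefficient of `z ^ k` in the Maclaurin
series of `δ_q(z) ^ θ`. For `q ≥ 1` one has `δ_q(0) > 0`, so the real power is analytic at `0`. -/
def lubichCoeff (q : ℕ) (θ : ℝ) (k : ℕ) : ℝ :=
  iteratedDeriv k (fun z : ℝ => bdfPoly q z ^ θ) 0 / (k.factorial : ℝ)

/-- The corrected operator `𝒜_q^θ` at `t_n = n τ`, for a function given on `[0, T]`. -/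
def lubichCaputo (T : ℝ) (q : ℕ) (θ τ : ℝ) (f : ℝ → ℝ) (n : ℕ) : ℝ :=
  (1 / τ ^ θ) * ∑ k ∈ Finset.range (n + 1),
      lubichCoeff q θ k * f (((n - k : ℕ) : ℝ) * τ)
    - (1 / τ ^ θ) * ∑ l ∈ Finset.range ⌈θ⌉₊, ∑ k ∈ Finset.range (n + 1),
      lubichCoeff q θ k * timeDeriv T l f 0 * (((n - k : ℕ) : ℝ) * τ) ^ l / (l.factorial : ℝ)

end CaputoLubich

end

noncomputable section

namespace CaputoLubich

open Finset Filter Topology PowerSeries MeasureTheory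

/-! ### Taylor series at the origin -/

/-! Let `P = q + m - 1` and let `E_l` (`errKernel`) be the error, with unit step, of the convolution
quadrature for the fractional derivative of `x^l`. The correction terms of the operator remove the
Taylor polynomial of `u` of degree `< m`. Taylor's formula, with fractional remainder for the Caputo
derivative and classical remainder for the quadrature, then gives by scaling
(`caputo_sub_lubichCaputo`) that the error at `t_n` is `∑_{m ≤ l < m+q} u^{(l)}(0)/l! · τ^{l-θ}
E_l(n)` plus `τ^{P-θ}/P! · ∫_0^{t_n} E_P((t_n - s)/τ) u^{(q+m)}(s) ds`. Everything reduces to the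
size of `E_l`.

At integers, `∑_k ω_k (n-k)^l` has generating function `δ_q(z)^θ ∑_n n^l z^n`. Put `w = 1 - z` and
`t = -log(1 - w)`. Then `δ_q^θ` agrees with `t^θ` to relative order `w^q`, and `∑ n^l z^n` with `l!
t^{-l-1}` to relative order `w^{l+1}`. For noninteger `θ` the exact value `l! n^{l-θ}/Γ(l+1-θ)` has
the expansion of `l! t^{θ-l-1}`. The first `min(q, l+1)` terms cancel, so `E_l(n) =
O(n^{l-θ-min(q,l+1)})`. The transfer from functions to coefficients uses no complex analysis:
`HasExp` records expansions in the scale `[z^n](1-z)^{c+i}`, and the only analytic input on `δ_q` is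
that the coefficients of `(δ_q/(1-z))^θ` decay geometrically (`geomDecay_bdfQuotSeries`), which is
where `q ≤ 5` enters.

For `θ = m` the weights vanish beyond `mq`; there `E_l(n)` is a polynomial in `n` tending to `0`,
hence zero for `l < q + m` (`errKernel_natCast_eq_zero`).

Between integers, the relation `E_{l+1}' = (l+1) E_l` carries the bounds over: `|E_P(x)| ≤ K
x^{m-1-θ}` for noninteger `θ`, and `E_P` is bounded with bounded support for `θ = m`. As `m-1-θ >
-1` in the first case, the integral term is always `O(τ^q)`. The monomial terms are `O(t_n^{l-θ-q}
τ^q)` for `l ≥ q-1` (part 1), absent (part 2), or zero (part 3). -/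

/-- The formal Taylor series at `0` of a real function. -/
def taylorSeries (f : ℝ → ℝ) : ℝ⟦X⟧ :=
  PowerSeries.mk fun n => iteratedDeriv n f 0 / (n.factorial : ℝ)

lemma coeff_taylorSeries (f : ℝ → ℝ) (n : ℕ) :
    coeff n (taylorSeries f) = iteratedDeriv n f 0 / (n.factorial : ℝ) := by
  simp [taylorSeries]

lemma constantCoeff_taylorSeries (f : ℝ → ℝ) : constantCoeff (taylorSeries f) = f 0 := by
  rw [← coeff_zero_eq_constantCoeff_apply, coeff_taylorSeries]; simp

lemma taylorSeries_congr {f g : ℝ → ℝ} (h : f =ᶠ[𝓝 0] g) : taylorSeries f = taylorSeries g := by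
  ext n
  rw [coeff_taylorSeries, coeff_taylorSeries, h.iteratedDeriv_eq]

lemma taylorSeries_deriv (f : ℝ → ℝ) :
    taylorSeries (deriv f) = derivative ℝ (taylorSeries f) := by
  ext n
  rw [coeff_derivative, coeff_taylorSeries, coeff_taylorSeries, iteratedDeriv_succ',
    Nat.factorial_succ]
  push_cast
  field_simp

lemma taylorSeries_mul {f g : ℝ → ℝ} (hf : AnalyticAt ℝ f 0) (hg : AnalyticAt ℝ g 0) :
    taylorSeries (fun x => f x * g x) = taylorSeries f * taylorSeries g := by
  ext n
  rw [coeff_mul, coeff_taylorSeries, iteratedDeriv_fun_mul hf.contDiffAt hg.contDiffAt,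
    Nat.sum_antidiagonal_eq_sum_range_succ_mk, Finset.sum_div]
  refine Finset.sum_congr rfl fun i hi => ?_
  have hin : i ≤ n := by simpa [Nat.lt_succ_iff] using hi
  rw [coeff_taylorSeries, coeff_taylorSeries, Nat.cast_choose ℝ hin]
  have h1 : ((n.factorial : ℕ) : ℝ) ≠ 0 := by positivity
  have h2 : ((i.factorial : ℕ) : ℝ) ≠ 0 := by positivity
  have h3 : (((n - i).factorial : ℕ) : ℝ) ≠ 0 := by positivity
  field_simp

lemma taylorSeries_add {f g : ℝ → ℝ} (hf : AnalyticAt ℝ f 0) (hg : AnalyticAt ℝ g 0) :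
    taylorSeries (fun x => f x + g x) = taylorSeries f + taylorSeries g := by
  ext n
  have := iteratedDeriv_add (n := n) (hf.contDiffAt) (hg.contDiffAt)
  rw [map_add, coeff_taylorSeries, coeff_taylorSeries, coeff_taylorSeries, ← add_div, ← this]
  rfl

lemma taylorSeries_const (c : ℝ) : taylorSeries (fun _ => c) = C c := by
  ext n
  rw [coeff_taylorSeries, coeff_C]
  rcases n with _ | n
  · simp
  · simp [iteratedDeriv_const]

lemma taylorSeries_id : taylorSeries (fun x => x) = X := by
  ext n
  rcases n with _ | _ | n
  · simp [coeff_taylorSeries]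
  · simp [coeff_taylorSeries, coeff_X]
  · have h1 : deriv (fun x : ℝ => x) = fun _ => 1 := by ext x; simp
    rw [coeff_taylorSeries, coeff_X, iteratedDeriv_succ', h1]
    simp [iteratedDeriv_const]

lemma taylorSeries_const_mul (c : ℝ) {f : ℝ → ℝ} (hf : AnalyticAt ℝ f 0) :
    taylorSeries (fun x => c * f x) = C c * taylorSeries f := by
  rw [taylorSeries_mul analyticAt_const hf, taylorSeries_const]

lemma hasFPowerSeriesAt_taylorSeries {f : ℝ → ℝ} (hf : AnalyticAt ℝ f 0) :
    HasFPowerSeriesAt f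
      (FormalMultilinearSeries.ofScalars ℝ fun n => coeff n (taylorSeries f)) 0 := by
  simpa [coeff_taylorSeries] using hf.hasFPowerSeriesAt

lemma isBigO_taylorSeries {f : ℝ → ℝ} (hf : AnalyticAt ℝ f 0) (M : ℕ) :
    (fun x => f x - ∑ i ∈ range M, coeff i (taylorSeries f) * x ^ i) =O[𝓝 0]
      fun x => x ^ M := by
  have h := (hasFPowerSeriesAt_taylorSeries hf).isBigO_sub_partialSum_pow M
  have h2 : (fun x => f x - ∑ i ∈ range M, coeff i (taylorSeries f) * x ^ i) =
      fun y => f (0 + y) - (FormalMultilinearSeries.ofScalars ℝ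
        fun n => coeff n (taylorSeries f)).partialSum M y := by
    ext y
    simp [FormalMultilinearSeries.partialSum, mul_comm]
  rw [h2]
  refine h.trans (Asymptotics.IsBigO.of_norm_norm ?_)
  simp only [norm_pow, norm_norm]
  exact Asymptotics.isBigO_refl _ _

/-- A polynomial of degree `< M` that is `O(x ^ M)` as `x → 0+` vanishes. -/
lemma coeff_eq_zero_of_isBigO {a : ℕ → ℝ} {M : ℕ}
    (h : (fun x : ℝ => ∑ i ∈ range M, a i * x ^ i) =O[𝓝[>] 0] fun x => x ^ M) :
    ∀ i < M, a i = 0 := by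
  intro i
  induction i using Nat.strong_induction_on with
  | _ i ih =>
  intro hi
  -- The lower coefficients vanish by induction, so `x^i` factors out; dividing by it and letting `x
  -- → 0+` isolates `a i`.
  have h1 : (fun x : ℝ => ∑ j ∈ range M, a j * x ^ j) =
      fun x => x ^ i * ∑ j ∈ range (M - i), a (i + j) * x ^ j := by
    ext x
    have : M = i + (M - i) := by omega
    conv_lhs => rw [this, Finset.sum_range_add]
    rw [Finset.sum_eq_zero, zero_add, Finset.mul_sum]
    · refine Finset.sum_congr rfl fun j _ => ?_
      rw [pow_add]; ring
    · intro j hj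
      rw [ih j (Finset.mem_range.1 hj) (by have := Finset.mem_range.1 hj; omega), zero_mul]
  rw [h1] at h
  have h2 : (fun x : ℝ => ∑ j ∈ range (M - i), a (i + j) * x ^ j) =O[𝓝[>] 0]
      fun x => x ^ (M - i) := by
    have h3 := (Asymptotics.isBigO_refl (fun x : ℝ => (x ^ i)⁻¹) (𝓝[>] 0)).mul h
    refine (h3.congr' ?_ ?_)
    · filter_upwards [self_mem_nhdsWithin] with x hx
      have : x ≠ 0 := ne_of_gt hx
      field_simp
    · filter_upwards [self_mem_nhdsWithin] with x hx
      have : x ≠ 0 := ne_of_gt hx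
      rw [← pow_sub_mul_pow x hi.le]
      field_simp
  have hlim : Tendsto (fun x : ℝ => x ^ (M - i)) (𝓝[>] 0) (𝓝 0) := by
    have : Tendsto (fun x : ℝ => x ^ (M - i)) (𝓝 0) (𝓝 (0 ^ (M - i))) :=
      (continuous_pow _).tendsto 0
    rw [zero_pow (by omega)] at this
    exact this.mono_left nhdsWithin_le_nhds
  have hz := h2.trans_tendsto hlim
  have hc : Tendsto (fun x : ℝ => ∑ j ∈ range (M - i), a (i + j) * x ^ j) (𝓝[>] 0)
      (𝓝 (∑ j ∈ range (M - i), a (i + j) * 0 ^ j)) := by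
    have : Continuous (fun x : ℝ => ∑ j ∈ range (M - i), a (i + j) * x ^ j) := by fun_prop
    exact (this.tendsto 0).mono_left nhdsWithin_le_nhds
  have := tendsto_nhds_unique hc hz
  obtain ⟨k, hk⟩ : ∃ k, M - i = k + 1 := ⟨M - i - 1, by omega⟩
  rw [hk, Finset.sum_range_succ'] at this
  simpa using this

lemma analyticAt_rpow_const {f : ℝ → ℝ} {x : ℝ} (hf : AnalyticAt ℝ f x) (h : 0 < f x) (c : ℝ) :
    AnalyticAt ℝ (fun y => f y ^ c) x := by
  have h1 : AnalyticAt ℝ (fun y => Real.exp (Real.log (f y) * c)) x :=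
    ((hf.log h).mul analyticAt_const).rexp
  refine h1.congr ?_
  filter_upwards [hf.continuousAt.eventually (lt_mem_nhds h)] with y hy
  rw [Real.rpow_def_of_pos hy]

/-- The differential equation `f · (f ^ c)' = c f' · f ^ c` for Taylor series. -/
lemma taylorSeries_rpow_ode {f : ℝ → ℝ} (hf : AnalyticAt ℝ f 0) (h : 0 < f 0) (c : ℝ) :
    taylorSeries f * derivative ℝ (taylorSeries fun y => f y ^ c) =
      C c * derivative ℝ (taylorSeries f) * taylorSeries fun y => f y ^ c := by
  have hc := analyticAt_rpow_const hf h c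
  rw [← taylorSeries_deriv, ← taylorSeries_deriv, ← taylorSeries_mul hf hc.deriv,
    ← taylorSeries_const_mul c hf.deriv,
    ← taylorSeries_mul (f := fun x => c * deriv f x) (analyticAt_const.mul hf.deriv) hc]
  apply taylorSeries_congr
  filter_upwards [hf.continuousAt.eventually (lt_mem_nhds h), hf.eventually_analyticAt] with y hy hay
  have := (hay.differentiableAt.hasDerivAt.rpow_const (p := c) (Or.inl hy.ne')).deriv
  rw [this, Real.rpow_sub_one hy.ne']
  field_simp

lemma taylorSeries_rpow_add {f : ℝ → ℝ} (hf : AnalyticAt ℝ f 0) (h : 0 < f 0) (c d : ℝ) :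
    taylorSeries (fun y => f y ^ (c + d)) =
      taylorSeries (fun y => f y ^ c) * taylorSeries fun y => f y ^ d := by
  rw [← taylorSeries_mul (analyticAt_rpow_const hf h c) (analyticAt_rpow_const hf h d)]
  apply taylorSeries_congr
  filter_upwards [hf.continuousAt.eventually (lt_mem_nhds h)] with y hy
  rw [Real.rpow_add hy]

/-- The first `q` coefficients of a solution of `f Y' = c f' Y` depend only on those of `f`. -/
lemma coeff_eq_of_ode {f g Y Z : ℝ⟦X⟧} {c : ℝ} {q : ℕ}
    (hfg : ∀ n < q, coeff n f = coeff n g) (hf0 : coeff 0 f ≠ 0) (h0 : coeff 0 Y = coeff 0 Z)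
    (hY : f * derivative ℝ Y = C c * derivative ℝ f * Y)
    (hZ : g * derivative ℝ Z = C c * derivative ℝ g * Z) :
    ∀ n < q, coeff n Y = coeff n Z := by
  intro n
  induction n using Nat.strong_induction_on with
  | _ n ih =>
  intro hn
  rcases n with _ | n
  · exact h0
  -- Coefficient `n` of the equation, solved for the `k = 0` term on the left: it determines
  -- `Y_{n+1}` from `f_0, …, f_{n+1}` and `Y_0, …, Y_n`.
  have key : ∀ {f Y : ℝ⟦X⟧}, f * derivative ℝ Y = C c * derivative ℝ f * Y →
      coeff 0 f * (coeff (n + 1) Y * (n + 1)) =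
        (∑ k ∈ range (n + 1), c * (coeff (k + 1) f * (k + 1)) * coeff (n - k) Y) -
        ∑ k ∈ range n, coeff (k + 1) f * (coeff (n - (k + 1) + 1) Y * ((n - (k + 1) : ℕ) + 1)) := by
    intro f Y h
    have h1 := congrArg (coeff n) h
    rw [mul_assoc, coeff_C_mul, coeff_mul, coeff_mul, Nat.sum_antidiagonal_eq_sum_range_succ_mk,
      Nat.sum_antidiagonal_eq_sum_range_succ_mk, Finset.sum_range_succ', Finset.mul_sum] at h1
    simp only [coeff_derivative, Nat.sub_zero] at h1
    simp only [mul_assoc] at h1 ⊢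
    linarith
  have e1 := key hY
  have e2 := key hZ
  have : coeff 0 f * (coeff (n + 1) Y * (n + 1)) = coeff 0 f * (coeff (n + 1) Z * (n + 1)) := by
    rw [e1, hfg 0 (by omega), e2]
    congr 1
    · refine Finset.sum_congr rfl fun k hk => ?_
      have := Finset.mem_range.1 hk
      rw [hfg _ (by omega), ih _ (by omega) (by omega)]
    · refine Finset.sum_congr rfl fun k hk => ?_
      have := Finset.mem_range.1 hk
      rw [hfg _ (by omega), ih _ (by omega) (by omega)]
  have hn1 : (n : ℝ) + 1 ≠ 0 := by positivity
  exact mul_right_cancel₀ hn1 (mul_left_cancel₀ hf0 this)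

/-! ### Coefficients of real powers of `1 - z` -/

/-- The coefficient of `z ^ n` in `(1 - z) ^ e`. -/
def binCoeff (e : ℝ) (n : ℕ) : ℝ := ∏ i ∈ range n, ((i : ℝ) - e) / (i + 1)

@[simp] lemma binCoeff_zero (e : ℝ) : binCoeff e 0 = 1 := by simp [binCoeff]

lemma binCoeff_succ (e : ℝ) (n : ℕ) :
    binCoeff e (n + 1) = binCoeff e n * (((n : ℝ) - e) / (n + 1)) := by
  rw [binCoeff, Finset.prod_range_succ, ← binCoeff]

lemma mul_binCoeff_sub_one (e : ℝ) (n : ℕ) : e * binCoeff (e - 1) n = (e - n) * binCoeff e n := by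
  induction n with
  | zero => simp
  | succ n ih =>
    rw [binCoeff_succ, binCoeff_succ, ← mul_assoc, ih]
    have : (n : ℝ) + 1 ≠ 0 := by positivity
    push_cast
    field_simp
    ring

/-- Coefficient form of `z d/dz (1-z)^e = -e (1-z)^{e-1} + e (1-z)^e`. -/
lemma natCast_mul_binCoeff (e : ℝ) (n : ℕ) :
    (n : ℝ) * binCoeff e n = -e * binCoeff (e - 1) n + e * binCoeff e n := by
  linarith [mul_binCoeff_sub_one e n]

lemma binCoeff_natCast_eq_zero {k n : ℕ} (h : k < n) : binCoeff (k : ℝ) n = 0 :=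
  Finset.prod_eq_zero (Finset.mem_range.2 h) (by simp)

lemma binCoeff_neg_one (n : ℕ) : binCoeff (-1) n = 1 := by
  refine Finset.prod_eq_one fun i _ => ?_
  have : (i : ℝ) + 1 ≠ 0 := by positivity
  rw [sub_neg_eq_add, div_self this]

lemma taylorSeries_one_sub_rpow (e : ℝ) :
    taylorSeries (fun z => (1 - z) ^ e) = PowerSeries.mk (binCoeff e) := by
  have ha : AnalyticAt ℝ (fun z : ℝ => 1 - z) 0 := analyticAt_const.sub analyticAt_id
  have hT : taylorSeries (fun z : ℝ => 1 - z) = 1 - X := by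
    have h := taylorSeries_add (f := fun _ => 1) (g := fun z : ℝ => -1 * z) analyticAt_const
      (analyticAt_const.mul analyticAt_id)
    rw [taylorSeries_const_mul (f := fun z => z) _ analyticAt_id, taylorSeries_id,
      taylorSeries_const] at h
    have h2 : (fun z : ℝ => 1 - z) = fun z => 1 + -1 * z := by ext; ring
    rw [h2, h]
    simp [sub_eq_add_neg]
  have h := taylorSeries_rpow_ode ha (by norm_num) e
  rw [hT] at h
  ext n
  rw [coeff_mk]
  induction n with
  | zero => simp [coeff_taylorSeries]
  | succ n ih =>
    have h1 := congrArg (coeff n) h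
    have h2 : derivative ℝ (1 - X : ℝ⟦X⟧) = -1 := by
      rw [map_sub, derivative_X]; simp
    rw [h2, mul_assoc, coeff_C_mul, neg_one_mul, sub_mul, one_mul, map_sub, map_neg,
      coeff_derivative, ih] at h1
    have h3 : coeff n (X * derivative ℝ (taylorSeries fun z : ℝ => (1 - z) ^ e)) =
        n * binCoeff e n := by
      rcases n with _ | n
      · simp
      · rw [coeff_succ_X_mul, coeff_derivative, ih]; push_cast; ring
    rw [h3] at h1
    rw [binCoeff_succ]
    have : (n : ℝ) + 1 ≠ 0 := by positivity
    field_simp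
    linarith

/-- The formal power series of `(1 - z) ^ e`. -/
def binSeries (e : ℝ) : ℝ⟦X⟧ := PowerSeries.mk (binCoeff e)

@[simp] lemma coeff_binSeries (e : ℝ) (n : ℕ) : coeff n (binSeries e) = binCoeff e n := by
  simp [binSeries]

lemma binSeries_add (a b : ℝ) : binSeries (a + b) = binSeries a * binSeries b := by
  have ha : AnalyticAt ℝ (fun z : ℝ => 1 - z) 0 := analyticAt_const.sub analyticAt_id
  rw [binSeries, binSeries, binSeries, ← taylorSeries_one_sub_rpow, ← taylorSeries_one_sub_rpow,
    ← taylorSeries_one_sub_rpow]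
  exact taylorSeries_rpow_add ha (by norm_num) a b

lemma binSeries_one : binSeries 1 = 1 - X := by
  ext n
  rcases n with _ | _ | n
  · simp
  · simp [binCoeff, coeff_X, coeff_one]
  · have := binCoeff_natCast_eq_zero (k := 1) (n := n + 2) (by omega)
    simp only [Nat.cast_one] at this
    simp [this, coeff_X, coeff_one]

lemma binSeries_add_one (e : ℝ) : binSeries (e + 1) = (1 - X) * binSeries e := by
  rw [binSeries_add, binSeries_one, mul_comm]

lemma binSeries_add_natCast (e : ℝ) (k : ℕ) :
    binSeries (e + k) = (1 - X) ^ k * binSeries e := by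
  induction k with
  | zero => simp
  | succ k ih => rw [Nat.cast_succ, ← add_assoc, binSeries_add_one, ih, pow_succ']; ring

lemma binSeries_zero : binSeries 0 = 1 := by
  ext n
  rcases n with _ | n
  · simp
  · have := binCoeff_natCast_eq_zero (k := 0) (n := n + 1) (by omega)
    simp only [Nat.cast_zero] at this
    simp [this, coeff_one]

lemma exists_bound_of_eventually_bound {a : ℕ → ℝ} {s K : ℝ} {n₀ : ℕ}
    (h : ∀ n, n₀ ≤ n → |a n| ≤ K * ((n : ℝ) + 1) ^ s) :
    ∃ K', ∀ n, |a n| ≤ K' * ((n : ℝ) + 1) ^ s := by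
  set L := ∑ j ∈ range n₀, |a j| / ((j : ℝ) + 1) ^ s with hL
  have hL0 : 0 ≤ L := Finset.sum_nonneg fun j _ => by positivity
  refine ⟨|K| + L, fun n => ?_⟩
  have hp : (0 : ℝ) < ((n : ℝ) + 1) ^ s := by positivity
  rw [add_mul]
  rcases lt_or_ge n n₀ with hn | hn
  · have : |a n| / ((n : ℝ) + 1) ^ s ≤ L :=
      Finset.single_le_sum (f := fun j : ℕ => |a j| / ((j : ℝ) + 1) ^ s)
        (fun j _ => by positivity) (Finset.mem_range.2 hn)
    rw [div_le_iff₀ hp] at this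
    have := mul_nonneg (abs_nonneg K) hp.le
    linarith
  · have h1 := h n hn
    have h2 := mul_le_mul_of_nonneg_right (le_abs_self K) hp.le
    have := mul_nonneg hL0 hp.le
    linarith

/-- The ratio of consecutive coefficients is `(n-e)/(n+1) = 1 + (-e-1)/(n+1) ≤ exp((-e-1)/(n+1))`,
which is compared with the ratio of consecutive powers of exponent `-e-1`. Only this upper bound is
needed, so natural `e`, where the coefficients eventually vanish, requires no separate treatment. -/
lemma exists_abs_binCoeff_le (e : ℝ) :
    ∃ C, 0 ≤ C ∧ ∀ n : ℕ, |binCoeff e n| ≤ C * ((n : ℝ) + 1) ^ (-e - 1) := by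
  obtain ⟨n₀, hn₀⟩ := exists_nat_ge (|e| + 1)
  have hn₀1 : (1 : ℝ) ≤ n₀ := le_trans (by linarith [abs_nonneg e]) hn₀
  -- a comparison of consecutive terms
  have hlog : ∀ x : ℝ, 0 < x → 1 / (x + 1) ≤ Real.log ((x + 1) / x) := by
    intro x hx
    have := Real.one_sub_inv_le_log_of_pos (x := (x + 1) / x) (by positivity)
    refine le_trans (le_of_eq ?_) this
    rw [inv_div]; field_simp; ring
  have hlog' : ∀ x : ℝ, 0 < x → Real.log ((x + 1) / x) ≤ 1 / x := by
    intro x hx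
    have := Real.log_le_sub_one_of_pos (x := (x + 1) / x) (by positivity)
    refine le_trans this (le_of_eq ?_)
    field_simp; ring
  -- the sequence `|b_n| (n + s) ^ (e + 1)` is eventually decreasing, for `s = 1` or `s = 0`
  obtain ⟨s, hs, hs1, hstep⟩ : ∃ s : ℝ, 0 ≤ s ∧ s ≤ 1 ∧ ∀ n : ℕ, n₀ ≤ n →
      ((n : ℝ) - e) / (n + 1) ≤ ((n + 1 + s) / (n + s)) ^ (-e - 1) := by
    have hbase : ∀ n : ℕ, n₀ ≤ n → ((n : ℝ) - e) / (n + 1) ≤ Real.exp ((-e - 1) / (n + 1)) := by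
      intro n hn
      refine le_trans (le_of_eq ?_) (Real.add_one_le_exp _)
      field_simp; ring
    -- The sign of the exponent decides which logarithmic inequality is usable: `1/(n+1) ≤
    -- log((n+1)/n)` gives the shift `s = 0`, and `log((n+2)/(n+1)) ≤ 1/(n+1)` gives `s = 1`.
    rcases le_total 0 (-e - 1) with he | he
    · refine ⟨0, le_rfl, zero_le_one, fun n hn => (hbase n hn).trans ?_⟩
      have hn' : (0 : ℝ) < n := lt_of_lt_of_le (by linarith) (Nat.cast_le.2 hn)
      rw [Real.rpow_def_of_pos (by positivity)]
      apply Real.exp_le_exp.2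
      have := hlog n hn'
      simp only [add_zero]
      calc (-e - 1) / ((n : ℝ) + 1) = (-e - 1) * (1 / (n + 1)) := by ring
        _ ≤ (-e - 1) * Real.log ((n + 1) / n) := by gcongr
        _ = _ := mul_comm _ _
    · refine ⟨1, zero_le_one, le_rfl, fun n hn => (hbase n hn).trans ?_⟩
      rw [Real.rpow_def_of_pos (by positivity)]
      apply Real.exp_le_exp.2
      have := hlog' ((n : ℝ) + 1) (by positivity)
      calc (-e - 1) / ((n : ℝ) + 1) = (-e - 1) * (1 / (n + 1)) := by ring
        _ ≤ (-e - 1) * Real.log ((n + 1 + 1) / (n + 1)) := mul_le_mul_of_nonpos_left this he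
        _ = _ := mul_comm _ _
  have hdec : ∀ k : ℕ, |binCoeff e (n₀ + k)| ≤
      |binCoeff e n₀| * (((n₀ + k : ℕ) + s) / (n₀ + s)) ^ (-e - 1) := by
    intro k
    induction k with
    | zero =>
      have : (n₀ : ℝ) + s ≠ 0 := by positivity
      simp [div_self this]
    | succ k ih =>
      rw [← add_assoc, binCoeff_succ, abs_mul]
      have hpos : (0 : ℝ) ≤ (((n₀ + k : ℕ) : ℝ) - e) / ((n₀ + k : ℕ) + 1) := by
        have : (n₀ : ℝ) ≤ (n₀ + k : ℕ) := by exact_mod_cast Nat.le_add_right _ _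
        apply div_nonneg _ (by positivity)
        linarith [le_abs_self e]
      rw [abs_of_nonneg hpos]
      have hst := hstep (n₀ + k) (Nat.le_add_right _ _)
      refine (mul_le_mul ih hst hpos (by positivity)).trans (le_of_eq ?_)
      rw [mul_assoc, ← Real.mul_rpow (by positivity) (by positivity)]
      congr 2
      have h1 : (n₀ : ℝ) + s ≠ 0 := by positivity
      have h2 : (((n₀ + k : ℕ) : ℝ)) + s ≠ 0 := by push_cast; positivity
      push_cast at h2 ⊢
      field_simp
  -- compare `n + s` with `n + 1`
  have hcomp : ∀ n : ℕ, n₀ ≤ n → (((n : ℝ) + s) / (n₀ + s)) ^ (-e - 1) ≤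
      (2 ^ |(-e - 1)| * ((n₀ : ℝ) + s) ^ (-(-e - 1))) * ((n : ℝ) + 1) ^ (-e - 1) := by
    intro n hn
    have hn' : (1 : ℝ) ≤ n := hn₀1.trans (Nat.cast_le.2 hn)
    rw [Real.div_rpow (by positivity) (by positivity),
      Real.rpow_neg (x := (n₀ : ℝ) + s) (by positivity)]
    have : ((n : ℝ) + s) ^ (-e - 1) ≤ 2 ^ |(-e - 1)| * ((n : ℝ) + 1) ^ (-e - 1) := by
      rcases le_total 0 (-e - 1) with he | he
      · calc ((n : ℝ) + s) ^ (-e - 1) ≤ ((n : ℝ) + 1) ^ (-e - 1) := by gcongr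
          _ ≤ _ := le_mul_of_one_le_left (by positivity)
              (Real.one_le_rpow (by norm_num) (abs_nonneg _))
      · rw [abs_of_nonpos he, Real.rpow_neg (by norm_num), inv_mul_eq_div,
          ← Real.div_rpow (by positivity) (by norm_num)]
        exact Real.rpow_le_rpow_of_nonpos (by positivity) (by linarith) he
    calc ((n : ℝ) + s) ^ (-e - 1) / ((n₀ : ℝ) + s) ^ (-e - 1)
        ≤ (2 ^ |(-e - 1)| * ((n : ℝ) + 1) ^ (-e - 1)) / ((n₀ : ℝ) + s) ^ (-e - 1) := by gcongr
      _ = _ := by ring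
  set K := |binCoeff e n₀| * (2 ^ |(-e - 1)| * ((n₀ : ℝ) + s) ^ (-(-e - 1))) with hK
  suffices h : ∀ n, n₀ ≤ n → |binCoeff e n| ≤ K * ((n : ℝ) + 1) ^ (-e - 1) by
    obtain ⟨C, hC⟩ := exists_bound_of_eventually_bound h
    exact ⟨C, by simpa using (abs_nonneg _).trans (hC 0), hC⟩
  intro n hn
  obtain ⟨k, rfl⟩ := Nat.exists_eq_add_of_le hn
  refine (hdec k).trans
    ((mul_le_mul_of_nonneg_left (hcomp (n₀ + k) hn) (abs_nonneg _)).trans (le_of_eq ?_))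
  rw [hK]; ring

/-! ### Power series with geometrically decaying coefficients -/

/-- The coefficients of the power series decay geometrically. -/
def GeomDecay (Y : ℝ⟦X⟧) : Prop :=
  ∃ A κ : ℝ, 0 < κ ∧ κ < 1 ∧ ∀ n, |coeff n Y| ≤ A * κ ^ n

/-- The sum of a power series at `z`. -/
def seriesSum (Y : ℝ⟦X⟧) (z : ℝ) : ℝ := ∑' n, coeff n Y * z ^ n

lemma GeomDecay.summable {Y : ℝ⟦X⟧} (h : GeomDecay Y) {z : ℝ} (hz : |z| ≤ 1) :
    Summable fun n => coeff n Y * z ^ n := by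
  obtain ⟨A, κ, hκ0, hκ1, hA⟩ := h
  refine Summable.of_norm_bounded (g := fun n => A * κ ^ n)
    ((summable_geometric_of_lt_one hκ0.le hκ1).mul_left A) fun n => ?_
  rw [norm_mul, norm_pow, Real.norm_eq_abs, Real.norm_eq_abs]
  exact (mul_le_of_le_one_right (abs_nonneg _) (pow_le_one₀ (abs_nonneg _) hz)).trans (hA n)

lemma GeomDecay.exists_bound {Y : ℝ⟦X⟧} (h : GeomDecay Y) :
    ∃ B, ∀ z, |z| ≤ 1 → |seriesSum Y z| ≤ B := by
  obtain ⟨A, κ, hκ0, hκ1, hA⟩ := h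
  refine ⟨∑' n, A * κ ^ n, fun z hz => ?_⟩
  refine tsum_of_norm_bounded (f := fun n => coeff n Y * z ^ n)
    ((summable_geometric_of_lt_one hκ0.le hκ1).mul_left A).hasSum fun n => ?_
  rw [norm_mul, norm_pow, Real.norm_eq_abs, Real.norm_eq_abs]
  exact (mul_le_of_le_one_right (abs_nonneg _) (pow_le_one₀ (abs_nonneg _) hz)).trans (hA n)

/-- Dividing a geometrically decaying series minus its value at `1` by `1 - z`. -/
lemma GeomDecay.exists_tail {Y : ℝ⟦X⟧} (h : GeomDecay Y) :
    ∃ (s : ℝ) (Z : ℝ⟦X⟧), GeomDecay Z ∧ Y = C s + (1 - X) * Z ∧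
      ∀ z, |z| ≤ 1 → seriesSum Y z = s + (1 - z) * seriesSum Z z := by
  have hs : Summable fun n => coeff n Y := by simpa using h.summable (z := 1) (by simp)
  have h' := h
  obtain ⟨A, κ, hκ0, hκ1, hA⟩ := h
  set y : ℕ → ℝ := fun n => coeff n Y with hy
  -- The `n`-th coefficient of `(Y(z) - Y(1))/(1-z)` is `∑_{k ≤ n} y_k - Y(1)`, that is, minus a
  -- tail; tails inherit the geometric decay.
  set t : ℕ → ℝ := fun n => -∑' k, y (k + (n + 1)) with ht
  have hss : ∀ n, Summable fun k => y (k + n) := fun n => (summable_nat_add_iff n).2 hs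
  have ht0 : y 0 = (∑' n, y n) + t 0 := by
    rw [hs.tsum_eq_zero_add]; simp [ht]
  have hts : ∀ n, y (n + 1) = t (n + 1) - t n := by
    intro n
    have := (hss (n + 1)).tsum_eq_zero_add
    simp only [ht]
    rw [this]
    simp only [zero_add]
    have e : ∀ k, k + 1 + (n + 1) = k + (n + 1 + 1) := fun k => by ring
    simp only [e]
    ring
  have hZ : GeomDecay (PowerSeries.mk t) := by
    refine ⟨A * κ / (1 - κ), κ, hκ0, hκ1, fun n => ?_⟩
    rw [coeff_mk, ht, abs_neg]
    have hg : HasSum (fun k => A * κ ^ (n + 1) * κ ^ k) (A * κ ^ (n + 1) * (1 - κ)⁻¹) :=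
      (hasSum_geometric_of_lt_one hκ0.le hκ1).mul_left _
    refine (tsum_of_norm_bounded (f := fun k => y (k + (n + 1))) hg fun k => ?_).trans
      (le_of_eq ?_)
    · refine (hA _).trans (le_of_eq ?_)
      rw [pow_add κ k]; ring
    · rw [pow_succ]; ring
  refine ⟨∑' n, y n, PowerSeries.mk t, hZ, ?_, ?_⟩
  · ext n
    rcases n with _ | n
    · simpa [sub_mul, hy] using ht0
    · rw [sub_mul, one_mul, map_add, map_sub, coeff_succ_X_mul, coeff_C]
      simpa using hts n
  · intro z hz
    have hs1 := h'.summable hz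
    have hs2 := hZ.summable hz
    simp only [coeff_mk] at hs2
    have hs3 : Summable fun n => t n * z ^ (n + 1) := by
      simpa [pow_succ, mul_assoc, mul_comm, mul_left_comm] using hs2.mul_left z
    have hs4 : Summable fun n => t (n + 1) * z ^ (n + 1) :=
      (summable_nat_add_iff (f := fun n => t n * z ^ n) 1).2 hs2
    have e1 : seriesSum Y z = y 0 + ∑' n, y (n + 1) * z ^ (n + 1) := by
      rw [seriesSum, hs1.tsum_eq_zero_add]; simp [hy]
    have e2 : seriesSum (PowerSeries.mk t) z = t 0 + ∑' n, t (n + 1) * z ^ (n + 1) := by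
      simp only [seriesSum, coeff_mk]
      rw [hs2.tsum_eq_zero_add]; simp
    have e3 : z * seriesSum (PowerSeries.mk t) z = ∑' n, t n * z ^ (n + 1) := by
      simp only [seriesSum, coeff_mk]
      rw [← tsum_mul_left]
      exact tsum_congr fun n => by rw [pow_succ]; ring
    have e4 : ∑' n, y (n + 1) * z ^ (n + 1) =
        (∑' n, t (n + 1) * z ^ (n + 1)) - ∑' n, t n * z ^ (n + 1) := by
      rw [← hs4.tsum_sub hs3]
      exact tsum_congr fun n => by rw [hts n]; ring
    rw [sub_mul, one_mul, e3, e1, e4, e2, ht0]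
    ring

/-- Expansion of a geometrically decaying series in powers of `1 - z`. -/
lemma GeomDecay.exists_expansion {Y : ℝ⟦X⟧} (h : GeomDecay Y) (M : ℕ) :
    ∃ (γ : ℕ → ℝ) (Z : ℝ⟦X⟧), GeomDecay Z ∧
      Y = ∑ i ∈ range M, C (γ i) * (1 - X) ^ i + (1 - X) ^ M * Z ∧
      ∀ z, |z| ≤ 1 → seriesSum Y z =
        ∑ i ∈ range M, γ i * (1 - z) ^ i + (1 - z) ^ M * seriesSum Z z := by
  induction M with
  | zero => exact ⟨0, Y, h, by simp, by simp⟩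
  | succ M ih =>
    obtain ⟨γ, Z, hZ, h1, h2⟩ := ih
    obtain ⟨s, W, hW, h3, h4⟩ := hZ.exists_tail
    refine ⟨fun i => if i = M then s else γ i, W, hW, ?_, fun z hz => ?_⟩
    · rw [h1, h3, Finset.sum_range_succ]
      have : ∑ i ∈ range M, C (if i = M then s else γ i) * (1 - X : ℝ⟦X⟧) ^ i =
          ∑ i ∈ range M, C (γ i) * (1 - X) ^ i :=
        Finset.sum_congr rfl fun i hi => by rw [if_neg (Finset.mem_range.1 hi).ne]
      simp only [this, if_true, pow_succ]
      ring
    · rw [h2 z hz, h4 z hz, Finset.sum_range_succ]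
      have : ∑ i ∈ range M, (if i = M then s else γ i) * (1 - z) ^ i =
          ∑ i ∈ range M, γ i * (1 - z) ^ i :=
        Finset.sum_congr rfl fun i hi => by rw [if_neg (Finset.mem_range.1 hi).ne]
      simp only [this, if_true, pow_succ]
      ring

lemma summable_rpow_mul_geometric {κ : ℝ} (h0 : 0 < κ) (h1 : κ < 1) (s : ℝ) :
    Summable fun k : ℕ => ((k : ℝ) + 1) ^ s * κ ^ k := by
  obtain ⟨N, hN⟩ := exists_nat_ge s
  have h := summable_pow_mul_geometric_of_norm_lt_one (R := ℝ) N (r := κ)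
    (by rwa [Real.norm_of_nonneg h0.le])
  have h2 := ((summable_nat_add_iff 1).2 h).mul_left κ⁻¹
  refine Summable.of_nonneg_of_le (fun k => by positivity) (fun k => ?_) h2
  have : ((k : ℝ) + 1) ^ s ≤ ((k : ℝ) + 1) ^ N := by
    rw [← Real.rpow_natCast]
    exact Real.rpow_le_rpow_of_exponent_le (by linarith [k.cast_nonneg (α := ℝ)]) hN
  calc ((k : ℝ) + 1) ^ s * κ ^ k ≤ ((k : ℝ) + 1) ^ N * κ ^ k := by gcongr
    _ = _ := by push_cast; rw [pow_succ κ]; field_simp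

/-- Rests on `n+1 ≤ (n-k+1)(k+1)`. In a convolution it pulls out `(n+1)^s` at the price of a power
of `k+1`, which a geometric factor absorbs. -/
lemma rpow_sub_add_one_le (s : ℝ) {n k : ℕ} (hk : k ≤ n) :
    (((n - k : ℕ) : ℝ) + 1) ^ s ≤ ((n : ℝ) + 1) ^ s * ((k : ℝ) + 1) ^ |s| := by
  have hk' : (k : ℝ) ≤ n := Nat.cast_le.2 hk
  have hk0 : (0 : ℝ) ≤ k := k.cast_nonneg
  rw [Nat.cast_sub hk]
  rcases le_total 0 s with hs | hs
  · have h1 : ((n : ℝ) - k + 1) ^ s ≤ ((n : ℝ) + 1) ^ s :=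
      Real.rpow_le_rpow (by linarith) (by linarith) hs
    exact h1.trans (le_mul_of_one_le_right (by positivity)
      (Real.one_le_rpow (by linarith) (abs_nonneg _)))
  · rw [abs_of_nonpos hs, Real.rpow_neg (by positivity), ← div_eq_mul_inv,
      ← Real.div_rpow (by positivity) (by positivity)]
    refine Real.rpow_le_rpow_of_nonpos (by positivity) ?_ hs
    rw [div_le_iff₀ (by positivity)]
    nlinarith

/-- Convolution with a geometrically decaying sequence preserves polynomial bounds. -/
lemma GeomDecay.mul_bound {Y Z : ℝ⟦X⟧} (h : GeomDecay Y) {K s : ℝ}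
    (hZ : ∀ n : ℕ, |coeff n Z| ≤ K * ((n : ℝ) + 1) ^ s) :
    ∃ K', ∀ n : ℕ, |coeff n (Y * Z)| ≤ K' * ((n : ℝ) + 1) ^ s := by
  obtain ⟨A, κ, hκ0, hκ1, hA⟩ := h
  have hA0 : 0 ≤ A := by simpa using (abs_nonneg _).trans (hA 0)
  have hK0 : 0 ≤ K := by simpa using (abs_nonneg _).trans (hZ 0)
  have hsum := summable_rpow_mul_geometric hκ0 hκ1 |s|
  refine ⟨A * K * ∑' k : ℕ, ((k : ℝ) + 1) ^ |s| * κ ^ k, fun n => ?_⟩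
  rw [coeff_mul, Nat.sum_antidiagonal_eq_sum_range_succ_mk]
  calc |∑ k ∈ range n.succ, coeff k Y * coeff (n - k) Z|
      ≤ ∑ k ∈ range n.succ, A * K * ((n : ℝ) + 1) ^ s * (((k : ℝ) + 1) ^ |s| * κ ^ k) := by
        refine (Finset.abs_sum_le_sum_abs _ _).trans (Finset.sum_le_sum fun k hk => ?_)
        have hk' : k ≤ n := Nat.lt_succ_iff.1 (Finset.mem_range.1 hk)
        rw [abs_mul]
        calc |coeff k Y| * |coeff (n - k) Z|
            ≤ (A * κ ^ k) * (K * (((n : ℝ) + 1) ^ s * ((k : ℝ) + 1) ^ |s|)) := by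
              refine mul_le_mul (hA k) ((hZ _).trans ?_) (abs_nonneg _) (by positivity)
              exact mul_le_mul_of_nonneg_left (rpow_sub_add_one_le s hk') hK0
          _ = _ := by ring
    _ = A * K * ((n : ℝ) + 1) ^ s * ∑ k ∈ range n.succ, ((k : ℝ) + 1) ^ |s| * κ ^ k := by
        rw [Finset.mul_sum]
    _ ≤ A * K * ((n : ℝ) + 1) ^ s * ∑' k : ℕ, ((k : ℝ) + 1) ^ |s| * κ ^ k := by
        refine mul_le_mul_of_nonneg_left (hsum.sum_le_tsum _ fun k _ => ?_) (by positivity)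
        positivity
    _ = _ := by ring

/-! ### Singular expansions -/

/-- `x` has the full asymptotic expansion `∑ i, f i * [z ^ n] (1 - z) ^ (c + i)`, that is, its
generating function behaves at `z = 1` like `w ^ c * f w`, where `w = 1 - z`. -/
def HasExp (x : ℕ → ℝ) (c : ℝ) (f : ℝ⟦X⟧) : Prop :=
  ∀ M : ℕ, ∃ K, ∀ n : ℕ, |x n - ∑ i ∈ range M, coeff i f * binCoeff (c + i) n| ≤
    K * ((n : ℝ) + 1) ^ (-(c + M) - 1)

lemma HasExp.congr {x y : ℕ → ℝ} {c : ℝ} {f : ℝ⟦X⟧} (h : HasExp x c f) (hxy : ∀ n, x n = y n) :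
    HasExp y c f := by
  rwa [← funext hxy]

lemma HasExp.add {x y : ℕ → ℝ} {c : ℝ} {f g : ℝ⟦X⟧} (hx : HasExp x c f) (hy : HasExp y c g) :
    HasExp (fun n => x n + y n) c (f + g) := by
  intro M
  obtain ⟨K, hK⟩ := hx M
  obtain ⟨L, hL⟩ := hy M
  refine ⟨K + L, fun n => ?_⟩
  rw [add_mul]
  refine le_trans (le_of_eq ?_) ((abs_add_le _ _).trans (add_le_add (hK n) (hL n)))
  congr 1
  simp only [map_add, add_mul, Finset.sum_add_distrib]
  ring

lemma HasExp.const_mul {x : ℕ → ℝ} {c : ℝ} {f : ℝ⟦X⟧} (hx : HasExp x c f) (a : ℝ) :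
    HasExp (fun n => a * x n) c (C a * f) := by
  intro M
  obtain ⟨K, hK⟩ := hx M
  refine ⟨|a| * K, fun n => ?_⟩
  have h : a * x n - ∑ i ∈ range M, coeff i (C a * f) * binCoeff (c + i) n =
      a * (x n - ∑ i ∈ range M, coeff i f * binCoeff (c + i) n) := by
    rw [mul_sub, Finset.mul_sum]
    simp only [coeff_C_mul, mul_assoc]
  rw [h, abs_mul, mul_assoc]
  exact mul_le_mul_of_nonneg_left (hK n) (abs_nonneg _)

lemma HasExp.sub {x y : ℕ → ℝ} {c : ℝ} {f g : ℝ⟦X⟧} (hx : HasExp x c f) (hy : HasExp y c g) :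
    HasExp (fun n => x n - y n) c (f - g) := by
  have := hx.add (hy.const_mul (-1))
  have e : f + C (-1) * g = f - g := by simp [sub_eq_add_neg]
  rw [e] at this
  exact this.congr fun n => by ring

lemma HasExp.zero (c : ℝ) : HasExp (fun _ => 0) c 0 := fun M => ⟨0, fun n => by simp⟩

lemma HasExp.sum {ι : Type*} (s : Finset ι) {x : ι → ℕ → ℝ} {c : ℝ} {f : ι → ℝ⟦X⟧}
    (h : ∀ i ∈ s, HasExp (x i) c (f i)) :
    HasExp (fun n => ∑ i ∈ s, x i n) c (∑ i ∈ s, f i) := by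
  classical
  induction s using Finset.induction_on with
  | empty => simpa using HasExp.zero c
  | insert a s ha ih =>
    simp only [Finset.sum_insert ha]
    exact (h a (Finset.mem_insert_self _ _)).add
      (ih fun i hi => h i (Finset.mem_insert_of_mem hi))

lemma rpow_natCast_add_one_mono {a b : ℝ} (h : a ≤ b) (n : ℕ) :
    ((n : ℝ) + 1) ^ a ≤ ((n : ℝ) + 1) ^ b :=
  Real.rpow_le_rpow_of_exponent_le (by linarith [n.cast_nonneg (α := ℝ)]) h

/-- This is `w^{c+k} f = w^c (w^k f)`, a shift of the summation index. -/
lemma HasExp.X_pow_mul {x : ℕ → ℝ} {c : ℝ} {f : ℝ⟦X⟧} (k : ℕ) (h : HasExp x (c + k) f) :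
    HasExp x c (X ^ k * f) := by
  intro M
  rcases le_or_gt k M with hk | hk
  · obtain ⟨L, rfl⟩ := Nat.exists_eq_add_of_le hk
    obtain ⟨K, hK⟩ := h L
    refine ⟨K, fun n => ?_⟩
    have e1 : ∑ i ∈ range (k + L), coeff i (X ^ k * f) * binCoeff (c + i) n =
        ∑ i ∈ range L, coeff i f * binCoeff (c + k + i) n := by
      rw [Finset.sum_range_add, Finset.sum_eq_zero, zero_add]
      · refine Finset.sum_congr rfl fun i _ => ?_
        rw [add_comm k i, coeff_X_pow_mul]
        push_cast
        congr 2; ring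
      · intro i hi
        rw [coeff_X_pow_mul', if_neg (by simpa using hi), zero_mul]
    rw [e1]
    convert hK n using 3
    push_cast; ring
  -- Here `k > M`, so no nonzero term is subtracted, and the order-zero bound for the exponent `c +
  -- k` is already stronger than required.
  · obtain ⟨K, hK⟩ := h 0
    refine ⟨K, fun n => ?_⟩
    have hK0 : 0 ≤ K := by simpa using (abs_nonneg _).trans (hK 0)
    rw [Finset.sum_eq_zero]
    · have := hK n
      simp only [Finset.range_zero, Finset.sum_empty] at this
      refine this.trans (mul_le_mul_of_nonneg_left (rpow_natCast_add_one_mono ?_ n) hK0)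
      have : (M : ℝ) ≤ k := Nat.cast_le.2 hk.le
      push_cast
      linarith
    · intro i hi
      have := Finset.mem_range.1 hi
      rw [coeff_X_pow_mul', if_neg (by omega), zero_mul]

/-- The action of `z d/dz` on `w ^ c * f w`, divided by `w ^ (c - 1)`, for `w = 1 - z`. -/
def eulerOp (c : ℝ) (f : ℝ⟦X⟧) : ℝ⟦X⟧ := -(1 - X) * (C c * f + X * derivative ℝ f)

lemma coeff_zero_eulerOp (c : ℝ) (f : ℝ⟦X⟧) : coeff 0 (eulerOp c f) = -c * coeff 0 f := by
  simp [eulerOp]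

lemma coeff_succ_eulerOp (c : ℝ) (f : ℝ⟦X⟧) (i : ℕ) :
    coeff (i + 1) (eulerOp c f) = -(c + (i + 1 : ℕ)) * coeff (i + 1) f + (c + i) * coeff i f := by
  have h : ∀ j : ℕ, coeff j (C c * f + X * derivative ℝ f) = (c + j) * coeff j f := by
    intro j
    rw [map_add, coeff_C_mul]
    rcases j with _ | j
    · simp
    · rw [coeff_succ_X_mul, coeff_derivative]; push_cast; ring
  have e : eulerOp c f = X * (C c * f + X * derivative ℝ f) - (C c * f + X * derivative ℝ f) := by
    rw [eulerOp]; ring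
  rw [e, map_sub, coeff_succ_X_mul, h, h]
  ring

/-- Apply `natCast_mul_binCoeff` to each term and regroup; cutting the sum at `M` leaves one
boundary term. -/
lemma sum_eulerOp_mul_binCoeff (c : ℝ) (f : ℝ⟦X⟧) (M n : ℕ) :
    (n : ℝ) * ∑ i ∈ range M, coeff i f * binCoeff (c + i) n =
      ∑ i ∈ range (M + 1), coeff i (eulerOp c f) * binCoeff (c - 1 + i) n +
        (c + M) * coeff M f * binCoeff (c - 1 + M) n := by
  induction M with
  | zero => simp [coeff_zero_eulerOp]
  | succ M ih =>
    rw [Finset.sum_range_succ, mul_add, ih, Finset.sum_range_succ _ (M + 1), coeff_succ_eulerOp]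
    have h := natCast_mul_binCoeff (c + M) n
    have e1 : c + M - 1 = c - 1 + M := by ring
    have e2 : c - 1 + ((M + 1 : ℕ) : ℝ) = c + M := by push_cast; ring
    rw [e1] at h
    rw [e2]
    push_cast
    linear_combination (coeff M f) * h

/-- Multiplying a sequence by `n` is `z d/dz` on its generating function, which lowers the leading
exponent by one. -/
lemma HasExp.natCast_mul {x : ℕ → ℝ} {c : ℝ} {f : ℝ⟦X⟧} (h : HasExp x c f) :
    HasExp (fun n => (n : ℝ) * x n) (c - 1) (eulerOp c f) := by
  intro M
  obtain ⟨K, hK⟩ := h M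
  have hK0 : 0 ≤ K := by simpa using (abs_nonneg _).trans (hK 0)
  obtain ⟨B, hB0, hB⟩ := exists_abs_binCoeff_le (c - 1 + M)
  -- The two terms of order `M` left over, the last coefficient of `eulerOp` and the boundary term,
  -- have the size of the remainder and are moved into it.
  set a := coeff M (eulerOp c f) + (c + M) * coeff M f with ha
  refine ⟨K + |a| * B, fun n => ?_⟩
  have e : n * x n - ∑ i ∈ range M, coeff i (eulerOp c f) * binCoeff (c - 1 + i) n =
      n * (x n - ∑ i ∈ range M, coeff i f * binCoeff (c + i) n) +
        a * binCoeff (c - 1 + M) n := by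
    rw [mul_sub, sum_eulerOp_mul_binCoeff, Finset.sum_range_succ, ha]; ring
  rw [e, add_mul K]
  refine (abs_add_le _ _).trans (add_le_add ?_ ?_)
  · rw [abs_mul, Nat.abs_cast]
    have hn : (0 : ℝ) < (n : ℝ) + 1 := by positivity
    have e2 : -(c + M) - 1 = -(c - 1 + M) - 1 - 1 := by ring
    calc (n : ℝ) * |x n - ∑ i ∈ range M, coeff i f * binCoeff (c + i) n|
        ≤ ((n : ℝ) + 1) * (K * ((n : ℝ) + 1) ^ (-(c + M) - 1)) :=
          mul_le_mul (by linarith) (hK n) (abs_nonneg _) hn.le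
      _ = _ := by rw [e2, Real.rpow_sub_one hn.ne']; field_simp
  · rw [abs_mul, mul_assoc]
    exact mul_le_mul_of_nonneg_left (hB n) (abs_nonneg _)

lemma HasExp.bound {x : ℕ → ℝ} {c : ℝ} {f : ℝ⟦X⟧} (h : HasExp x c f) {M : ℕ}
    (hf : ∀ i < M, coeff i f = 0) :
    ∃ K, ∀ n : ℕ, |x n| ≤ K * ((n : ℝ) + 1) ^ (-(c + M) - 1) := by
  obtain ⟨K, hK⟩ := h M
  refine ⟨K, fun n => ?_⟩
  have := hK n
  rwa [Finset.sum_eq_zero fun i hi => by rw [hf i (Finset.mem_range.1 hi), zero_mul],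
    sub_zero] at this

/-- The product of a geometrically decaying series and `(1 - z) ^ e`. -/
lemma GeomDecay.hasExp {Y : ℝ⟦X⟧} (h : GeomDecay Y) {g : ℝ → ℝ} (hg : AnalyticAt ℝ g 0)
    (hYg : ∀ᶠ w in 𝓝[>] (0 : ℝ), seriesSum Y (1 - w) = g w) (e : ℝ) :
    HasExp (fun n => coeff n (Y * binSeries e)) e (taylorSeries g) := by
  intro M
  obtain ⟨γ, Z, hZ, hY, hYs⟩ := h.exists_expansion M
  -- Both `∑ γ_i w^i` and the Taylor polynomial approximate `g` up to `O(w^M)` as `w → 0+`, so their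
  -- coefficients coincide.
  have hγ : ∀ i < M, γ i - coeff i (taylorSeries g) = 0 := by
    apply coeff_eq_zero_of_isBigO
    have h1 := (isBigO_taylorSeries hg M).mono (nhdsWithin_le_nhds (s := Set.Ioi 0))
    obtain ⟨B, hB⟩ := hZ.exists_bound
    have hev : ∀ᶠ w in 𝓝[>] (0 : ℝ), w < 1 :=
      nhdsWithin_le_nhds (Iio_mem_nhds zero_lt_one)
    have h2 : (fun w : ℝ => g w - ∑ i ∈ range M, γ i * w ^ i) =O[𝓝[>] 0] fun w => w ^ M := by
      refine Asymptotics.IsBigO.of_bound B ?_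
      filter_upwards [hYg, hev, self_mem_nhdsWithin] with w hw hw1 hw0
      have hw0' : (0 : ℝ) < w := hw0
      have hz : |1 - w| ≤ 1 := by rw [abs_le]; constructor <;> linarith
      rw [← hw, hYs _ hz, sub_sub_cancel, add_sub_cancel_left, norm_mul, mul_comm]
      exact mul_le_mul_of_nonneg_right (hB _ hz) (norm_nonneg _)
    refine (h1.sub h2).congr_left fun w => ?_
    simp only [sub_mul, Finset.sum_sub_distrib]
    ring
  obtain ⟨B, -, hB⟩ := exists_abs_binCoeff_le (e + M)
  obtain ⟨K, hK⟩ := hZ.mul_bound (Z := binSeries (e + M)) (K := B) (s := -(e + M) - 1)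
    (fun n => by rw [coeff_binSeries]; exact hB n)
  refine ⟨K, fun n => le_trans (le_of_eq ?_) (hK n)⟩
  congr 1
  have : Y * binSeries e = ∑ i ∈ range M, C (γ i) * binSeries (e + i) +
      Z * binSeries (e + M) := by
    conv_lhs => rw [hY]
    rw [add_mul, Finset.sum_mul, binSeries_add_natCast]
    congr 1
    · exact Finset.sum_congr rfl fun i _ => by rw [binSeries_add_natCast]; ring
    · ring
  simp only [this, map_add, map_sum]
  have h3 : ∑ i ∈ range M, coeff n (C (γ i) * binSeries (e + i)) =
      ∑ i ∈ range M, coeff i (taylorSeries g) * binCoeff (e + i) n := by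
    refine Finset.sum_congr rfl fun i hi => ?_
    rw [coeff_C_mul, coeff_binSeries, ← sub_eq_zero.1 (hγ i (Finset.mem_range.1 hi))]
  rw [h3]
  ring

/-! ### Powers of `log (1 / (1 - w)) / w` -/

/-- The function `-log (1 - w) / w`, extended by `1` at `w = 0`. -/
def logQuot (w : ℝ) : ℝ := dslope (fun w => -Real.log (1 - w)) 0 w

lemma analyticAt_neg_log_one_sub : AnalyticAt ℝ (fun w : ℝ => -Real.log (1 - w)) 0 :=
  ((analyticAt_const.sub analyticAt_id).log (by simp)).neg

lemma analyticAt_logQuot : AnalyticAt ℝ logQuot 0 := by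
  obtain ⟨p, hp⟩ := analyticAt_neg_log_one_sub
  exact hp.has_fpower_series_dslope_fslope.analyticAt

lemma logQuot_of_ne {w : ℝ} (hw : w ≠ 0) : logQuot w = -Real.log (1 - w) / w := by
  rw [logQuot, dslope_of_ne _ hw, slope_def_field]
  simp

lemma mul_logQuot (w : ℝ) : w * logQuot w = -Real.log (1 - w) := by
  rcases eq_or_ne w 0 with rfl | hw
  · simp
  · rw [logQuot_of_ne hw]; field_simp

lemma one_sub_X_mul_derivative :
    (1 - X) * derivative ℝ (X * taylorSeries logQuot) = 1 := by
  have h1 : X * taylorSeries logQuot = taylorSeries fun w : ℝ => -Real.log (1 - w) := by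
    rw [← taylorSeries_id, ← taylorSeries_mul (f := fun x => x) analyticAt_id analyticAt_logQuot]
    exact congrArg _ (funext mul_logQuot)
  have h2 : derivative ℝ (X * taylorSeries logQuot) = binSeries (-1) := by
    rw [h1, ← taylorSeries_deriv, binSeries, ← taylorSeries_one_sub_rpow]
    apply taylorSeries_congr
    filter_upwards [Iio_mem_nhds (zero_lt_one (α := ℝ))] with w hw
    have hw' : 1 - w ≠ 0 := (sub_pos.2 hw).ne'
    have h3 : HasDerivAt (fun w : ℝ => -Real.log (1 - w)) (-((-1) / (1 - w))) w :=
      (((hasDerivAt_id w).const_sub 1).log hw').neg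
    rw [h3.deriv, Real.rpow_neg_one]
    field_simp
  have h3 := binSeries_add_one (-1)
  rw [h2, ← h3, neg_add_cancel, binSeries_zero]

lemma coeff_taylorSeries_logQuot (n : ℕ) : coeff n (taylorSeries logQuot) = 1 / ((n : ℝ) + 1) := by
  have h : derivative ℝ (X * taylorSeries logQuot) = binSeries (-1) := by
    have h3 := binSeries_add_one (-1)
    rw [neg_add_cancel, binSeries_zero] at h3
    have h5 : (1 - X : ℝ⟦X⟧) ≠ 0 := by
      intro h0
      have := congrArg constantCoeff h0
      simp at this
    exact mul_left_cancel₀ h5 (by rw [one_sub_X_mul_derivative, ← h3])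
  have := congrArg (coeff n) h
  rw [coeff_derivative, coeff_succ_X_mul, coeff_binSeries, binCoeff_neg_one] at this
  exact eq_div_of_mul_eq (by positivity) this

lemma logQuot_zero : logQuot 0 = 1 := by
  have := coeff_taylorSeries_logQuot 0
  rw [coeff_zero_eq_constantCoeff_apply, constantCoeff_taylorSeries] at this
  simpa using this

lemma logQuot_pos : 0 < logQuot 0 := by rw [logQuot_zero]; exact one_pos

/-- The formal power series of `(-log (1 - w) / w) ^ c`. -/
def logSeries (c : ℝ) : ℝ⟦X⟧ := taylorSeries fun w => logQuot w ^ c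

lemma logSeries_add (c d : ℝ) : logSeries (c + d) = logSeries c * logSeries d :=
  taylorSeries_rpow_add analyticAt_logQuot logQuot_pos c d

lemma logSeries_one : logSeries 1 = taylorSeries logQuot := by simp [logSeries]

lemma coeff_zero_logSeries (c : ℝ) : coeff 0 (logSeries c) = 1 := by
  rw [coeff_zero_eq_constantCoeff_apply, logSeries, constantCoeff_taylorSeries, logQuot_zero,
    Real.one_rpow]

/-- With `t = -log(1-w)`, the series `w^c · logSeries c` represents `t^c`; since `z = e^{-t}`, the
operator `z d/dz` is `-d/dt`, and `-d/dt t^c = -c t^{c-1}`. -/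
lemma eulerOp_logSeries (c : ℝ) : eulerOp c (logSeries c) = C (-c) * logSeries (c - 1) := by
  have h0 : taylorSeries logQuot ≠ 0 := by
    intro h
    have := coeff_taylorSeries_logQuot 0
    simp [h] at this
  apply mul_left_cancel₀ h0
  have h1 := taylorSeries_rpow_ode analyticAt_logQuot logQuot_pos c
  rw [← logSeries] at h1
  have h2 := one_sub_X_mul_derivative
  rw [Derivation.leibniz, derivative_X] at h2
  simp only [smul_eq_mul, mul_one] at h2
  have h3 : logSeries c = taylorSeries logQuot * logSeries (c - 1) := by
    rw [← logSeries_one, ← logSeries_add]; congr 1; ring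
  rw [eulerOp, map_neg]
  calc taylorSeries logQuot * (-(1 - X) * (C c * logSeries c + X * derivative ℝ (logSeries c)))
      = -(1 - X) * (C c * logSeries c * taylorSeries logQuot +
          X * (taylorSeries logQuot * derivative ℝ (logSeries c))) := by ring
    _ = -(C c * logSeries c) * ((1 - X) * (X * derivative ℝ (taylorSeries logQuot) +
          taylorSeries logQuot)) := by rw [h1]; ring
    _ = -(C c * (taylorSeries logQuot * logSeries (c - 1))) := by rw [h2, mul_one, ← h3]
    _ = _ := by ring

/-! ### Powers of `n` in terms of binomial coefficients -/

/-- `∑ n, n ^ l z ^ n = w ^ (-l-1) * powSeries l w` for `w = 1 - z`. -/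
def powSeries : ℕ → ℝ⟦X⟧
  | 0 => 1
  | l + 1 => eulerOp (-((l : ℝ) + 1)) (powSeries l)

lemma natCast_pow_eq_sum (l n : ℕ) : (n : ℝ) ^ l =
    ∑ i ∈ range (l + 1), coeff i (powSeries l) * binCoeff (-((l : ℝ) + 1) + i) n := by
  induction l with
  | zero => simp [powSeries, binCoeff_neg_one]
  | succ l ih =>
    rw [pow_succ', ih, sum_eulerOp_mul_binCoeff, powSeries]
    have h1 : -((l : ℝ) + 1) + ((l + 1 : ℕ) : ℝ) = 0 := by push_cast; ring
    have h2 : -(((l + 1 : ℕ) : ℝ) + 1) = -((l : ℝ) + 1) - 1 := by push_cast; ring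
    rw [h1, h2]
    ring

/-- `∑ n^l e^{-nt}` equals `l! t^{-l-1}` plus a function regular at `t = 0`, so exactly the singular
coefficients `i ≤ l` can be compared. Both sides obey the same Euler recursion. -/
lemma coeff_powSeries {l i : ℕ} (hi : i ≤ l) :
    coeff i (powSeries l) = l.factorial * coeff i (logSeries (-((l : ℝ) + 1))) := by
  induction l generalizing i with
  | zero =>
    obtain rfl : i = 0 := by omega
    simp [powSeries, coeff_zero_logSeries, -coeff_zero_eq_constantCoeff]
  | succ l ih =>
    have h := eulerOp_logSeries (-((l : ℝ) + 1))
    have h2 : -(((l + 1 : ℕ) : ℝ) + 1) = -((l : ℝ) + 1) - 1 := by push_cast; ring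
    have h3 : (((l + 1).factorial : ℕ) : ℝ) * coeff i (logSeries (-((l : ℝ) + 1) - 1)) =
        l.factorial * coeff i (eulerOp (-((l : ℝ) + 1)) (logSeries (-((l : ℝ) + 1)))) := by
      rw [h, coeff_C_mul, Nat.factorial_succ]; push_cast; ring
    rw [h2, h3, powSeries]
    rcases i with _ | i
    · rw [coeff_zero_eulerOp, coeff_zero_eulerOp, ih (Nat.zero_le _)]; ring
    · rw [coeff_succ_eulerOp, coeff_succ_eulerOp]
      -- At the new top index `l+1` the factor `c + (l+1)` is zero, so the uncontrolled coefficient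
      -- of index `l+1` drops out.
      rcases (Nat.lt_or_ge l (i + 1)) with hl | hl
      · obtain rfl : i = l := by omega
        rw [ih le_rfl]
        push_cast
        ring
      · rw [ih hl, ih (by omega)]; ring

lemma coeff_mul_congr {A A' B B' : ℝ⟦X⟧} {k : ℕ} (hA : ∀ i < k, coeff i A = coeff i A')
    (hB : ∀ i < k, coeff i B = coeff i B') : ∀ i < k, coeff i (A * B) = coeff i (A' * B') := by
  intro i hi
  rw [coeff_mul, coeff_mul]
  refine Finset.sum_congr rfl fun p hp => ?_
  have := Finset.HasAntidiagonal.mem_antidiagonal.1 hp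
  rw [hA _ (by omega), hB _ (by omega)]

/-! ### Geometric decay for solutions of linear recurrences -/

/-- `s = p/(1+t)`, where `∑ |t_n| x^n < 1` persists for some `x > 1` by continuity, so `1+t` has no
zero in a disc larger than the unit disc. The recursion for `s_n` proves the bound directly. -/
lemma geomDecay_of_add_mul_eq {s t p : ℝ⟦X⟧} {N : ℕ} (h : s + t * s = p)
    (ht0 : coeff 0 t = 0) (htN : ∀ n, N ≤ n → coeff n t = 0) (hpN : ∀ n, N ≤ n → coeff n p = 0)
    (ht : ∑ n ∈ range N, |coeff n t| < 1) : GeomDecay s := by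
  obtain ⟨x, hx1, hx⟩ : ∃ x : ℝ, 1 < x ∧ ∑ n ∈ range N, |coeff n t| * x ^ n < 1 := by
    have hc : Continuous fun x : ℝ => ∑ n ∈ range N, |coeff n t| * x ^ n := by fun_prop
    have h1 : ∀ᶠ x in 𝓝 (1 : ℝ), ∑ n ∈ range N, |coeff n t| * x ^ n < 1 :=
      hc.continuousAt.eventually (gt_mem_nhds (by simpa using ht))
    have h2 : ∀ᶠ x in 𝓝[>] (1 : ℝ), ∑ n ∈ range N, |coeff n t| * x ^ n < 1 :=
      nhdsWithin_le_nhds h1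
    obtain ⟨x, hx, hx1⟩ := (h2.and self_mem_nhdsWithin).exists
    exact ⟨x, hx1, hx⟩
  have hx0 : 0 < x := by linarith
  set σ := ∑ n ∈ range N, |coeff n t| * x ^ n with hσ
  set P := ∑ n ∈ range N, |coeff n p| * x ^ n with hP
  have hP0 : 0 ≤ P := Finset.sum_nonneg fun n _ => by positivity
  -- The solution of `B = P + Bσ`, so that the bound `|s_n| x^n ≤ B` reproduces itself; `t_0 = 0`
  -- ensures that only earlier `s_j` occur.
  set B := P / (1 - σ) with hB
  have hσ1 : 0 < 1 - σ := by linarith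
  have hB0 : 0 ≤ B := by positivity
  have hBP : P = B * (1 - σ) := by rw [hB]; field_simp
  have hp : ∀ n, |coeff n p| * x ^ n ≤ P := by
    intro n
    rcases lt_or_ge n N with hn | hn
    · exact Finset.single_le_sum (f := fun n => |coeff n p| * x ^ n) (fun n _ => by positivity)
        (Finset.mem_range.2 hn)
    · rw [hpN n hn]; simpa using hP0
  have key : ∀ n, |coeff n s| * x ^ n ≤ B := by
    intro n
    induction n using Nat.strong_induction_on with
    | _ n ih =>
    have h1 : coeff n s = coeff n p - ∑ k ∈ range (n + 1), coeff k t * coeff (n - k) s := by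
      rw [← h, map_add, coeff_mul, Nat.sum_antidiagonal_eq_sum_range_succ_mk]; ring
    have h2 : ∑ k ∈ range (n + 1), |coeff k t| * x ^ k ≤ σ := by
      rcases le_total (n + 1) N with hn | hn
      · exact Finset.sum_le_sum_of_subset_of_nonneg (Finset.range_subset_range.2 hn)
          fun _ _ _ => by positivity
      · refine le_of_eq (Finset.sum_subset (Finset.range_subset_range.2 hn) fun k _ hk => ?_).symm
        rw [htN k (by simpa using hk)]; simp
    have h3 : |∑ k ∈ range (n + 1), coeff k t * coeff (n - k) s| * x ^ n ≤ B * σ := by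
      calc |∑ k ∈ range (n + 1), coeff k t * coeff (n - k) s| * x ^ n
          ≤ (∑ k ∈ range (n + 1), |coeff k t * coeff (n - k) s|) * x ^ n := by
            gcongr; exact Finset.abs_sum_le_sum_abs _ _
        _ ≤ ∑ k ∈ range (n + 1), (|coeff k t| * x ^ k) * B := by
            rw [Finset.sum_mul]
            refine Finset.sum_le_sum fun k hk => ?_
            rcases Nat.eq_zero_or_pos k with rfl | hk0
            · simp [ht0, -coeff_zero_eq_constantCoeff]
            · have hkn : k ≤ n := Nat.lt_succ_iff.1 (Finset.mem_range.1 hk)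
              rw [abs_mul, ← pow_mul_pow_sub x hkn]
              have := ih (n - k) (by omega)
              calc |coeff k t| * |coeff (n - k) s| * (x ^ k * x ^ (n - k))
                  = (|coeff k t| * x ^ k) * (|coeff (n - k) s| * x ^ (n - k)) := by ring
                _ ≤ _ := by gcongr
        _ = B * ∑ k ∈ range (n + 1), |coeff k t| * x ^ k := by rw [← Finset.sum_mul, mul_comm]
        _ ≤ B * σ := by gcongr
    have h4 : |coeff n s| ≤ |coeff n p| + |∑ k ∈ range (n + 1), coeff k t * coeff (n - k) s| := by
      rw [h1]; exact abs_sub _ _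
    calc |coeff n s| * x ^ n ≤ (|coeff n p| +
          |∑ k ∈ range (n + 1), coeff k t * coeff (n - k) s|) * x ^ n := by gcongr
      _ ≤ P + B * σ := by rw [add_mul]; exact add_le_add (hp n) h3
      _ = B := by rw [hBP]; ring
  refine ⟨B, x⁻¹, by positivity, inv_lt_one_of_one_lt₀ hx1, fun n => ?_⟩
  rw [inv_pow, ← div_eq_mul_inv, le_div_iff₀ (by positivity)]
  exact key n

/-- A discrete Gronwall argument: after rescaling by `κ^j`, the partial sums `S_n` of `|Y_j|/κ^j`
satisfy `S_{n+1} ≤ (1 + B/(n+1)) S_n`, hence grow at most polynomially. -/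
lemma geomDecay_of_derivative_eq {s Y : ℝ⟦X⟧} {θ : ℝ} (hs : GeomDecay s)
    (h : derivative ℝ Y = C θ * (s * Y)) : GeomDecay Y := by
  obtain ⟨A, κ, hκ0, hκ1, hA⟩ := hs
  have hA0 : 0 ≤ A := by simpa using (abs_nonneg _).trans (hA 0)
  set B := |θ| * A / κ with hB
  have hB0 : 0 ≤ B := by positivity
  set a : ℕ → ℝ := fun j => |coeff j Y| / κ ^ j with ha
  have ha0 : ∀ j, 0 ≤ a j := fun j => by positivity
  have hrec : ∀ n : ℕ, a (n + 1) * (n + 1) ≤ B * ∑ j ∈ range (n + 1), a j := by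
    intro n
    have h1 : coeff (n + 1) Y * (n + 1) =
        θ * ∑ k ∈ range (n + 1), coeff k s * coeff (n - k) Y := by
      rw [← coeff_derivative, h, coeff_C_mul, coeff_mul, Nat.sum_antidiagonal_eq_sum_range_succ_mk]
    have h2 : |coeff (n + 1) Y| * (n + 1) ≤
        |θ| * ∑ k ∈ range (n + 1), (A * κ ^ k) * |coeff (n - k) Y| := by
      have hn : |(n : ℝ) + 1| = n + 1 := abs_of_nonneg (by positivity)
      rw [← hn, ← abs_mul, h1, abs_mul]
      refine mul_le_mul_of_nonneg_left ((Finset.abs_sum_le_sum_abs _ _).trans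
        (Finset.sum_le_sum fun k _ => ?_)) (abs_nonneg _)
      rw [abs_mul]
      exact mul_le_mul_of_nonneg_right (hA k) (abs_nonneg _)
    have h3 : ∑ k ∈ range (n + 1), (A * κ ^ k) * |coeff (n - k) Y| =
        A * κ ^ n * ∑ j ∈ range (n + 1), a j := by
      rw [← Finset.sum_range_reflect a, Finset.mul_sum]
      refine Finset.sum_congr rfl fun k hk => ?_
      have hkn : k ≤ n := Nat.lt_succ_iff.1 (Finset.mem_range.1 hk)
      rw [ha]
      simp only [Nat.add_sub_cancel]
      rw [← pow_mul_pow_sub κ hkn]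
      field_simp
    rw [h3] at h2
    change |coeff (n + 1) Y| / κ ^ (n + 1) * (n + 1) ≤ _
    rw [div_mul_eq_mul_div, div_le_iff₀ (by positivity)]
    refine h2.trans (le_of_eq ?_)
    rw [hB, pow_succ]
    field_simp
  -- The product of the factors `1 + B/(j+1)` is `binCoeff (-B-1) n`, which is `O(n^B)`.
  have hS : ∀ n : ℕ, ∑ j ∈ range (n + 1), a j ≤ a 0 * binCoeff (-B - 1) n := by
    intro n
    induction n with
    | zero => simp
    | succ n ih =>
      rw [Finset.sum_range_succ, binCoeff_succ]
      have hn : (0 : ℝ) < (n : ℝ) + 1 := by positivity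
      have h1 : a (n + 1) ≤ B * (∑ j ∈ range (n + 1), a j) / (n + 1) := by
        rw [le_div_iff₀ hn]; exact hrec n
      calc ∑ j ∈ range (n + 1), a j + a (n + 1)
          ≤ ∑ j ∈ range (n + 1), a j + B * (∑ j ∈ range (n + 1), a j) / (n + 1) := by gcongr
        _ = (∑ j ∈ range (n + 1), a j) * ((n - (-B - 1)) / (n + 1)) := by field_simp; ring
        _ ≤ a 0 * binCoeff (-B - 1) n * ((n - (-B - 1)) / (n + 1)) := by
            refine mul_le_mul_of_nonneg_right ih (div_nonneg ?_ hn.le)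
            linarith [n.cast_nonneg (α := ℝ)]
        _ = _ := by ring
  obtain ⟨K, hK0, hK⟩ := exists_abs_binCoeff_le (-B - 1)
  have hY : ∀ n : ℕ, |coeff n Y| ≤ a 0 * K * (((n : ℝ) + 1) ^ B * κ ^ n) := by
    intro n
    have h1 : a n ≤ a 0 * (K * ((n : ℝ) + 1) ^ B) := by
      have h2 := hK n
      have e : -(-B - 1) - 1 = B := by ring
      rw [e] at h2
      calc a n ≤ ∑ j ∈ range (n + 1), a j :=
            Finset.single_le_sum (fun j _ => ha0 j) (Finset.self_mem_range_succ n)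
        _ ≤ a 0 * binCoeff (-B - 1) n := hS n
        _ ≤ _ := mul_le_mul_of_nonneg_left ((le_abs_self _).trans h2) (ha0 0)
    rw [ha] at h1
    simp only at h1
    rw [div_le_iff₀ (by positivity)] at h1
    refine h1.trans (le_of_eq ?_)
    simp only [ha]
    ring
  -- With `κ^n = κ'^n κ'^n`, one factor absorbs the power of `n` and the other remains as the decay.
  set κ' := Real.sqrt κ with hκ'
  have hκ'0 : 0 < κ' := Real.sqrt_pos.2 hκ0
  have hκ'1 : κ' < 1 := by rw [hκ', Real.sqrt_lt' one_pos]; simpa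
  have hsq : κ = κ' * κ' := (Real.mul_self_sqrt hκ0.le).symm
  have hsum := summable_rpow_mul_geometric hκ'0 hκ'1 B
  refine ⟨a 0 * K * ∑' k : ℕ, ((k : ℝ) + 1) ^ B * κ' ^ k, κ', hκ'0, hκ'1, fun n => ?_⟩
  refine (hY n).trans ?_
  have h1 := hsum.le_tsum n fun k _ => by positivity
  rw [hsq, mul_pow]
  have := ha0 0
  calc a 0 * K * (((n : ℝ) + 1) ^ B * (κ' ^ n * κ' ^ n))
      = a 0 * K * (((n : ℝ) + 1) ^ B * κ' ^ n) * κ' ^ n := by ring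
    _ ≤ _ := by gcongr

/-- A geometrically decaying series is analytic on a neighbourhood of the closed unit disc. -/
lemma GeomDecay.hasFPowerSeriesOnBall {Y : ℝ⟦X⟧} (h : GeomDecay Y) :
    ∃ R : ENNReal, 1 < R ∧ HasFPowerSeriesOnBall (seriesSum Y)
      (FormalMultilinearSeries.ofScalars ℝ fun n => coeff n Y) 0 R := by
  obtain ⟨A, κ, hκ0, hκ1, hA⟩ := h
  set p := FormalMultilinearSeries.ofScalars ℝ (fun n => coeff n Y) with hp
  set x : NNReal := Real.toNNReal κ⁻¹ with hx
  have hxκ : (x : ℝ) = κ⁻¹ := Real.coe_toNNReal _ (by positivity)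
  have hrad : (x : ENNReal) ≤ p.radius := by
    refine p.le_radius_of_bound A fun n => ?_
    rw [hp, FormalMultilinearSeries.ofScalars_norm, Real.norm_eq_abs, hxκ, inv_pow]
    rw [← div_eq_mul_inv, div_le_iff₀ (by positivity)]
    exact hA n
  have hx1 : (1 : ENNReal) < x := by
    rw [← ENNReal.coe_one, ENNReal.coe_lt_coe, ← NNReal.coe_lt_coe, hxκ]
    exact (one_lt_inv₀ hκ0).2 hκ1
  have hpos : 0 < p.radius := lt_of_lt_of_le (zero_lt_one.trans hx1) hrad
  refine ⟨p.radius, hx1.trans_le hrad, ?_⟩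
  have h2 := p.hasFPowerSeriesOnBall hpos
  have e : p.sum = seriesSum Y := by
    ext z
    simp [FormalMultilinearSeries.sum, hp, seriesSum, mul_comm]
  rwa [e] at h2

/-- Identity theorem: both functions are analytic near the connected set `[0, 1]` and have the same
germ at `0`. The end point `z = 1` is where the singular expansions are taken. -/
lemma GeomDecay.seriesSum_eqOn {Y : ℝ⟦X⟧} (h : GeomDecay Y) {g : ℝ → ℝ}
    (hg : ∀ z ∈ Set.Icc (0 : ℝ) 1, AnalyticAt ℝ g z) (hY : Y = taylorSeries g) :
    ∀ z ∈ Set.Icc (0 : ℝ) 1, seriesSum Y z = g z := by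
  obtain ⟨R, hR, hp⟩ := h.hasFPowerSeriesOnBall
  have ha : AnalyticOnNhd ℝ (seriesSum Y) (Set.Icc (0 : ℝ) 1) := by
    refine hp.analyticOnNhd.mono fun z hz => ?_
    rw [Metric.mem_eball, edist_zero_right]
    refine lt_of_le_of_lt ?_ hR
    rw [← ofReal_norm, Real.norm_of_nonneg hz.1]
    exact ENNReal.ofReal_le_one.2 hz.2
  refine ha.eqOn_of_preconnected_of_eventuallyEq hg isPreconnected_Icc
    (Set.left_mem_Icc.2 zero_le_one) ?_
  have h1 := hasFPowerSeriesAt_taylorSeries (hg 0 (Set.left_mem_Icc.2 zero_le_one))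
  rw [← hY] at h1
  filter_upwards [hp.hasFPowerSeriesAt.eventually_hasSum_sub, h1.eventually_hasSum_sub] with z h2 h3
  exact h2.unique h3

/-! ### The generating polynomial of the backward difference formula -/

/-- The polynomial `δ_q / (1 - z)` in terms of `w = 1 - z`. -/
def bdfQuot (q : ℕ) (w : ℝ) : ℝ := ∑ j ∈ range q, 1 / ((j : ℝ) + 1) * w ^ j

lemma bdfPoly_eq (q : ℕ) (z : ℝ) : bdfPoly q z = (1 - z) * bdfQuot q (1 - z) := by
  rw [bdfPoly, bdfQuot, Finset.mul_sum, ← Finset.Ico_add_one_right_eq_Icc,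
    Finset.sum_Ico_eq_sum_range]
  refine Finset.sum_congr (by simp) fun j _ => ?_
  push_cast
  rw [pow_add]
  ring

lemma bdfQuot_pos {q : ℕ} (hq : 1 ≤ q) {w : ℝ} (hw : 0 ≤ w) : 0 < bdfQuot q w := by
  refine Finset.sum_pos' (fun j _ => by positivity) ⟨0, Finset.mem_range.2 hq, by simp⟩

lemma analyticAt_sum_mul_pow (a : ℕ → ℝ) (N : ℕ) (x : ℝ) :
    AnalyticAt ℝ (fun w : ℝ => ∑ j ∈ range N, a j * w ^ j) x := by
  have h := Finset.analyticAt_fun_sum (𝕜 := ℝ) (f := fun j w => a j * w ^ j) (c := x) (range N)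
    fun j _ => (analyticAt_const.mul (analyticAt_id.pow j))
  exact h

lemma analyticAt_bdfQuot (q : ℕ) (w : ℝ) : AnalyticAt ℝ (bdfQuot q) w :=
  analyticAt_sum_mul_pow (fun j => 1 / ((j : ℝ) + 1)) q w

lemma analyticAt_bdfQuot_one_sub (q : ℕ) (z : ℝ) :
    AnalyticAt ℝ (fun z => bdfQuot q (1 - z)) z :=
  (analyticAt_bdfQuot q (1 - z)).fun_comp (analyticAt_const.sub analyticAt_id)

lemma taylorSeries_pow (j : ℕ) : taylorSeries (fun x => x ^ j) = X ^ j := by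
  induction j with
  | zero => simpa using taylorSeries_const 1
  | succ j ih =>
    have := taylorSeries_mul (f := fun x => x ^ j) (g := fun x => x) (analyticAt_id.pow j)
      analyticAt_id
    simp only [pow_succ, this, ih, taylorSeries_id]

lemma coeff_taylorSeries_sum (a : ℕ → ℝ) (N n : ℕ) :
    coeff n (taylorSeries fun x => ∑ j ∈ range N, a j * x ^ j) = if n < N then a n else 0 := by
  have h : taylorSeries (fun x => ∑ j ∈ range N, a j * x ^ j) =
      ∑ j ∈ range N, C (a j) * X ^ j := by
    induction N with
    | zero => simpa using taylorSeries_const 0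
    | succ N ih =>
      have := taylorSeries_add (g := fun x => a N * x ^ N) (analyticAt_sum_mul_pow a N 0)
        (analyticAt_const.mul (analyticAt_id.pow N))
      rw [taylorSeries_const_mul (f := fun x => x ^ N) _ (analyticAt_id.pow N), taylorSeries_pow,
        ih] at this
      simp only [Finset.sum_range_succ, this]
  rw [h, map_sum]
  simp [coeff_X_pow]

/-- A certificate that `δ_q/(1-z)` has no zero in the closed unit disc: `1 + ∑ a_n z^n` cannot
vanish there. The value `b_0` is `1/(1 + 1/2 + … + 1/q)`, normalising the constant term. For `q ≤ 3`
a constant multiplier suffices; for `q = 4, 5` the normalised coefficients are too large, and a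
factor of degree one or two corrects this. The product has degree at most `4 + 2`, hence seven
coefficients; entries beyond a list are `0`. -/
lemma exists_bdf_multiplier {q : ℕ} (hq1 : 1 ≤ q) (hq5 : q ≤ 5) : ∃ a b : ℕ → ℝ,
    a 0 = 0 ∧ ∑ n ∈ range 7, |a n| < 1 ∧ ∀ z : ℝ,
      bdfQuot q (1 - z) * ∑ n ∈ range 3, b n * z ^ n = 1 + ∑ n ∈ range 7, a n * z ^ n := by
  interval_cases q
  · refine ⟨fun n => [0].getD n 0, fun n => [1].getD n 0, by simp, ?_, fun z => ?_⟩
    · simp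
    · simp [Finset.sum_range_succ, bdfQuot]
  · refine ⟨fun n => [0, -1 / 3].getD n 0, fun n => [2 / 3].getD n 0, by simp, ?_, fun z => ?_⟩
    · simp [Finset.sum_range_succ, abs_div]; norm_num
    · simp [Finset.sum_range_succ, bdfQuot]; ring
  · refine ⟨fun n => [0, -7 / 11, 2 / 11].getD n 0, fun n => [6 / 11].getD n 0, by simp, ?_,
      fun z => ?_⟩
    · simp [Finset.sum_range_succ, abs_div]; norm_num
    · simp [Finset.sum_range_succ, bdfQuot]; ring
  · refine ⟨fun n => [0, -1 / 50, -77 / 250, 87 / 250, -27 / 250].getD n 0,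
      fun n => [12 / 25, 54 / 125].getD n 0, by simp, ?_, fun z => ?_⟩
    · simp [Finset.sum_range_succ, abs_div]; norm_num
    · simp [Finset.sum_range_succ, bdfQuot]; ring
  · refine ⟨fun n => [0, 7 / 685, -19 / 685, 181 / 685, -44 / 685, -54 / 685, 24 / 685].getD n 0,
      fun n => [60 / 137, 72 / 137, 24 / 137].getD n 0, by simp, ?_, fun z => ?_⟩
    · simp [Finset.sum_range_succ, abs_div]; norm_num
    · simp [Finset.sum_range_succ, bdfQuot]; ring

/-- The polynomial `δ_q / (1 - z)` in terms of `z`. -/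
def bdfQuotPoly (q : ℕ) : Polynomial ℝ :=
  ∑ j ∈ range q, Polynomial.C (1 / ((j : ℝ) + 1)) * (1 - Polynomial.X) ^ j

lemma natDegree_one_sub_X_pow_le (j : ℕ) :
    ((1 - Polynomial.X : Polynomial ℝ) ^ j).natDegree ≤ j := by
  have h1 : (1 - Polynomial.X : Polynomial ℝ).natDegree ≤ 1 := by
    refine (Polynomial.natDegree_sub_le _ _).trans ?_
    simp
  refine Polynomial.natDegree_pow_le.trans ?_
  nlinarith

lemma natDegree_bdfQuotPoly_le (q : ℕ) : (bdfQuotPoly q).natDegree ≤ q - 1 := by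
  refine Polynomial.natDegree_sum_le_of_forall_le _ _ fun j hj => ?_
  have := Finset.mem_range.1 hj
  exact (Polynomial.natDegree_C_mul_le _ _).trans ((natDegree_one_sub_X_pow_le j).trans (by omega))

lemma taylorSeries_one_sub_pow (N : ℕ) :
    taylorSeries (fun z : ℝ => (1 - z) ^ N) = (1 - X) ^ N := by
  have h2 := binSeries_add_natCast 0 N
  rw [zero_add, binSeries_zero, mul_one] at h2
  rw [← h2, binSeries, ← taylorSeries_one_sub_rpow]
  simp only [Real.rpow_natCast]

lemma taylorSeries_bdfQuot_one_sub (q : ℕ) :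
    taylorSeries (fun z => bdfQuot q (1 - z)) = (bdfQuotPoly q : ℝ⟦X⟧) := by
  induction q with
  | zero => simpa [bdfQuot, bdfQuotPoly] using taylorSeries_const 0
  | succ N ih =>
    have haN : AnalyticAt ℝ (fun z : ℝ => (1 - z) ^ N) 0 :=
      (analyticAt_const.sub analyticAt_id).pow N
    have := taylorSeries_add (g := fun z : ℝ => 1 / ((N : ℝ) + 1) * (1 - z) ^ N)
      (analyticAt_bdfQuot_one_sub N 0) (analyticAt_const.mul haN)
    rw [taylorSeries_const_mul _ haN, ih, taylorSeries_one_sub_pow] at this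
    simp only [bdfQuot, bdfQuotPoly, Finset.sum_range_succ] at this ⊢
    rw [this]
    push_cast
    rfl

/-- The power series of `(δ_q / (1 - z)) ^ θ`. -/
def bdfQuotSeries (q : ℕ) (θ : ℝ) : ℝ⟦X⟧ := taylorSeries fun z => bdfQuot q (1 - z) ^ θ

/-- Work with the logarithmic derivative `s = G'/G` of `G = δ_q/(1-z)`: multiplying `sG = G'` by the
multiplier `B` gives `s(1+A) = G'B`, so `s` decays geometrically, and `Y = G^θ` solves `Y' = θ s Y`.
No complex powers or roots are involved. -/
lemma geomDecay_bdfQuotSeries {q : ℕ} (hq1 : 1 ≤ q) (hq5 : q ≤ 5) (θ : ℝ) :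
    GeomDecay (bdfQuotSeries q θ) := by
  obtain ⟨a, b, ha0, ha, hab⟩ := exists_bdf_multiplier hq1 hq5
  set G := taylorSeries fun z => bdfQuot q (1 - z) with hG
  set A := taylorSeries fun z => ∑ n ∈ range 7, a n * z ^ n with hA
  set B := taylorSeries fun z => ∑ n ∈ range 3, b n * z ^ n with hB
  have hGB : G * B = 1 + A := by
    rw [hG, hB, ← taylorSeries_mul (analyticAt_bdfQuot_one_sub q 0) (analyticAt_sum_mul_pow b 3 0)]
    simp only [hab]
    rw [taylorSeries_add analyticAt_const (analyticAt_sum_mul_pow a 7 0), taylorSeries_const,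
      map_one]
  have hpos : 0 < bdfQuot q (1 - 0) := bdfQuot_pos hq1 (by norm_num)
  have hG0 : constantCoeff G ≠ 0 := by
    rw [hG, constantCoeff_taylorSeries]
    exact hpos.ne'
  have hGfin : ∀ n, q ≤ n → coeff n G = 0 := fun n hn => by
    rw [hG, taylorSeries_bdfQuot_one_sub, Polynomial.coeff_coe,
      Polynomial.coeff_eq_zero_of_natDegree_lt]
    have := natDegree_bdfQuotPoly_le q
    omega
  set s := derivative ℝ G * G⁻¹ with hs
  have hsG : s * G = derivative ℝ G := by
    rw [hs, mul_assoc, PowerSeries.inv_mul_cancel _ hG0, mul_one]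
  have hgs : GeomDecay s := by
    refine geomDecay_of_add_mul_eq (s := s) (t := A) (p := derivative ℝ G * B) (N := q + 7)
      ?_ ?_ ?_ ?_ ?_
    · rw [← hsG, mul_assoc, hGB]; ring
    · rw [hA, coeff_taylorSeries_sum, if_pos (by norm_num), ha0]
    · intro n hn
      rw [hA, coeff_taylorSeries_sum, if_neg (by omega)]
    · intro n hn
      rw [coeff_mul]
      refine Finset.sum_eq_zero fun p hp => ?_
      have hp' := Finset.HasAntidiagonal.mem_antidiagonal.1 hp
      rcases lt_or_ge p.2 3 with h | h
      · rw [coeff_derivative, hGfin _ (by omega)]; simp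
      · rw [hB, coeff_taylorSeries_sum, if_neg (by omega), mul_zero]
    · refine lt_of_le_of_lt (le_of_eq ?_) ha
      rw [add_comm, Finset.sum_range_add]
      have h1 : ∑ n ∈ range 7, |coeff n A| = ∑ n ∈ range 7, |a n| :=
        Finset.sum_congr rfl fun n hn => by
          rw [hA, coeff_taylorSeries_sum, if_pos (Finset.mem_range.1 hn)]
      rw [h1, Finset.sum_eq_zero (s := range q), add_zero]
      intro n _
      rw [hA, coeff_taylorSeries_sum, if_neg (by omega), abs_zero]
  refine geomDecay_of_derivative_eq (θ := θ) hgs ?_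
  have h1 := taylorSeries_rpow_ode (analyticAt_bdfQuot_one_sub q 0) hpos θ
  rw [← hG, ← bdfQuotSeries, ← hsG] at h1
  have hGne : G ≠ 0 := fun h => hG0 (by simp [h])
  apply mul_left_cancel₀ hGne
  rw [h1]; ring

lemma seriesSum_bdfQuotSeries {q : ℕ} (hq1 : 1 ≤ q) (hq5 : q ≤ 5) (θ : ℝ) {w : ℝ}
    (hw0 : 0 ≤ w) (hw1 : w ≤ 1) :
    seriesSum (bdfQuotSeries q θ) (1 - w) = bdfQuot q w ^ θ := by
  have h := (geomDecay_bdfQuotSeries hq1 hq5 θ).seriesSum_eqOn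
    (g := fun z => bdfQuot q (1 - z) ^ θ) (fun z hz => ?_) rfl (1 - w)
    ⟨by linarith, by linarith⟩
  · simpa using h
  · exact analyticAt_rpow_const (analyticAt_bdfQuot_one_sub q z)
      (bdfQuot_pos hq1 (by linarith [hz.2])) θ

/-- The generating series of Lubich's coefficients. -/
def lubichSeries (q : ℕ) (θ : ℝ) : ℝ⟦X⟧ := PowerSeries.mk (lubichCoeff q θ)

lemma lubichSeries_eq {q : ℕ} (hq1 : 1 ≤ q) (θ : ℝ) :
    lubichSeries q θ = bdfQuotSeries q θ * binSeries θ := by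
  have h1 : lubichSeries q θ = taylorSeries fun z => bdfPoly q z ^ θ := rfl
  have ha : AnalyticAt ℝ (fun z : ℝ => 1 - z) 0 := analyticAt_const.sub analyticAt_id
  have hpos : 0 < bdfQuot q (1 - 0) := bdfQuot_pos hq1 (by norm_num)
  rw [h1, bdfQuotSeries, binSeries, ← taylorSeries_one_sub_rpow, ← taylorSeries_mul
    (analyticAt_rpow_const (analyticAt_bdfQuot_one_sub q 0) hpos θ)
    (analyticAt_rpow_const ha (by norm_num) θ)]
  apply taylorSeries_congr
  filter_upwards [(analyticAt_bdfQuot_one_sub q 0).continuousAt.eventually (lt_mem_nhds hpos),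
    Iio_mem_nhds (zero_lt_one (α := ℝ))] with z hz hz1
  rw [bdfPoly_eq, Real.mul_rpow (sub_pos.2 hz1).le hz.le, mul_comm]

/-- For integer order `δ_q^m` is a polynomial of degree at most `m(q-1) + m = mq`. -/
lemma lubichCoeff_eq_zero {q m k : ℕ} (hq1 : 1 ≤ q) (hk : m * q < k) :
    lubichCoeff q m k = 0 := by
  have h1 : lubichCoeff q m k = coeff k (lubichSeries q m) := by simp [lubichSeries]
  have h2 : bdfQuotSeries q m = ((bdfQuotPoly q ^ m : Polynomial ℝ) : ℝ⟦X⟧) := by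
    rw [bdfQuotSeries]
    simp only [Real.rpow_natCast]
    rw [Polynomial.coe_pow, ← taylorSeries_bdfQuot_one_sub]
    clear h1 hk
    induction m with
    | zero => simpa using taylorSeries_const 1
    | succ m ih =>
      have ha := analyticAt_bdfQuot_one_sub q 0
      simp only [pow_succ]
      rw [taylorSeries_mul (f := fun z => bdfQuot q (1 - z) ^ m) (ha.pow m) ha, ih]
  have h3 : binSeries m = ((1 - Polynomial.X : Polynomial ℝ) ^ m : Polynomial ℝ) := by
    have := binSeries_add_natCast 0 m
    rw [zero_add, binSeries_zero, mul_one] at this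
    rw [this]
    push_cast
    rfl
  rw [h1, lubichSeries_eq hq1, h2, h3, ← Polynomial.coe_mul, Polynomial.coeff_coe]
  apply Polynomial.coeff_eq_zero_of_natDegree_lt
  refine lt_of_le_of_lt Polynomial.natDegree_mul_le (lt_of_le_of_lt ?_ hk)
  have h4 := natDegree_bdfQuotPoly_le q
  have h5 : (bdfQuotPoly q ^ m).natDegree ≤ m * (q - 1) :=
    Polynomial.natDegree_pow_le.trans (Nat.mul_le_mul_left m h4)
  refine (add_le_add h5 (natDegree_one_sub_X_pow_le m)).trans (le_of_eq ?_)
  obtain ⟨p, rfl⟩ := Nat.exists_eq_add_of_le hq1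
  rw [Nat.add_sub_cancel_left]
  ring

/-- The first `q` coefficients of `(δ_q / w) ^ θ` and of `(log (1 / (1 - w)) / w) ^ θ` agree. -/
lemma coeff_taylorSeries_bdfQuot_rpow {q : ℕ} (hq1 : 1 ≤ q) (θ : ℝ) :
    ∀ i < q, coeff i (taylorSeries fun w => bdfQuot q w ^ θ) = coeff i (logSeries θ) := by
  have hpos : 0 < bdfQuot q 0 := bdfQuot_pos hq1 le_rfl
  have h0 : bdfQuot q 0 = 1 := by
    rw [bdfQuot, Finset.sum_eq_single 0] <;> simp +contextual
    omega
  have hco : ∀ n < q, coeff n (taylorSeries (bdfQuot q)) = coeff n (taylorSeries logQuot) := by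
    intro n hn
    have : bdfQuot q = fun w => ∑ j ∈ range q, 1 / ((j : ℝ) + 1) * w ^ j := rfl
    rw [coeff_taylorSeries_logQuot, this,
      coeff_taylorSeries_sum (fun j => 1 / ((j : ℝ) + 1)), if_pos hn]
  -- `δ_q/w` is the truncation after `q` terms of `-log(1-w)/w = ∑ w^j/(j+1)`; the differential
  -- equation transfers the agreement to the powers `θ`.
  refine coeff_eq_of_ode hco ?_ ?_
    (taylorSeries_rpow_ode (analyticAt_bdfQuot q 0) hpos θ)
    (taylorSeries_rpow_ode analyticAt_logQuot logQuot_pos θ)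
  · rw [coeff_zero_eq_constantCoeff_apply, constantCoeff_taylorSeries]
    exact hpos.ne'
  · rw [coeff_zero_eq_constantCoeff_apply, constantCoeff_taylorSeries,
      coeff_zero_logSeries, h0, Real.one_rpow]

/-- Convolution of Lubich's coefficients with the `l`-th powers. -/
def lubichPow (q : ℕ) (θ : ℝ) (l n : ℕ) : ℝ :=
  ∑ k ∈ range (n + 1), lubichCoeff q θ k * ((n - k : ℕ) : ℝ) ^ l

lemma lubichPow_eq (q : ℕ) (hq1 : 1 ≤ q) (θ : ℝ) (l n : ℕ) : lubichPow q θ l n =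
    ∑ i ∈ range (l + 1), coeff i (powSeries l) *
      coeff n (bdfQuotSeries q θ * binSeries (θ - l - 1 + i)) := by
  have h1 : lubichPow q θ l n = coeff n (lubichSeries q θ *
      ∑ i ∈ range (l + 1), C (coeff i (powSeries l)) * binSeries (-((l : ℝ) + 1) + i)) := by
    rw [coeff_mul, Nat.sum_antidiagonal_eq_sum_range_succ_mk, lubichPow]
    refine Finset.sum_congr rfl fun k _ => ?_
    rw [lubichSeries, coeff_mk, natCast_pow_eq_sum, map_sum]
    simp only [coeff_C_mul, coeff_binSeries]
  rw [h1, lubichSeries_eq hq1, Finset.mul_sum, map_sum]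
  refine Finset.sum_congr rfl fun i _ => ?_
  rw [← coeff_C_mul]
  congr 1
  have : θ - l - 1 + i = θ + (-((l : ℝ) + 1) + i) := by ring
  rw [this, binSeries_add θ]
  ring

/-- The singular expansion of `∑ k ≤ n, ω_k (n - k) ^ l`, up to the leading `min q (l + 1)` terms
explicit. -/
lemma exists_hasExp_lubichPow {q : ℕ} (hq1 : 1 ≤ q) (hq5 : q ≤ 5) (θ : ℝ) (l : ℕ) :
    ∃ f : ℝ⟦X⟧, HasExp (lubichPow q θ l) (θ - l - 1) f ∧ ∀ i, i < q → i ≤ l →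
      coeff i f = l.factorial * coeff i (logSeries (θ - l - 1)) := by
  set R := taylorSeries fun w => bdfQuot q w ^ θ with hR
  set P : ℝ⟦X⟧ := ∑ i ∈ range (l + 1), C (coeff i (powSeries l)) * X ^ i with hP
  have hPc : ∀ i, i ≤ l → coeff i P = l.factorial * coeff i (logSeries (-((l : ℝ) + 1))) := by
    intro i hi
    rw [← coeff_powSeries hi, hP, map_sum]
    simp [coeff_X_pow, -coeff_zero_eq_constantCoeff, hi]
  refine ⟨P * R, ?_, fun i hi hil => ?_⟩
  · rw [hP, Finset.sum_mul]
    refine HasExp.congr (x := fun n => ∑ i ∈ range (l + 1), coeff i (powSeries l) *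
      coeff n (bdfQuotSeries q θ * binSeries (θ - l - 1 + i))) (HasExp.sum _ fun i _ => ?_)
      fun n => (lubichPow_eq q hq1 θ l n).symm
    rw [mul_assoc]
    refine HasExp.const_mul (HasExp.X_pow_mul i ?_) _
    refine (geomDecay_bdfQuotSeries hq1 hq5 θ).hasExp
      (analyticAt_rpow_const (analyticAt_bdfQuot q 0) (bdfQuot_pos hq1 le_rfl) θ) ?_ _
    have hev : ∀ᶠ w in 𝓝[>] (0 : ℝ), w < 1 := nhdsWithin_le_nhds (Iio_mem_nhds zero_lt_one)
    filter_upwards [hev, self_mem_nhdsWithin] with w hw1 hw0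
    exact seriesSum_bdfQuotSeries hq1 hq5 θ (le_of_lt hw0) hw1.le
  -- `P` matches `l! (t/w)^{-l-1}` in `l+1` coefficients and `R` matches `(t/w)^θ` in `q`
  -- coefficients, so the product matches in the smaller number.
  · have h1 := coeff_mul_congr (k := min q (l + 1)) (A := P)
      (A' := C (l.factorial : ℝ) * logSeries (-((l : ℝ) + 1))) (B := R) (B' := logSeries θ)
      (fun j hj => by rw [hPc j (by omega), coeff_C_mul])
      (fun j hj => coeff_taylorSeries_bdfQuot_rpow hq1 θ j (by omega)) i (by omega)
    rw [h1, mul_assoc, coeff_C_mul, ← logSeries_add]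
    congr 3
    ring

/-! ### The singular expansion of `n ^ (-θ)` -/

/-- Both claims follow from the fact that the beta density has total mass one. -/
lemma integral_rpow_mul_one_sub_rpow {a b : ℝ} (ha : 0 < a) (hb : 0 < b) :
    IntegrableOn (fun x : ℝ => x ^ (a - 1) * (1 - x) ^ (b - 1)) (Set.Ioo 0 1) ∧
      ∫ x in Set.Ioo (0 : ℝ) 1, x ^ (a - 1) * (1 - x) ^ (b - 1) =
        Real.Gamma a * Real.Gamma b / Real.Gamma (a + b) := by
  have hB := ProbabilityTheory.beta_pos ha hb
  set B := ProbabilityTheory.beta a b with hBdef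
  have h1 : ∫⁻ x in Set.Ioo (0 : ℝ) 1,
      ENNReal.ofReal (1 / B * x ^ (a - 1) * (1 - x) ^ (b - 1)) = 1 := by
    rw [hBdef, ← ProbabilityTheory.lintegral_betaPDF]
    exact ProbabilityTheory.lintegral_betaPDF_eq_one ha hb
  have hnn : 0 ≤ᵐ[volume.restrict (Set.Ioo (0 : ℝ) 1)]
      fun x : ℝ => 1 / B * x ^ (a - 1) * (1 - x) ^ (b - 1) := by
    refine (ae_restrict_iff' measurableSet_Ioo).2 (ae_of_all _ fun x hx => ?_)
    have h2 : 0 ≤ 1 - x := by linarith [hx.2]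
    have h3 : 0 ≤ x := hx.1.le
    simp only [Pi.zero_apply]
    positivity
  have hm : Measurable fun x : ℝ => 1 / B * x ^ (a - 1) * (1 - x) ^ (b - 1) := by fun_prop
  have hint : IntegrableOn (fun x : ℝ => 1 / B * x ^ (a - 1) * (1 - x) ^ (b - 1))
      (Set.Ioo 0 1) := by
    refine ⟨hm.aestronglyMeasurable, ?_⟩
    rw [hasFiniteIntegral_iff_ofReal hnn, h1]
    exact ENNReal.one_lt_top
  have hval : ∫ x in Set.Ioo (0 : ℝ) 1, 1 / B * x ^ (a - 1) * (1 - x) ^ (b - 1) = 1 := by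
    rw [integral_eq_lintegral_of_nonneg_ae hnn hm.aestronglyMeasurable, h1]
    simp
  have e : (fun x : ℝ => x ^ (a - 1) * (1 - x) ^ (b - 1)) =
      fun x => B * (1 / B * x ^ (a - 1) * (1 - x) ^ (b - 1)) := by
    ext x; field_simp
  rw [e]
  refine ⟨hint.const_mul B, ?_⟩
  rw [integral_const_mul, hval, mul_one, hBdef, ProbabilityTheory.beta]

/-- The substitution `e^{-t}` in the Beta integral with parameters `x - e` and `e + 1`. -/
lemma integral_exp_mul_exp_sub_one_rpow {e x : ℝ} (he : -1 < e) (hx : e < x) :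
    IntegrableOn (fun t : ℝ => Real.exp (-x * t) * (Real.exp t - 1) ^ e) (Set.Ioi 0) ∧
      ∫ t in Set.Ioi (0 : ℝ), Real.exp (-x * t) * (Real.exp t - 1) ^ e =
        Real.Gamma (x - e) * Real.Gamma (e + 1) / Real.Gamma (x + 1) := by
  obtain ⟨h1, h2⟩ := integral_rpow_mul_one_sub_rpow (a := x - e) (b := e + 1) (by linarith)
    (by linarith)
  have himg : (fun t : ℝ => Real.exp (-t)) '' Set.Ioi 0 = Set.Ioo 0 1 := by
    ext y
    constructor
    · rintro ⟨t, ht, rfl⟩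
      have : (0 : ℝ) < t := ht
      exact ⟨Real.exp_pos _, by simpa using this⟩
    · intro hy
      exact ⟨-Real.log y, neg_pos.2 (Real.log_neg hy.1 hy.2), by simp [Real.exp_log hy.1]⟩
  have hd : ∀ t ∈ Set.Ioi (0 : ℝ),
      HasDerivWithinAt (fun t : ℝ => Real.exp (-t)) (-Real.exp (-t)) (Set.Ioi 0) t := by
    intro t _
    have := ((hasDerivAt_id t).neg.exp).hasDerivWithinAt (s := Set.Ioi 0)
    simpa using this
  have hinj : Set.InjOn (fun t : ℝ => Real.exp (-t)) (Set.Ioi 0) := by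
    intro s _ t _ h
    simpa using h
  have hcongr : ∀ t ∈ Set.Ioi (0 : ℝ),
      |(-Real.exp (-t))| • (Real.exp (-t) ^ (x - e - 1) * (1 - Real.exp (-t)) ^ (e + 1 - 1)) =
        Real.exp (-x * t) * (Real.exp t - 1) ^ e := by
    intro t ht
    have ht' : (0 : ℝ) < t := ht
    have h3 : 0 ≤ Real.exp t - 1 := by linarith [Real.add_one_le_exp t]
    have h4 : 1 - Real.exp (-t) = Real.exp (-t) * (Real.exp t - 1) := by
      rw [mul_sub, ← Real.exp_add]; simp
    rw [abs_neg, abs_of_pos (Real.exp_pos _), smul_eq_mul, h4, add_sub_cancel_right,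
      Real.mul_rpow (Real.exp_pos _).le h3, ← Real.exp_mul, ← Real.exp_mul, ← mul_assoc,
      ← mul_assoc, ← Real.exp_add, ← Real.exp_add]
    congr 2
    ring
  rw [← himg] at h1 h2
  have h3 := (integrableOn_image_iff_integrableOn_abs_deriv_smul measurableSet_Ioi hd hinj _).1 h1
  rw [integral_image_eq_integral_abs_deriv_smul measurableSet_Ioi hd hinj] at h2
  refine ⟨h3.congr_fun hcongr measurableSet_Ioi, ?_⟩
  rw [← setIntegral_congr_fun measurableSet_Ioi hcongr, h2]
  congr 2
  ring

lemma Gamma_natCast_sub {e : ℝ} (he : ∀ k : ℕ, e ≠ k) (n : ℕ) :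
    Real.Gamma (n - e) = Real.Gamma (-e) * binCoeff e n * Real.Gamma (n + 1) := by
  induction n with
  | zero => simp
  | succ n ih =>
    have h1 : (n : ℝ) - e ≠ 0 := fun h => he n (by linarith)
    have h2 : ((n + 1 : ℕ) : ℝ) - e = (n - e) + 1 := by push_cast; ring
    have h3 : (n : ℝ) + 1 ≠ 0 := by positivity
    rw [h2, Real.Gamma_add_one h1, ih, binCoeff_succ, Nat.cast_succ, Real.Gamma_add_one h3]
    field_simp

/-- Raising `i` by one multiplies one Gamma factor by some `r` and divides the other by `-r`, which
changes the sign. -/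
lemma Gamma_mul_Gamma_shift {θ : ℝ} (hθ : ∀ k : ℤ, θ ≠ k) (i : ℕ) :
    Real.Gamma (-(θ - 1 + i)) * Real.Gamma (θ - 1 + i + 1) =
      (-1) ^ i * (Real.Gamma (1 - θ) * Real.Gamma θ) := by
  induction i with
  | zero => simp
  | succ i ih =>
    have h1 : θ - 1 + i + 1 ≠ 0 := fun h => hθ (-i) (by push_cast; linarith)
    have e1 : -(θ - 1 + ((i + 1 : ℕ) : ℝ)) = -(θ - 1 + i + 1) := by push_cast; ring
    have e2 : θ - 1 + ((i + 1 : ℕ) : ℝ) + 1 = (θ - 1 + i + 1) + 1 := by push_cast; ring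
    have e3 : -(θ - 1 + i) = -(θ - 1 + i + 1) + 1 := by ring
    rw [e1, e2, Real.Gamma_add_one h1, pow_succ]
    rw [e3, Real.Gamma_add_one (neg_ne_zero.2 h1)] at ih
    linear_combination -ih

/-- Global form of the Taylor expansion of `(log (1 + y) / y) ^ c`. -/
lemma exists_logQuot_rpow_bound {c : ℝ} (hc : -1 ≤ c) {M : ℕ} (hM : 1 ≤ M) :
    ∃ K, 0 ≤ K ∧ ∀ y : ℝ, 0 < y →
      |logQuot (-y) ^ c - ∑ i ∈ range M, coeff i (logSeries c) * (-y) ^ i| ≤ K * y ^ M := by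
  have h := isBigO_taylorSeries (analyticAt_rpow_const analyticAt_logQuot logQuot_pos c) M
  obtain ⟨K₁, hK₁⟩ := h.bound
  obtain ⟨ε, hε, hball⟩ := Metric.eventually_nhds_iff.1 hK₁
  rw [← logSeries] at hball
  -- For `y ≥ ε`, `y^i ≤ y^M / ε^{M-i}`. The first two terms absorb the bound `1 + y` of the
  -- function, available because `c ≥ -1` and dominated because `M ≥ 1`; the sum absorbs the Taylor
  -- polynomial.
  set K₂ := 1 / ε ^ M + 1 / ε ^ (M - 1) + ∑ i ∈ range M, |coeff i (logSeries c)| / ε ^ (M - i)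
    with hK₂
  have hK₂0 : 0 ≤ K₂ := by positivity
  refine ⟨|K₁| + K₂, by positivity, fun y hy => ?_⟩
  have hyM : 0 ≤ y ^ M := by positivity
  rcases lt_or_ge y ε with hyε | hyε
  · have := hball (y := -y) (by simpa [abs_of_pos hy] using hyε)
    rw [Real.norm_eq_abs, norm_pow, norm_neg, Real.norm_of_nonneg hy.le] at this
    refine this.trans ?_
    have := le_abs_self K₁
    nlinarith
  · have hlow : y / (1 + y) ≤ Real.log (1 + y) := by
      have := Real.one_sub_inv_le_log_of_pos (x := 1 + y) (by positivity)
      refine le_trans (le_of_eq ?_) this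
      field_simp; ring
    have hup : Real.log (1 + y) ≤ y := by
      have := Real.log_le_sub_one_of_pos (x := 1 + y) (by positivity)
      linarith
    have hlq : logQuot (-y) = Real.log (1 + y) / y := by
      rw [logQuot_of_ne (by linarith), sub_neg_eq_add, neg_div_neg_eq]
    have hq1 : logQuot (-y) ≤ 1 := by rw [hlq, div_le_one hy]; exact hup
    have hq2 : 1 / (1 + y) ≤ logQuot (-y) := by
      rw [hlq, le_div_iff₀ hy]; exact le_trans (le_of_eq (by ring)) hlow
    have hq0 : 0 < logQuot (-y) := lt_of_lt_of_le (by positivity) hq2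
    have hF : |logQuot (-y) ^ c| ≤ 1 + y := by
      rw [abs_of_nonneg (by positivity)]
      rcases le_total 0 c with hc0 | hc0
      · exact (Real.rpow_le_one hq0.le hq1 hc0).trans (by linarith)
      · calc logQuot (-y) ^ c ≤ (1 / (1 + y)) ^ c :=
              Real.rpow_le_rpow_of_nonpos (by positivity) hq2 hc0
          _ = (1 + y) ^ (-c) := by
              rw [one_div, Real.inv_rpow (by positivity), Real.rpow_neg (by positivity)]
          _ ≤ (1 + y) ^ (1 : ℝ) :=
              Real.rpow_le_rpow_of_exponent_le (by linarith) (by linarith)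
          _ = 1 + y := Real.rpow_one _
    have hpow : ∀ i, i ≤ M → y ^ i ≤ y ^ M / ε ^ (M - i) := by
      intro i hi
      rw [le_div_iff₀ (by positivity), ← pow_mul_pow_sub y hi]
      gcongr
    have hS : |∑ i ∈ range M, coeff i (logSeries c) * (-y) ^ i| ≤
        ∑ i ∈ range M, |coeff i (logSeries c)| / ε ^ (M - i) * y ^ M := by
      refine (Finset.abs_sum_le_sum_abs _ _).trans (Finset.sum_le_sum fun i hi => ?_)
      rw [abs_mul, abs_pow, abs_neg, abs_of_pos hy]
      calc |coeff i (logSeries c)| * y ^ i ≤ |coeff i (logSeries c)| * (y ^ M / ε ^ (M - i)) := by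
            gcongr; exact hpow i (Finset.mem_range.1 hi).le
        _ = _ := by ring
    have h0 := hpow 0 (Nat.zero_le _)
    have h1 := hpow 1 hM
    rw [pow_zero, Nat.sub_zero] at h0
    rw [pow_one] at h1
    calc |logQuot (-y) ^ c - ∑ i ∈ range M, coeff i (logSeries c) * (-y) ^ i|
        ≤ |logQuot (-y) ^ c| + |∑ i ∈ range M, coeff i (logSeries c) * (-y) ^ i| := abs_sub _ _
      _ ≤ (y ^ M / ε ^ M + y ^ M / ε ^ (M - 1)) +
          ∑ i ∈ range M, |coeff i (logSeries c)| / ε ^ (M - i) * y ^ M :=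
          add_le_add (hF.trans (add_le_add h0 h1)) hS
      _ = K₂ * y ^ M := by rw [hK₂, ← Finset.sum_mul]; ring
      _ ≤ _ := by
          have := abs_nonneg K₁
          nlinarith

/-- A form of Watson's lemma adapted to the scale. Start from `Γ(θ) n^{-θ} = ∫ t^{θ-1} e^{-nt} dt`,
put `y = e^t - 1`, so `t = y · logQuot(-y)`, and expand `t^{θ-1}` in the functions `y^{θ-1+i}`.
Their moments against `e^{-nt}` are Beta integrals, equal to `(-1)^i κ` times `binCoeff (θ-1+i) n`.
Since `θ` is not an integer, the Gamma factors are finite and nonzero. -/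
lemma hasExp_rpow_neg {θ : ℝ} (hθ0 : 0 < θ) (hθ : ∀ k : ℤ, θ ≠ k) :
    HasExp (fun n => (n : ℝ) ^ (-θ) / Real.Gamma (1 - θ)) (θ - 1) (logSeries (θ - 1)) := by
  have hG1 : Real.Gamma (1 - θ) ≠ 0 := Real.Gamma_ne_zero fun m h =>
    hθ (m + 1) (by push_cast; linarith)
  have hG2 : Real.Gamma θ ≠ 0 := (Real.Gamma_pos_of_pos hθ0).ne'
  have hne : ∀ i : ℕ, ∀ k : ℕ, θ - 1 + i ≠ k := fun i k h =>
    hθ (k + 1 - i) (by push_cast; linarith)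
  set κ := Real.Gamma (1 - θ) * Real.Gamma θ with hκ
  have hκ0 : κ ≠ 0 := mul_ne_zero hG1 hG2
  -- the moments of `(e ^ t - 1) ^ (θ - 1 + i)`
  have hI : ∀ i n : ℕ, θ - 1 + i < n →
      ∫ t in Set.Ioi (0 : ℝ), Real.exp (-n * t) * (Real.exp t - 1) ^ (θ - 1 + i) =
        (-1) ^ i * κ * binCoeff (θ - 1 + i) n := by
    intro i n hn
    have hi0 : (0 : ℝ) ≤ i := i.cast_nonneg
    rw [(integral_exp_mul_exp_sub_one_rpow (e := θ - 1 + i) (by linarith) hn).2,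
      Gamma_natCast_sub (hne i), hκ, ← Gamma_mul_Gamma_shift hθ i]
    have : Real.Gamma ((n : ℝ) + 1) ≠ 0 := (Real.Gamma_pos_of_pos (by positivity)).ne'
    field_simp
  intro M
  -- The global Taylor bound needs `M ≥ 1`; order zero is just the size of `n^{-θ}`.
  rcases Nat.eq_zero_or_pos M with rfl | hM
  · refine exists_bound_of_eventually_bound (n₀ := 1) (K := 2 ^ θ / |Real.Gamma (1 - θ)|)
      fun n hn => ?_
    have hn' : (1 : ℝ) ≤ n := by exact_mod_cast hn
    have e : -(θ - 1 + ((0 : ℕ) : ℝ)) - 1 = -θ := by push_cast; ring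
    rw [Finset.range_zero, Finset.sum_empty, sub_zero, e, abs_div, div_mul_eq_mul_div]
    gcongr
    rw [abs_of_nonneg (by positivity), Real.rpow_neg (by positivity), Real.rpow_neg (by positivity),
      ← div_eq_mul_inv, inv_eq_one_div, div_le_div_iff₀ (by positivity) (by positivity), one_mul,
      ← Real.mul_rpow (by norm_num) (by positivity)]
    exact Real.rpow_le_rpow (by positivity) (by linarith) hθ0.le
  obtain ⟨K, hK0, hK⟩ := exists_logQuot_rpow_bound (c := θ - 1) (by linarith) hM
  obtain ⟨B, hB0, hB⟩ := exists_abs_binCoeff_le (θ - 1 + M)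
  -- The moments up to order `M` converge at infinity only for `n > θ - 1 + M`; the remaining
  -- finitely many `n` go into the constant.
  obtain ⟨n₀, hn₀⟩ := exists_nat_gt (θ - 1 + M)
  refine exists_bound_of_eventually_bound (n₀ := max n₀ 1) (K := K * B) fun n hn => ?_
  have hn1 : (1 : ℝ) ≤ n := by exact_mod_cast (le_max_right n₀ 1).trans hn
  have hnM : θ - 1 + M < n :=
    hn₀.trans_le (by exact_mod_cast (le_max_left n₀ 1).trans hn)
  have hni : ∀ i ∈ range M, θ - 1 + (i : ℝ) < n := fun i hi => by
    have : (i : ℝ) ≤ M := by exact_mod_cast (Finset.mem_range.1 hi).le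
    linarith
  have hint : ∀ i : ℕ, θ - 1 + i < n →
      IntegrableOn (fun t : ℝ => Real.exp (-n * t) * (Real.exp t - 1) ^ (θ - 1 + i))
        (Set.Ioi 0) := fun i hi =>
    (integral_exp_mul_exp_sub_one_rpow (by linarith [i.cast_nonneg (α := ℝ)]) hi).1
  have hΓ : ∫ t in Set.Ioi (0 : ℝ), t ^ (θ - 1) * Real.exp (-(n * t)) =
      (1 / (n : ℝ)) ^ θ * Real.Gamma θ :=
    Real.integral_rpow_mul_exp_neg_mul_Ioi hθ0 (by linarith)
  -- The integral of a nonintegrable function is `0` by convention, whereas this value is positive.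
  have hΓint : IntegrableOn (fun t : ℝ => t ^ (θ - 1) * Real.exp (-(n * t))) (Set.Ioi 0) := by
    by_contra hcon
    rw [integral_undef hcon] at hΓ
    have : (0 : ℝ) < (1 / (n : ℝ)) ^ θ * Real.Gamma θ :=
      mul_pos (by positivity) (Real.Gamma_pos_of_pos hθ0)
    linarith
  set e : ℕ → ℝ := fun i => coeff i (logSeries (θ - 1)) with he
  -- the integrated remainder
  have hrem : (n : ℝ) ^ (-θ) * Real.Gamma θ - κ * ∑ i ∈ range M, e i * binCoeff (θ - 1 + i) n =
      ∫ t in Set.Ioi (0 : ℝ), (t ^ (θ - 1) * Real.exp (-(n * t)) -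
        ∑ i ∈ range M, e i * (-1) ^ i *
          (Real.exp (-n * t) * (Real.exp t - 1) ^ (θ - 1 + i))) := by
    rw [integral_sub hΓint, hΓ, integral_finsetSum, Finset.mul_sum, one_div,
      Real.inv_rpow (by positivity), Real.rpow_neg (by positivity)]
    · congr 1
      refine Finset.sum_congr rfl fun i hi => ?_
      rw [integral_const_mul, hI i n (hni i hi)]
      have : ((-1 : ℝ) ^ i) * (-1) ^ i = 1 := by rw [← mul_pow]; simp
      linear_combination (-(κ * e i * binCoeff (θ - 1 + i) n)) * this
    · exact fun i hi => (hint i (hni i hi)).const_mul _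
    · exact integrable_finsetSum _ fun i hi => (hint i (hni i hi)).const_mul _
  have hbd : |∫ t in Set.Ioi (0 : ℝ), (t ^ (θ - 1) * Real.exp (-(n * t)) -
        ∑ i ∈ range M, e i * (-1) ^ i *
          (Real.exp (-n * t) * (Real.exp t - 1) ^ (θ - 1 + i)))| ≤
      K * |κ| * |binCoeff (θ - 1 + M) n| := by
    have h1 := norm_integral_le_of_norm_le ((hint M hnM).const_mul K)
      (f := fun t : ℝ => t ^ (θ - 1) * Real.exp (-(n * t)) -
        ∑ i ∈ range M, e i * (-1) ^ i *
          (Real.exp (-n * t) * (Real.exp t - 1) ^ (θ - 1 + i)))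
      ((ae_restrict_iff' measurableSet_Ioi).2 (ae_of_all _ fun t ht => ?_))
    · rw [integral_const_mul, hI M n hnM, Real.norm_eq_abs] at h1
      refine h1.trans ((le_abs_self _).trans (le_of_eq ?_))
      rw [abs_mul, abs_mul, abs_mul, abs_pow, abs_neg, abs_one, one_pow, one_mul,
        abs_of_nonneg hK0]
      ring
    · have ht' : (0 : ℝ) < t := ht
      set y := Real.exp t - 1 with hy
      have hy0 : 0 < y := by
        have := Real.add_one_lt_exp ht'.ne'
        rw [hy]; linarith
      have hty : t = y * logQuot (-y) := by
        have := mul_logQuot (-y)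
        rw [sub_neg_eq_add, hy, add_sub_cancel, Real.log_exp] at this
        rw [hy]; linarith
      have hq0 : 0 < logQuot (-y) := by
        by_contra hcon
        have := mul_nonpos_of_nonneg_of_nonpos hy0.le (not_lt.1 hcon)
        linarith
      have hE : t ^ (θ - 1) * Real.exp (-(n * t)) -
          ∑ i ∈ range M, e i * (-1) ^ i * (Real.exp (-n * t) * y ^ (θ - 1 + i)) =
          Real.exp (-n * t) * y ^ (θ - 1) *
            (logQuot (-y) ^ (θ - 1) - ∑ i ∈ range M, e i * (-y) ^ i) := by
        have h3 : t ^ (θ - 1) = y ^ (θ - 1) * logQuot (-y) ^ (θ - 1) := by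
          conv_lhs => rw [hty]
          exact Real.mul_rpow hy0.le hq0.le
        rw [h3, mul_sub, Finset.mul_sum, neg_mul]
        congr 1
        · ring
        · refine Finset.sum_congr rfl fun i _ => ?_
          rw [Real.rpow_add hy0, Real.rpow_natCast, neg_pow y]
          ring
      rw [hE, Real.norm_eq_abs, abs_mul, abs_of_nonneg (by positivity), Real.rpow_add hy0,
        Real.rpow_natCast]
      calc Real.exp (-n * t) * y ^ (θ - 1) *
            |logQuot (-y) ^ (θ - 1) - ∑ i ∈ range M, e i * (-y) ^ i|
          ≤ Real.exp (-n * t) * y ^ (θ - 1) * (K * y ^ M) := by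
            gcongr; exact hK y hy0
        _ = _ := by ring
  rw [← hrem] at hbd
  have hfac : (n : ℝ) ^ (-θ) / Real.Gamma (1 - θ) -
      ∑ i ∈ range M, e i * binCoeff (θ - 1 + i) n =
      κ⁻¹ * ((n : ℝ) ^ (-θ) * Real.Gamma θ -
        κ * ∑ i ∈ range M, e i * binCoeff (θ - 1 + i) n) := by
    rw [mul_sub, inv_mul_cancel_left₀ hκ0, hκ]
    field_simp
  rw [hfac, abs_mul, abs_inv]
  have hκ' : 0 < |κ| := abs_pos.2 hκ0
  calc |κ|⁻¹ * _ ≤ |κ|⁻¹ * (K * |κ| * |binCoeff (θ - 1 + M) n|) := by gcongr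
    _ = K * |binCoeff (θ - 1 + M) n| := by field_simp
    _ ≤ K * (B * ((n : ℝ) + 1) ^ (-(θ - 1 + M) - 1)) := by gcongr; exact hB n
    _ = _ := by ring

/-! ### The error kernel -/

/-- The coefficient of `x ^ (l - θ)` in the fractional derivative of `x ^ l`
(it vanishes if `θ` is an integer `> l`). -/
def powCoeff (θ : ℝ) (l : ℕ) : ℝ := (l.factorial : ℝ) / Real.Gamma (l + 1 - θ)

/-- For `θ = l + 1` both sides vanish, thanks to the convention `Real.Gamma 0 = 0`; integer orders
thus need no separate differentiation rule. -/
lemma powCoeff_succ_mul (θ : ℝ) (l : ℕ) :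
    powCoeff θ (l + 1) * (((l + 1 : ℕ) : ℝ) - θ) = ((l : ℝ) + 1) * powCoeff θ l := by
  have e : ((l + 1 : ℕ) : ℝ) + 1 - θ = (l + 1 - θ) + 1 := by push_cast; ring
  rw [powCoeff, powCoeff, Nat.factorial_succ, e, Nat.cast_succ]
  by_cases h : (l : ℝ) + 1 - θ = 0
  · rw [h, Real.Gamma_zero]; simp
  · rw [Real.Gamma_add_one h]
    push_cast
    field_simp

/-- The error of the convolution quadrature with the nodes `0, 1, …, n` for `x ^ l`. -/
def errPiece (q : ℕ) (θ : ℝ) (l n : ℕ) (x : ℝ) : ℝ :=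
  powCoeff θ l * x ^ ((l : ℝ) - θ) - ∑ k ∈ range (n + 1), lubichCoeff q θ k * (x - k) ^ l

/-- The error at `x` of the convolution quadrature with unit step for `x ^ l`. -/
def errKernel (q : ℕ) (θ : ℝ) (l : ℕ) (x : ℝ) : ℝ := errPiece q θ l ⌊x⌋₊ x

lemma errKernel_natCast (q : ℕ) (θ : ℝ) (l n : ℕ) :
    errKernel q θ l n = powCoeff θ l * (n : ℝ) ^ ((l : ℝ) - θ) - lubichPow q θ l n := by
  rw [errKernel, Nat.floor_natCast, errPiece, lubichPow]
  congr 1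
  refine Finset.sum_congr rfl fun k hk => ?_
  rw [Nat.cast_sub (Nat.lt_succ_iff.1 (Finset.mem_range.1 hk))]

/-- Multiplication by `n` turns the expansion for `l` into the one for `l + 1`, because `eulerOp`
maps logarithmic series to multiples of such series. -/
lemma hasExp_rpow {θ : ℝ} (hθ0 : 0 < θ) (hθ : ∀ k : ℤ, θ ≠ k) (l : ℕ) :
    HasExp (fun n => (n : ℝ) ^ ((l : ℝ) - θ) / Real.Gamma (l + 1 - θ)) (θ - l - 1)
      (logSeries (θ - l - 1)) := by
  induction l with
  | zero => simpa using hasExp_rpow_neg hθ0 hθ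
  | succ l ih =>
    have hne : (l : ℝ) + 1 - θ ≠ 0 := fun h => hθ (l + 1) (by push_cast; linarith)
    have h := (ih.natCast_mul).const_mul ((l : ℝ) + 1 - θ)⁻¹
    have e1 : θ - ((l + 1 : ℕ) : ℝ) - 1 = θ - l - 1 - 1 := by push_cast; ring
    have e2 : ((l + 1 : ℕ) : ℝ) + 1 - θ = (l + 1 - θ) + 1 := by push_cast; ring
    rw [eulerOp_logSeries, ← mul_assoc, ← map_mul] at h
    have e3 : ((l : ℝ) + 1 - θ)⁻¹ * -(θ - l - 1) = 1 := by
      have : -(θ - l - 1) = (l : ℝ) + 1 - θ := by ring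
      rw [this, inv_mul_cancel₀ hne]
    rw [e3, map_one, one_mul] at h
    rw [e1, e2]
    refine h.congr fun n => ?_
    rw [Real.Gamma_add_one hne]
    rcases Nat.eq_zero_or_pos n with rfl | hn
    · have : ((l + 1 : ℕ) : ℝ) - θ ≠ 0 := by push_cast; exact hne
      rw [Nat.cast_zero, Real.zero_rpow this]; simp
    · have hn' : (n : ℝ) ≠ 0 := by positivity
      have e4 : ((l + 1 : ℕ) : ℝ) - θ = (l - θ) + 1 := by push_cast; ring
      rw [e4, Real.rpow_add_one hn']
      field_simp

/-- The expansions of the exact value and of the quadrature share their first `min q (l+1)`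
coefficients, so their difference has the size of the first term not cancelled. -/
lemma exists_errKernel_natCast_bound_of_not_int {q : ℕ} (hq1 : 1 ≤ q) (hq5 : q ≤ 5) {θ : ℝ}
    (hθ0 : 0 < θ) (hθ : ∀ k : ℤ, θ ≠ k) (l : ℕ) :
    ∃ K, ∀ n : ℕ, |errKernel q θ l n| ≤
      K * ((n : ℝ) + 1) ^ ((l : ℝ) - θ - (min q (l + 1) : ℕ)) := by
  obtain ⟨f, hf, hfc⟩ := exists_hasExp_lubichPow hq1 hq5 θ l
  have h := ((hasExp_rpow hθ0 hθ l).const_mul (l.factorial : ℝ)).sub hf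
  obtain ⟨K, hK⟩ := h.bound (M := min q (l + 1)) fun i hi => by
    rw [map_sub, coeff_C_mul, hfc i (by omega) (by omega), sub_self]
  refine ⟨K, fun n => ?_⟩
  have := hK n
  have e1 : -(θ - l - 1 + (min q (l + 1) : ℕ)) - 1 = (l : ℝ) - θ - (min q (l + 1) : ℕ) := by ring
  have e2 : errKernel q θ l n = (l.factorial : ℝ) * ((n : ℝ) ^ ((l : ℝ) - θ) /
      Real.Gamma (l + 1 - θ)) - lubichPow q θ l n := by
    rw [errKernel_natCast, powCoeff]; ring
  rwa [e1, ← e2] at this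

lemma powCoeff_natCast_of_lt {m l : ℕ} (h : l < m) : powCoeff m l = 0 := by
  obtain ⟨k, rfl⟩ := Nat.exists_eq_add_of_lt h
  have : (l : ℝ) + 1 - ((l + k + 1 : ℕ) : ℝ) = -(k : ℕ) := by push_cast; ring
  rw [powCoeff, this, Real.Gamma_neg_nat_eq_zero, div_zero]

lemma powCoeff_natCast_add (m j : ℕ) :
    powCoeff m (m + j) = ((m + j).factorial : ℝ) / (j.factorial : ℝ) := by
  have : ((m + j : ℕ) : ℝ) + 1 - m = (j : ℝ) + 1 := by push_cast; ring
  rw [powCoeff, this, Real.Gamma_nat_eq_factorial]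

/-- For `l = m + j` with `j < q`, the first `j+1` terms of the expansion reproduce `(m+j)!/j! · n^j`
exactly, by `natCast_pow_eq_sum`. For `l < m` the exact value is zero and the quadrature itself
decays. A decay of `1/n` is enough to annihilate a polynomial. -/
lemma exists_errKernel_le_inv {q m : ℕ} (hq1 : 1 ≤ q) (hq5 : q ≤ 5) {l : ℕ} (hl : l < q + m) :
    ∃ K, ∀ n : ℕ, |errKernel q m l n| ≤ K * ((n : ℝ) + 1)⁻¹ := by
  obtain ⟨f, hf, hfc⟩ := exists_hasExp_lubichPow hq1 hq5 m l
  rcases lt_or_ge l m with hlm | hlm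
  · obtain ⟨K, hK⟩ := hf.bound (M := 0) (by simp)
    have hK0 : 0 ≤ K := by simpa using (abs_nonneg _).trans (hK 0)
    refine ⟨K, fun n => ?_⟩
    rw [errKernel_natCast, powCoeff_natCast_of_lt hlm, zero_mul, zero_sub, abs_neg,
      ← Real.rpow_neg_one]
    refine (hK n).trans (mul_le_mul_of_nonneg_left (rpow_natCast_add_one_mono ?_ n) hK0)
    have : (l : ℝ) + 1 ≤ m := by exact_mod_cast hlm
    push_cast
    linarith
  · obtain ⟨j, rfl⟩ := Nat.exists_eq_add_of_le hlm
    obtain ⟨K, hK⟩ := hf (j + 1)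
    refine ⟨K, fun n => ?_⟩
    have e1 : (m : ℝ) - ((m + j : ℕ) : ℝ) - 1 = -((j : ℝ) + 1) := by push_cast; ring
    have e2 : -(-((j : ℝ) + 1) + ((j + 1 : ℕ) : ℝ)) - 1 = -1 := by push_cast; ring
    have h := hK n
    rw [e1, e2, Real.rpow_neg_one] at h
    refine le_trans (le_of_eq ?_) h
    rw [errKernel_natCast, abs_sub_comm, powCoeff_natCast_add]
    congr 2
    have e3 : ((m + j : ℕ) : ℝ) - m = (j : ℕ) := by push_cast; ring
    rw [e3, Real.rpow_natCast, natCast_pow_eq_sum, Finset.mul_sum]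
    refine Finset.sum_congr rfl fun i hi => ?_
    have hi' : i ≤ j := Nat.lt_succ_iff.1 (Finset.mem_range.1 hi)
    rw [coeff_powSeries hi', hfc i (by omega) (by omega), e1]
    have : (j.factorial : ℝ) ≠ 0 := by positivity
    field_simp

lemma polynomial_eq_zero_of_tendsto {p : Polynomial ℝ}
    (h : Tendsto (fun n : ℕ => p.eval (n : ℝ)) atTop (𝓝 0)) : p = 0 := by
  rcases lt_or_ge 0 p.degree with hd | hd
  · have h1 := (p.abs_tendsto_atTop hd).comp tendsto_natCast_atTop_atTop
    have h2 := h.abs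
    exact absurd h2 (not_tendsto_nhds_of_tendsto_atTop h1 _)
  · rw [Polynomial.eq_C_of_degree_le_zero hd] at h ⊢
    simp only [Polynomial.eval_C] at h
    rw [tendsto_nhds_unique tendsto_const_nhds h, map_zero]

/-- Once `n ≥ mq` no further weight enters the sum, so the error is a fixed polynomial evaluated at
`n`; it tends to `0`, hence vanishes identically. -/
lemma errKernel_natCast_eq_zero {q m : ℕ} (hq1 : 1 ≤ q) (hq5 : q ≤ 5) {l : ℕ} (hl : l < q + m)
    {n : ℕ} (hn : m * q ≤ n) : errKernel q m l n = 0 := by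
  set p : Polynomial ℝ := Polynomial.C (powCoeff m l) * Polynomial.X ^ (l - m) -
    ∑ k ∈ range (m * q + 1), Polynomial.C (lubichCoeff q m k) *
      (Polynomial.X - Polynomial.C (k : ℝ)) ^ l with hp
  have heval : ∀ n : ℕ, m * q ≤ n → errKernel q m l n = p.eval (n : ℝ) := by
    intro n hn
    have h1 : powCoeff m l * (n : ℝ) ^ ((l : ℝ) - m) = powCoeff m l * (n : ℝ) ^ (l - m) := by
      rcases lt_or_ge l m with hlm | hlm
      · rw [powCoeff_natCast_of_lt hlm, zero_mul, zero_mul]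
      · rw [← Nat.cast_sub hlm, Real.rpow_natCast]
    rw [errKernel, Nat.floor_natCast, errPiece, h1, hp, Polynomial.eval_sub, Polynomial.eval_mul,
      Polynomial.eval_C, Polynomial.eval_pow, Polynomial.eval_X, Polynomial.eval_finsetSum]
    congr 1
    simp only [Polynomial.eval_mul, Polynomial.eval_C, Polynomial.eval_pow, Polynomial.eval_sub,
      Polynomial.eval_X]
    symm
    refine Finset.sum_subset (Finset.range_subset_range.2 (by omega)) fun k _ hk => ?_
    rw [lubichCoeff_eq_zero hq1 (by simpa [Nat.lt_succ_iff] using hk), zero_mul]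
  obtain ⟨K, hK⟩ := exists_errKernel_le_inv hq1 hq5 hl
  have h0 : p = 0 := by
    apply polynomial_eq_zero_of_tendsto
    refine squeeze_zero_norm' (a := fun n : ℕ => K * ((n : ℝ) + 1)⁻¹) ?_ ?_
    · filter_upwards [eventually_ge_atTop (m * q)] with n hn
      rw [← heval n hn]; exact hK n
    · have := (tendsto_one_div_add_atTop_nhds_zero_nat (𝕜 := ℝ)).const_mul K
      simpa [one_div] using this
  rw [heval n hn, h0, Polynomial.eval_zero]

/-- With the set of nodes frozen, differentiation lowers the degree `l`. Together with the values at
integers this controls the kernel at all real points, by induction on `l`. -/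
lemma hasDerivAt_errPiece (q : ℕ) (θ : ℝ) (l n : ℕ) {x : ℝ} (hx : 0 < x) :
    HasDerivAt (errPiece q θ (l + 1) n) (((l : ℝ) + 1) * errPiece q θ l n x) x := by
  have h1 : HasDerivAt (fun x : ℝ => powCoeff θ (l + 1) * x ^ (((l + 1 : ℕ) : ℝ) - θ))
      (((l : ℝ) + 1) * (powCoeff θ l * x ^ ((l : ℝ) - θ))) x := by
    have := (Real.hasDerivAt_rpow_const (p := ((l + 1 : ℕ) : ℝ) - θ)
      (Or.inl hx.ne')).const_mul (powCoeff θ (l + 1))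
    refine this.congr_deriv ?_
    rw [← mul_assoc, powCoeff_succ_mul, mul_assoc]
    congr 3
    push_cast
    ring
  have h2 : HasDerivAt (fun x : ℝ => ∑ k ∈ range (n + 1), lubichCoeff q θ k * (x - k) ^ (l + 1))
      (∑ k ∈ range (n + 1), lubichCoeff q θ k * (((l : ℝ) + 1) * (x - k) ^ l)) x := by
    refine HasDerivAt.fun_sum fun k _ => HasDerivAt.const_mul _ ?_
    have := ((hasDerivAt_id x).sub_const (k : ℝ)).fun_pow (l + 1)
    simpa using this
  refine (h1.sub h2).congr_deriv ?_
  rw [errPiece, mul_sub, Finset.mul_sum]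
  congr 1
  exact Finset.sum_congr rfl fun k _ => by ring

lemma abs_errPiece_succ_sub_le (q : ℕ) (θ : ℝ) (l : ℕ) {n : ℕ} (hn : 1 ≤ n) {B : ℝ}
    (hB : ∀ x ∈ Set.Icc (n : ℝ) (n + 1), |errPiece q θ l n x| ≤ B) {x : ℝ}
    (hx : x ∈ Set.Icc (n : ℝ) (n + 1)) :
    |errPiece q θ (l + 1) n x - errPiece q θ (l + 1) n n| ≤ ((l : ℝ) + 1) * B := by
  have hn' : (1 : ℝ) ≤ n := by exact_mod_cast hn
  have hB0 : 0 ≤ B := (abs_nonneg _).trans (hB x hx)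
  have h := (convex_Icc (n : ℝ) (n + 1)).norm_image_sub_le_of_norm_hasDerivWithin_le
    (f := errPiece q θ (l + 1) n) (f' := fun x => ((l : ℝ) + 1) * errPiece q θ l n x)
    (C := ((l : ℝ) + 1) * B)
    (fun y hy => (hasDerivAt_errPiece q θ l n (by linarith [hy.1])).hasDerivWithinAt)
    (fun y hy => by
      rw [norm_mul, Real.norm_of_nonneg (by positivity)]
      exact mul_le_mul_of_nonneg_left (hB y hy) (by positivity))
    (Set.left_mem_Icc.2 (by linarith)) hx
  refine h.trans (mul_le_of_le_one_right (by positivity) ?_)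
  rw [Real.norm_eq_abs, abs_le]
  constructor <;> linarith [hx.1, hx.2]

lemma errPiece_natCast (q : ℕ) (θ : ℝ) (l n : ℕ) : errPiece q θ l n n = errKernel q θ l n := by
  rw [errKernel, Nat.floor_natCast]

/-- Induction on `l` on each interval `[n, n+1]`: for `l = 0 < m` the piece is constant, and a piece
with zero derivative and zero value at `n` is zero. -/
lemma errKernel_eq_zero {q m : ℕ} (hq1 : 1 ≤ q) (hq5 : q ≤ 5) (hm : 1 ≤ m) {l : ℕ}
    (hl : l < q + m) {x : ℝ} (hx : ((m * q : ℕ) : ℝ) ≤ x) : errKernel q m l x = 0 := by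
  have key : ∀ n : ℕ, m * q ≤ n → ∀ l, l < q + m → ∀ x ∈ Set.Icc (n : ℝ) (n + 1),
      errPiece q m l n x = 0 := by
    intro n hn l
    have hn1 : 1 ≤ n := le_trans (Nat.mul_pos hm hq1) hn
    induction l with
    | zero =>
      intro hl x _
      have h := errKernel_natCast_eq_zero hq1 hq5 hl hn
      rw [← errPiece_natCast] at h
      rw [← h, errPiece, errPiece, powCoeff_natCast_of_lt (by omega)]
      simp
    | succ l ih =>
      intro hl x hx
      have h := abs_errPiece_succ_sub_le q m l hn1 (B := 0)
        (fun y hy => by rw [ih (by omega) y hy, abs_zero]) hx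
      rw [errPiece_natCast, errKernel_natCast_eq_zero hq1 hq5 hl hn, mul_zero, sub_zero] at h
      exact abs_nonpos_iff.1 h
  have hx0 : 0 ≤ x := le_trans (Nat.cast_nonneg _) hx
  exact key ⌊x⌋₊ (Nat.le_floor hx) l hl x ⟨Nat.floor_le hx0, (Nat.lt_floor_add_one x).le⟩

lemma exists_errKernel_bound_of_int {q m : ℕ} (hq1 : 1 ≤ q) (hq5 : q ≤ 5) (hm : 1 ≤ m) :
    ∃ K, ∀ x : ℝ, 0 ≤ x → |errKernel q m (q + m - 1) x| ≤ K := by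
  set P := q + m - 1 with hP
  set L : ℝ := ((m * q : ℕ) : ℝ) with hL
  set S := ∑ k ∈ range (m * q + 1), |lubichCoeff q m k| with hS
  refine ⟨|powCoeff m P| * L ^ ((P : ℝ) - m) + S * L ^ P, fun x hx => ?_⟩
  have hPm : (0 : ℝ) ≤ (P : ℝ) - m := sub_nonneg.2 (by exact_mod_cast (by omega : m ≤ P))
  rcases le_or_gt L x with hLx | hLx
  · rw [errKernel_eq_zero hq1 hq5 hm (by omega) hLx, abs_zero]
    positivity
  · refine (abs_sub _ _).trans (add_le_add ?_ ?_)
    · rw [abs_mul, abs_of_nonneg (by positivity : (0 : ℝ) ≤ x ^ ((P : ℝ) - m))]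
      gcongr
    · refine (Finset.abs_sum_le_sum_abs _ _).trans ?_
      have hfl : ⌊x⌋₊ ≤ m * q := Nat.floor_le_of_le hLx.le
      calc ∑ k ∈ range (⌊x⌋₊ + 1), |lubichCoeff q m k * (x - k) ^ P|
          ≤ ∑ k ∈ range (⌊x⌋₊ + 1), |lubichCoeff q m k| * L ^ P := by
            refine Finset.sum_le_sum fun k hk => ?_
            have hk' : (k : ℝ) ≤ x := (Nat.le_floor_iff hx).1
              (Nat.lt_succ_iff.1 (Finset.mem_range.1 hk))
            have hk0 : (0 : ℝ) ≤ k := k.cast_nonneg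
            rw [abs_mul, abs_pow, abs_of_nonneg (by linarith : 0 ≤ x - k)]
            gcongr
            linarith
        _ ≤ ∑ k ∈ range (m * q + 1), |lubichCoeff q m k| * L ^ P :=
            Finset.sum_le_sum_of_subset_of_nonneg (Finset.range_subset_range.2 (by omega))
              fun _ _ _ => by positivity
        _ = S * L ^ P := by rw [hS, Finset.sum_mul]

/-- At integers every `l < q + m` satisfies the bound with exponent `γ = m-1-θ`, because `l - min q
(l+1) ≤ m-1`; integrating over unit intervals preserves it. For `x < 1` only the weight `k = 0`
occurs, and `x^γ ≥ 1`. -/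
lemma exists_errKernel_bound_of_not_int {q : ℕ} (hq1 : 1 ≤ q) (hq5 : q ≤ 5) {θ : ℝ}
    (hθ0 : 0 < θ) (hθ : ∀ k : ℤ, θ ≠ k) {m : ℕ} (hm1 : 1 ≤ m) (hmθ : (m : ℝ) - 1 < θ)
    (hθm : θ < m) :
    ∃ K, 0 ≤ K ∧ ∀ x : ℝ, 0 < x → |errKernel q θ (q + m - 1) x| ≤ K * x ^ ((m : ℝ) - 1 - θ) := by
  set γ := (m : ℝ) - 1 - θ with hγ
  have hm1' : (1 : ℝ) ≤ m := by exact_mod_cast hm1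
  have hnat : ∀ l < q + m, ∃ K, 0 ≤ K ∧ ∀ n : ℕ, |errKernel q θ l n| ≤ K * ((n : ℝ) + 1) ^ γ := by
    intro l hl
    obtain ⟨K, hK⟩ := exists_errKernel_natCast_bound_of_not_int hq1 hq5 hθ0 hθ l
    have hK0 : 0 ≤ K := by simpa using (abs_nonneg _).trans (hK 0)
    refine ⟨K, hK0, fun n => (hK n).trans
      (mul_le_mul_of_nonneg_left (rpow_natCast_add_one_mono ?_ n) hK0)⟩
    rw [hγ]
    have h1 : (l : ℝ) ≤ m - 1 + (min q (l + 1) : ℕ) := by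
      have : l + 1 ≤ m + min q (l + 1) := by omega
      have : (l : ℝ) + 1 ≤ m + (min q (l + 1) : ℕ) := by exact_mod_cast this
      linarith
    linarith
  have key : ∀ l < q + m, ∃ K, 0 ≤ K ∧ ∀ n : ℕ, 1 ≤ n → ∀ x ∈ Set.Icc (n : ℝ) (n + 1),
      |errPiece q θ l n x| ≤ K * ((n : ℝ) + 1) ^ γ := by
    intro l
    induction l with
    | zero =>
      intro hl
      obtain ⟨K, hK0, hK⟩ := hnat 0 hl
      refine ⟨K + |powCoeff θ 0| * (2 ^ θ), by positivity, fun n hn x hx => ?_⟩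
      have hn' : (1 : ℝ) ≤ n := by exact_mod_cast hn
      have hx0 : 0 < x := by linarith [hx.1]
      have e : errPiece q θ 0 n x = errKernel q θ 0 n +
          powCoeff θ 0 * (x ^ (-θ) - (n : ℝ) ^ (-θ)) := by
        rw [← errPiece_natCast, errPiece, errPiece]
        simp only [pow_zero, Nat.cast_zero, zero_sub]
        ring
      have h1 : x ^ (-θ) ≤ (n : ℝ) ^ (-θ) :=
        Real.rpow_le_rpow_of_nonpos (by linarith) hx.1 (by linarith)
      have h2 : (n : ℝ) ^ (-θ) ≤ 2 ^ θ * ((n : ℝ) + 1) ^ γ := by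
        calc (n : ℝ) ^ (-θ) ≤ (((n : ℝ) + 1) / 2) ^ (-θ) :=
              Real.rpow_le_rpow_of_nonpos (by positivity) (by linarith) (by linarith)
          _ = 2 ^ θ * ((n : ℝ) + 1) ^ (-θ) := by
              rw [Real.div_rpow (by positivity) (by norm_num), Real.rpow_neg (x := 2) (by norm_num)]
              field_simp
          _ ≤ 2 ^ θ * ((n : ℝ) + 1) ^ γ := by
              refine mul_le_mul_of_nonneg_left (rpow_natCast_add_one_mono ?_ n) (by positivity)
              rw [hγ]; linarith
      have h3 : 0 ≤ x ^ (-θ) := by positivity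
      rw [e, add_mul K]
      refine (abs_add_le _ _).trans (add_le_add (hK n) ?_)
      rw [abs_mul, mul_assoc]
      refine mul_le_mul_of_nonneg_left ?_ (abs_nonneg _)
      rw [abs_le]
      constructor <;> linarith
    | succ l ih =>
      intro hl
      obtain ⟨K, hK0, hK⟩ := hnat (l + 1) hl
      obtain ⟨L, hL0, hL⟩ := ih (by omega)
      refine ⟨((l : ℝ) + 1) * L + K, by positivity, fun n hn x hx => ?_⟩
      have h := abs_errPiece_succ_sub_le q θ l hn (hL n hn) hx
      rw [errPiece_natCast] at h
      calc |errPiece q θ (l + 1) n x|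
          = |(errPiece q θ (l + 1) n x - errKernel q θ (l + 1) n) + errKernel q θ (l + 1) n| := by
            rw [sub_add_cancel]
        _ ≤ ((l : ℝ) + 1) * (L * ((n : ℝ) + 1) ^ γ) + K * ((n : ℝ) + 1) ^ γ :=
            (abs_add_le _ _).trans (add_le_add h (hK n))
        _ = _ := by ring
  set P := q + m - 1 with hP
  obtain ⟨K, hK0, hK⟩ := key P (by omega)
  have hγ0 : γ ≤ 0 := by rw [hγ]; linarith
  have hPθ : 0 ≤ (P : ℝ) - θ := by
    have : (m : ℝ) ≤ P := by exact_mod_cast (by omega : m ≤ P)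
    linarith
  refine ⟨K + (|powCoeff θ P| + |lubichCoeff q θ 0|), by positivity, fun x hx => ?_⟩
  have hxγ : 0 < x ^ γ := by positivity
  rcases lt_or_ge x 1 with hx1 | hx1
  · have hfl : ⌊x⌋₊ = 0 := Nat.floor_eq_zero.2 hx1
    have h1 : 1 ≤ x ^ γ := Real.one_le_rpow_of_pos_of_le_one_of_nonpos hx hx1.le hγ0
    have h2 : |errKernel q θ P x| ≤ |powCoeff θ P| + |lubichCoeff q θ 0| := by
      rw [errKernel, hfl, errPiece]
      refine (abs_sub _ _).trans (add_le_add ?_ ?_)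
      · rw [abs_mul, abs_of_nonneg (by positivity : (0 : ℝ) ≤ x ^ ((P : ℝ) - θ))]
        exact mul_le_of_le_one_right (abs_nonneg _) (Real.rpow_le_one hx.le hx1.le hPθ)
      · simp only [zero_add, Finset.range_one, Finset.sum_singleton, Nat.cast_zero, sub_zero]
        rw [abs_mul, abs_pow, abs_of_pos hx]
        exact mul_le_of_le_one_right (abs_nonneg _) (pow_le_one₀ hx.le hx1.le)
    have h3 : 0 ≤ |powCoeff θ P| + |lubichCoeff q θ 0| := by positivity
    nlinarith
  · have h1 := hK ⌊x⌋₊ ((Nat.one_le_floor_iff x).2 hx1) x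
      ⟨Nat.floor_le hx.le, (Nat.lt_floor_add_one x).le⟩
    have h2 : ((⌊x⌋₊ : ℝ) + 1) ^ γ ≤ x ^ γ :=
      Real.rpow_le_rpow_of_nonpos hx (Nat.lt_floor_add_one x).le hγ0
    rw [← errKernel] at h1
    have h3 : 0 ≤ |powCoeff θ P| + |lubichCoeff q θ 0| := by positivity
    nlinarith [mul_le_mul_of_nonneg_left h2 hK0, mul_nonneg h3 hxγ.le]

lemma ne_intCast_of_ne_ceil {θ : ℝ} (hθ0 : 0 < θ) (hθ : θ ≠ ⌈θ⌉₊) (k : ℤ) : θ ≠ k := by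
  rintro hk
  have hk0 : 0 ≤ k := by
    have : (0 : ℝ) < k := hk ▸ hθ0
    exact_mod_cast this.le
  obtain ⟨j, rfl⟩ := Int.eq_ofNat_of_zero_le hk0
  apply hθ
  rw [hk]
  simp

lemma exists_errKernel_natCast_bound {q : ℕ} (hq1 : 1 ≤ q) (hq5 : q ≤ 5) {θ : ℝ} (hθ0 : 0 < θ)
    {l : ℕ} (hl : l < q + ⌈θ⌉₊) :
    ∃ K, ∀ n : ℕ, |errKernel q θ l n| ≤
      K * ((n : ℝ) + 1) ^ ((l : ℝ) - θ - (min q (l + 1) : ℕ)) := by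
  by_cases hθ : θ = ⌈θ⌉₊
  · set m := ⌈θ⌉₊ with hm
    rw [hθ]
    refine exists_bound_of_eventually_bound (n₀ := m * q) (K := 0) fun n hn => ?_
    rw [errKernel_natCast_eq_zero hq1 hq5 hl hn]
    simp
  · exact exists_errKernel_natCast_bound_of_not_int hq1 hq5 hθ0 (ne_intCast_of_ne_ceil hθ0 hθ) l

/-! ### Taylor expansion of fractional integrals -/

lemma continuousOn_timeDeriv {T : ℝ} (hT : 0 < T) {f : ℝ → ℝ} {k l : ℕ}
    (hf : ContDiffOn ℝ ((k : ℕ) : WithTop ℕ∞) f (Set.Icc 0 T)) (hl : l ≤ k) :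
    ContinuousOn (timeDeriv T l f) (Set.Icc 0 T) :=
  hf.continuousOn_iteratedDerivWithin (by exact_mod_cast hl) (uniqueDiffOn_Icc hT)

lemma hasDerivAt_timeDeriv {T : ℝ} (hT : 0 < T) {f : ℝ → ℝ} {k l : ℕ}
    (hf : ContDiffOn ℝ ((k : ℕ) : WithTop ℕ∞) f (Set.Icc 0 T)) (hl : l < k) {t : ℝ}
    (ht : t ∈ Set.Ioo 0 T) : HasDerivAt (timeDeriv T l f) (timeDeriv T (l + 1) f t) t := by
  have h := hf.differentiableOn_iteratedDerivWithin (m := l) (by exact_mod_cast hl)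
    (uniqueDiffOn_Icc hT) t ⟨ht.1.le, ht.2.le⟩
  have h2 := h.hasDerivWithinAt.hasDerivAt (Icc_mem_nhds ht.1 ht.2)
  rwa [← iteratedDerivWithin_succ] at h2

lemma continuous_sub_rpow {α : ℝ} (hα : 0 ≤ α) (t : ℝ) : Continuous fun ξ : ℝ => (t - ξ) ^ α :=
  (continuous_const.sub continuous_id).rpow_const fun _ => Or.inr hα

lemma intervalIntegrable_sub_rpow {α : ℝ} (hα : -1 < α) (t : ℝ) :
    IntervalIntegrable (fun ξ : ℝ => (t - ξ) ^ α) volume 0 t := by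
  have h := (intervalIntegral.intervalIntegrable_rpow' (a := 0) (b := t) hα).comp_sub_left t
  simpa using h.symm

/-- Integration by parts, which for `α = 0` is the fundamental theorem of calculus. -/
lemma rlIntegral_succ {T : ℝ} (hT : 0 < T) {f : ℝ → ℝ} {k l : ℕ}
    (hf : ContDiffOn ℝ ((k : ℕ) : WithTop ℕ∞) f (Set.Icc 0 T)) (hl : l < k) {α : ℝ} (hα : 0 ≤ α)
    {t : ℝ} (ht : t ∈ Set.Icc 0 T) :
    rlIntegral 0 α (timeDeriv T l f) t = t ^ α / Real.Gamma (α + 1) * timeDeriv T l f 0 +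
      rlIntegral 0 (α + 1) (timeDeriv T (l + 1) f) t := by
  have hα1 : α + 1 ≠ 0 := by positivity
  have hsub : Set.uIcc 0 t ⊆ Set.Icc 0 T := by
    rw [Set.uIcc_of_le ht.1]; exact Set.Icc_subset_Icc_right ht.2
  have hcont := (continuousOn_timeDeriv hT hf hl.le).mono hsub
  have hcont' := (continuousOn_timeDeriv hT hf (Nat.succ_le_of_lt hl)).mono hsub
  have hderiv : ∀ x ∈ Set.Ioo (min 0 t) (max 0 t),
      HasDerivAt (timeDeriv T l f) (timeDeriv T (l + 1) f x) x := by
    intro x hx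
    rw [min_eq_left ht.1, max_eq_right ht.1] at hx
    exact hasDerivAt_timeDeriv hT hf hl ⟨hx.1, hx.2.trans_le ht.2⟩
  rcases hα.eq_or_lt with rfl | hα0
  · rw [rlIntegral, rlIntegral, if_pos rfl, if_neg hα1]
    simp only [zero_add, Real.rpow_zero, Real.Gamma_one, sub_self, div_one, one_mul]
    have := intervalIntegral.integral_eq_sub_of_hasDerivAt_of_le ht.1
      (f := timeDeriv T l f) (f' := timeDeriv T (l + 1) f)
      (by rwa [Set.uIcc_of_le ht.1] at hcont)
      (fun x hx => hasDerivAt_timeDeriv hT hf hl ⟨hx.1, hx.2.trans_le ht.2⟩)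
      hcont'.intervalIntegrable
    rw [this]; ring
  · have hv : ∀ x ∈ Set.Ioo (min 0 t) (max 0 t),
        HasDerivAt (fun ξ : ℝ => -((t - ξ) ^ α / α)) ((t - x) ^ (α - 1)) x := by
      intro x hx
      rw [min_eq_left ht.1, max_eq_right ht.1] at hx
      have hx' : t - x ≠ 0 := (sub_pos.2 hx.2).ne'
      have h := ((((hasDerivAt_id x).const_sub t).rpow_const (p := α) (Or.inl hx')).div_const α).neg
      refine h.congr_deriv ?_
      simp only [id]
      field_simp
    have hparts := intervalIntegral.integral_mul_deriv_eq_deriv_mul_of_hasDerivAt hcont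
      (((continuous_sub_rpow hα t).div_const α).neg.continuousOn) hderiv hv
      hcont'.intervalIntegrable (intervalIntegrable_sub_rpow (by linarith) t)
    rw [rlIntegral, rlIntegral, if_neg hα0.ne', if_neg hα1, Real.Gamma_add_one hα0.ne',
      add_sub_cancel_right]
    have e1 : ∫ ξ in (0 : ℝ)..t, (t - ξ) ^ (α - 1) * timeDeriv T l f ξ =
        ∫ ξ in (0 : ℝ)..t, timeDeriv T l f ξ * (t - ξ) ^ (α - 1) := by simp only [mul_comm]
    have e2 : ∫ ξ in (0 : ℝ)..t, timeDeriv T (l + 1) f ξ * -((t - ξ) ^ α / α) =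
        -(1 / α) * ∫ ξ in (0 : ℝ)..t, (t - ξ) ^ α * timeDeriv T (l + 1) f ξ := by
      rw [← intervalIntegral.integral_const_mul]
      congr 1; ext ξ; ring
    simp only [Pi.neg_apply] at hparts
    rw [e1, hparts, e2]
    simp only [sub_self, Real.zero_rpow hα0.ne', sub_zero]
    have hG : Real.Gamma α ≠ 0 := (Real.Gamma_pos_of_pos hα0).ne'
    field_simp
    ring

lemma rlIntegral_eq_sum_add {T : ℝ} (hT : 0 < T) {f : ℝ → ℝ} {k l : ℕ}
    (hf : ContDiffOn ℝ ((k : ℕ) : WithTop ℕ∞) f (Set.Icc 0 T)) {α : ℝ} (hα : 0 ≤ α)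
    {t : ℝ} (ht : t ∈ Set.Icc 0 T) (j : ℕ) (hj : l + j ≤ k) :
    rlIntegral 0 α (timeDeriv T l f) t =
      ∑ i ∈ range j, t ^ (α + i) / Real.Gamma (α + i + 1) * timeDeriv T (l + i) f 0 +
      rlIntegral 0 (α + j) (timeDeriv T (l + j) f) t := by
  induction j with
  | zero => simp
  | succ j ih =>
    rw [ih (by omega), Finset.sum_range_succ,
      rlIntegral_succ hT hf (l := l + j) (by omega) (by positivity) ht]
    push_cast
    simp only [add_assoc]

lemma rlIntegral_of_pos {α : ℝ} (hα : 0 < α) (f : ℝ → ℝ) (t : ℝ) :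
    rlIntegral 0 α f t = 1 / Real.Gamma α * ∫ ξ in (0 : ℝ)..t, (t - ξ) ^ (α - 1) * f ξ := by
  rw [rlIntegral, if_neg hα.ne']

/-- Taylor's formula with integral remainder. -/
lemma eq_taylor_sum_add_integral {T : ℝ} (hT : 0 < T) {f : ℝ → ℝ} {P : ℕ}
    (hf : ContDiffOn ℝ ((P + 1 : ℕ) : WithTop ℕ∞) f (Set.Icc 0 T)) {t : ℝ}
    (ht : t ∈ Set.Icc 0 T) :
    f t = ∑ l ∈ range (P + 1), timeDeriv T l f 0 * t ^ l / (l.factorial : ℝ) +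
      1 / (P.factorial : ℝ) * ∫ s in (0 : ℝ)..t, (t - s) ^ P * timeDeriv T (P + 1) f s := by
  have h := rlIntegral_eq_sum_add hT hf (l := 0) le_rfl ht (P + 1) (by omega)
  have h0 : rlIntegral 0 0 (timeDeriv T 0 f) t = f t := by
    simp [rlIntegral, timeDeriv]
  have e : ((P + 1 : ℕ) : ℝ) - 1 = (P : ℕ) := by push_cast; ring
  rw [h0, zero_add, zero_add, rlIntegral_of_pos (by positivity), e] at h
  simp only [Real.rpow_natCast, Nat.cast_succ, Real.Gamma_nat_eq_factorial, zero_add] at h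
  rw [h]
  congr 1
  exact Finset.sum_congr rfl fun l _ => by ring

/-! ### Peano kernel representation of the error -/

lemma caputo_eq {T : ℝ} (hT : 0 < T) {q : ℕ} (hq1 : 1 ≤ q) (θ : ℝ) {f : ℝ → ℝ}
    (hf : ContDiffOn ℝ ((q + ⌈θ⌉₊ : ℕ) : WithTop ℕ∞) f (Set.Icc 0 T)) {t : ℝ}
    (ht : t ∈ Set.Icc 0 T) :
    caputo T θ f t = ∑ i ∈ range q, timeDeriv T (⌈θ⌉₊ + i) f 0 /
        ((⌈θ⌉₊ + i).factorial : ℝ) * (powCoeff θ (⌈θ⌉₊ + i) * t ^ (((⌈θ⌉₊ + i : ℕ) : ℝ) - θ)) +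
      1 / ((q + ⌈θ⌉₊ - 1).factorial : ℝ) * ∫ s in (0 : ℝ)..t,
        powCoeff θ (q + ⌈θ⌉₊ - 1) * (t - s) ^ (((q + ⌈θ⌉₊ - 1 : ℕ) : ℝ) - θ) *
          timeDeriv T (q + ⌈θ⌉₊) f s := by
  set m := ⌈θ⌉₊ with hm
  have hmθ : θ ≤ m := Nat.le_ceil θ
  have hq1' : (1 : ℝ) ≤ q := by exact_mod_cast hq1
  have hα : 0 < (m : ℝ) - θ + q := by linarith
  have eP : ((q + m - 1 : ℕ) : ℝ) = (m : ℝ) + q - 1 := by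
    rw [Nat.cast_sub (by omega)]; push_cast; ring
  rw [caputo, ← hm, rlIntegral_eq_sum_add hT hf (sub_nonneg.2 hmθ) ht q (by omega),
    rlIntegral_of_pos hα]
  congr 1
  · refine Finset.sum_congr rfl fun i _ => ?_
    have e1 : ((m + i : ℕ) : ℝ) - θ = m - θ + i := by push_cast; ring
    have e2 : ((m + i : ℕ) : ℝ) + 1 - θ = m - θ + i + 1 := by push_cast; ring
    have : ((m + i).factorial : ℝ) ≠ 0 := by positivity
    rw [powCoeff, e1, e2]
    field_simp
  · have e1 : ((q + m - 1 : ℕ) : ℝ) - θ = m - θ + q - 1 := by rw [eP]; ring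
    have e2 : ((q + m - 1 : ℕ) : ℝ) + 1 - θ = m - θ + q := by rw [eP]; ring
    have : ((q + m - 1).factorial : ℝ) ≠ 0 := by positivity
    have e3 : ∀ s : ℝ, powCoeff θ (q + m - 1) * (t - s) ^ (((q + m - 1 : ℕ) : ℝ) - θ) *
        timeDeriv T (q + m) f s = powCoeff θ (q + m - 1) *
          ((t - s) ^ ((m : ℝ) - θ + q - 1) * timeDeriv T (m + q) f s) := fun s => by
      rw [e1, add_comm q m, mul_assoc]
    simp only [e3]
    rw [intervalIntegral.integral_const_mul, powCoeff, e2]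
    field_simp

/-- The correction subtracts the Taylor polynomial of degree `< m` at every node, so only the
degrees `m, …, m+q-1` and the remainder survive. -/
lemma lubichCaputo_eq {T : ℝ} (hT : 0 < T) {q : ℕ} (hq1 : 1 ≤ q) (θ : ℝ) {f : ℝ → ℝ}
    (hf : ContDiffOn ℝ ((q + ⌈θ⌉₊ : ℕ) : WithTop ℕ∞) f (Set.Icc 0 T)) {τ : ℝ} (hτ : 0 < τ)
    {n : ℕ} (hn : n * τ ≤ T) :
    lubichCaputo T q θ τ f n = ∑ i ∈ range q, timeDeriv T (⌈θ⌉₊ + i) f 0 /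
        ((⌈θ⌉₊ + i).factorial : ℝ) * (τ ^ (-θ) *
          ∑ k ∈ range (n + 1), lubichCoeff q θ k * (((n - k : ℕ) : ℝ) * τ) ^ (⌈θ⌉₊ + i)) +
      1 / ((q + ⌈θ⌉₊ - 1).factorial : ℝ) * (τ ^ (-θ) * ∑ k ∈ range (n + 1),
        lubichCoeff q θ k * ∫ s in (0 : ℝ)..((n - k : ℕ) : ℝ) * τ,
          (((n - k : ℕ) : ℝ) * τ - s) ^ (q + ⌈θ⌉₊ - 1) * timeDeriv T (q + ⌈θ⌉₊) f s) := by
  set m := ⌈θ⌉₊ with hm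
  obtain ⟨P, hP⟩ : ∃ P, q + m = P + 1 := ⟨q + m - 1, by omega⟩
  have hP' : q + m - 1 = P := by omega
  rw [hP] at hf
  rw [hP', hP, lubichCaputo, ← hm]
  have htk : ∀ k : ℕ, ((n - k : ℕ) : ℝ) * τ ∈ Set.Icc 0 T := fun k =>
    ⟨by positivity, le_trans (mul_le_mul_of_nonneg_right (Nat.cast_le.2 (Nat.sub_le n k)) hτ.le) hn⟩
  have hsplit : ∀ k : ℕ, f (((n - k : ℕ) : ℝ) * τ) -
      ∑ l ∈ range m, timeDeriv T l f 0 * (((n - k : ℕ) : ℝ) * τ) ^ l / (l.factorial : ℝ) =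
      ∑ i ∈ range q, timeDeriv T (m + i) f 0 / ((m + i).factorial : ℝ) *
        (((n - k : ℕ) : ℝ) * τ) ^ (m + i) +
      1 / (P.factorial : ℝ) * ∫ s in (0 : ℝ)..((n - k : ℕ) : ℝ) * τ,
          (((n - k : ℕ) : ℝ) * τ - s) ^ P * timeDeriv T (P + 1) f s := by
    intro k
    rw [eq_taylor_sum_add_integral hT hf (htk k), ← hP, add_comm q m, Finset.sum_range_add]
    have : ∀ i ∈ range q, timeDeriv T (m + i) f 0 * (((n - k : ℕ) : ℝ) * τ) ^ (m + i) /
        ((m + i).factorial : ℝ) = timeDeriv T (m + i) f 0 / ((m + i).factorial : ℝ) *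
        (((n - k : ℕ) : ℝ) * τ) ^ (m + i) := fun i _ => by ring
    rw [Finset.sum_congr rfl this]
    ring
  rw [Finset.sum_comm, ← mul_sub, ← Finset.sum_sub_distrib, one_div,
    ← Real.rpow_neg hτ.le]
  have hk : ∀ k ∈ range (n + 1), lubichCoeff q θ k * f (((n - k : ℕ) : ℝ) * τ) -
      ∑ l ∈ range m, lubichCoeff q θ k * timeDeriv T l f 0 * (((n - k : ℕ) : ℝ) * τ) ^ l /
        (l.factorial : ℝ) =
      (∑ i ∈ range q, timeDeriv T (m + i) f 0 / ((m + i).factorial : ℝ) *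
        (lubichCoeff q θ k * (((n - k : ℕ) : ℝ) * τ) ^ (m + i))) +
      1 / (P.factorial : ℝ) * (lubichCoeff q θ k * ∫ s in (0 : ℝ)..((n - k : ℕ) : ℝ) * τ,
          (((n - k : ℕ) : ℝ) * τ - s) ^ P * timeDeriv T (P + 1) f s) := by
    intro k _
    have e : ∑ l ∈ range m, lubichCoeff q θ k * timeDeriv T l f 0 *
        (((n - k : ℕ) : ℝ) * τ) ^ l / (l.factorial : ℝ) = lubichCoeff q θ k *
        ∑ l ∈ range m, timeDeriv T l f 0 * (((n - k : ℕ) : ℝ) * τ) ^ l / (l.factorial : ℝ) := by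
      rw [Finset.mul_sum]
      exact Finset.sum_congr rfl fun l _ => by ring
    rw [e, ← mul_sub, hsplit, mul_add, Finset.mul_sum]
    congr 1
    · exact Finset.sum_congr rfl fun i _ => by ring
    · ring
  rw [Finset.sum_congr rfl hk, Finset.sum_add_distrib, Finset.sum_comm, mul_add]
  simp only [← Finset.mul_sum]
  congr 1
  · rw [Finset.mul_sum]
    exact Finset.sum_congr rfl fun i _ => by ring
  · ring

/-- The remainder of the quadrature error in terms of the error kernel. -/
lemma integral_errKernel {q : ℕ} {θ : ℝ} {P : ℕ} (hPθ : 0 ≤ (P : ℝ) - θ) {τ : ℝ} (hτ : 0 < τ)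
    (n : ℕ) {g : ℝ → ℝ} (hg : ContinuousOn g (Set.Icc 0 (n * τ))) :
    (∫ s in (0 : ℝ)..n * τ, powCoeff θ P * (n * τ - s) ^ ((P : ℝ) - θ) * g s) -
      τ ^ (-θ) * ∑ k ∈ range (n + 1), lubichCoeff q θ k *
        ∫ s in (0 : ℝ)..((n - k : ℕ) : ℝ) * τ, (((n - k : ℕ) : ℝ) * τ - s) ^ P * g s =
      τ ^ ((P : ℝ) - θ) * ∫ s in (0 : ℝ)..n * τ, errKernel q θ P ((n * τ - s) / τ) * g s := by
  set t : ℝ := n * τ with ht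
  have ht0 : 0 ≤ t := by positivity
  have hg' : ContinuousOn g (Set.uIcc 0 t) := by rwa [Set.uIcc_of_le ht0]
  -- Indicators extend the integrals over `[0, t_{n-k}]` to the common interval `[0, t_n]`.
  set ψ : ℕ → ℝ → ℝ := fun k => Set.indicator {s | s ≤ ((n - k : ℕ) : ℝ) * τ}
    fun s => (((n - k : ℕ) : ℝ) * τ - s) ^ P * g s with hψ
  have hψint : ∀ k, IntervalIntegrable (ψ k) volume 0 t := by
    intro k
    have h : IntervalIntegrable (fun s => (((n - k : ℕ) : ℝ) * τ - s) ^ P * g s) volume 0 t :=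
      (ContinuousOn.mul (by fun_prop) hg').intervalIntegrable
    rw [intervalIntegrable_iff] at h ⊢
    exact h.indicator measurableSet_Iic
  have hψval : ∀ k, ∫ s in (0 : ℝ)..((n - k : ℕ) : ℝ) * τ, (((n - k : ℕ) : ℝ) * τ - s) ^ P * g s =
      ∫ s in (0 : ℝ)..t, ψ k s := fun k =>
    (intervalIntegral.integral_indicator ⟨by positivity,
      mul_le_mul_of_nonneg_right (Nat.cast_le.2 (Nat.sub_le n k)) hτ.le⟩).symm
  have hint1 : IntervalIntegrable
      (fun s => powCoeff θ P * (t - s) ^ ((P : ℝ) - θ) * g s) volume 0 t :=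
    (ContinuousOn.mul (continuous_const.mul (continuous_sub_rpow hPθ t)).continuousOn
      hg').intervalIntegrable
  have hint2 : IntervalIntegrable (fun s => τ ^ (-θ) * ∑ k ∈ range (n + 1),
      lubichCoeff q θ k * ψ k s) volume 0 t := by
    refine IntervalIntegrable.const_mul ?_ _
    have := IntervalIntegrable.sum (range (n + 1)) (f := fun k s => lubichCoeff q θ k * ψ k s)
      (μ := volume) (a := 0) (b := t) fun k _ => (hψint k).const_mul _
    refine this.congr ?_
    exact fun s _ => by simp
  simp only [hψval]
  have e1 : τ ^ (-θ) * ∑ k ∈ range (n + 1), lubichCoeff q θ k * ∫ s in (0 : ℝ)..t, ψ k s =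
      ∫ s in (0 : ℝ)..t, τ ^ (-θ) * ∑ k ∈ range (n + 1), lubichCoeff q θ k * ψ k s := by
    rw [intervalIntegral.integral_const_mul, intervalIntegral.integral_finsetSum
      fun k _ => (hψint k).const_mul _]
    simp only [intervalIntegral.integral_const_mul]
  rw [e1, ← intervalIntegral.integral_sub hint1 hint2, ← intervalIntegral.integral_const_mul]
  refine intervalIntegral.integral_congr fun s hs => ?_
  rw [Set.uIcc_of_le ht0] at hs
  set x := (t - s) / τ with hx
  have hx0 : 0 ≤ x := div_nonneg (sub_nonneg.2 hs.2) hτ.le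
  have hts : t - s = x * τ := by rw [hx]; field_simp
  have hxn : x ≤ n := by
    rw [hx, div_le_iff₀ hτ]; linarith [hs.1]
  have hfl : ⌊x⌋₊ ≤ n := Nat.floor_le_of_le hxn
  -- The condition `s ≤ (n-k)τ` means `k ≤ x`, so exactly the indices up to `⌊x⌋` contribute, as in
  -- the definition of the kernel.
  have hsum : ∑ k ∈ range (n + 1), lubichCoeff q θ k * ψ k s =
      ∑ k ∈ range (⌊x⌋₊ + 1), lubichCoeff q θ k * (x - k) ^ P * (τ ^ P * g s) := by
    symm
    have hcast : ∀ k ≤ n, ((n - k : ℕ) : ℝ) * τ = s + (x - k) * τ := by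
      intro k hk
      rw [Nat.cast_sub hk, sub_mul, sub_mul, ← hts, ← ht]; ring
    refine Finset.sum_subset_zero_on_sdiff (Finset.range_subset_range.2 (by omega)) ?_ ?_
    · intro k hk
      rw [Finset.mem_sdiff, Finset.mem_range, Finset.mem_range] at hk
      have hkx : x < k := (Nat.floor_lt hx0).1 (by omega)
      have : s ∉ {s | s ≤ ((n - k : ℕ) : ℝ) * τ} := by
        rw [Set.mem_ofPred_eq, hcast k (by omega), not_le]
        nlinarith
      simp only [hψ]
      rw [Set.indicator_of_notMem this, mul_zero]
    · intro k hk
      have hk' : k ≤ ⌊x⌋₊ := Nat.lt_succ_iff.1 (Finset.mem_range.1 hk)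
      have hkx : (k : ℝ) ≤ x := (Nat.le_floor_iff hx0).1 hk'
      have : s ∈ {s | s ≤ ((n - k : ℕ) : ℝ) * τ} := by
        rw [Set.mem_ofPred_eq, hcast k (by omega)]
        nlinarith [mul_nonneg (sub_nonneg.2 hkx) hτ.le]
      simp only [hψ]
      rw [Set.indicator_of_mem this, hcast k (by omega), add_sub_cancel_left, mul_pow]
      ring
  rw [hsum, errKernel, errPiece, hts, Real.mul_rpow hx0 hτ.le, ← Finset.sum_mul]
  have hτP : τ ^ ((P : ℝ) - θ) = τ ^ P * τ ^ (-θ) := by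
    rw [sub_eq_add_neg, Real.rpow_add hτ, Real.rpow_natCast]
  rw [hτP]
  ring

/-- The error of the corrected operator in terms of the error kernel. -/
lemma caputo_sub_lubichCaputo {T : ℝ} (hT : 0 < T) {q : ℕ} (hq1 : 1 ≤ q) (θ : ℝ) {f : ℝ → ℝ}
    (hf : ContDiffOn ℝ ((q + ⌈θ⌉₊ : ℕ) : WithTop ℕ∞) f (Set.Icc 0 T)) {τ : ℝ} (hτ : 0 < τ)
    {n : ℕ} (hn : n * τ ≤ T) :
    caputo T θ f (n * τ) - lubichCaputo T q θ τ f n =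
      ∑ i ∈ range q, timeDeriv T (⌈θ⌉₊ + i) f 0 / ((⌈θ⌉₊ + i).factorial : ℝ) *
        (τ ^ (((⌈θ⌉₊ + i : ℕ) : ℝ) - θ) * errKernel q θ (⌈θ⌉₊ + i) n) +
      1 / ((q + ⌈θ⌉₊ - 1).factorial : ℝ) * (τ ^ (((q + ⌈θ⌉₊ - 1 : ℕ) : ℝ) - θ) *
        ∫ s in (0 : ℝ)..n * τ, errKernel q θ (q + ⌈θ⌉₊ - 1) ((n * τ - s) / τ) *
          timeDeriv T (q + ⌈θ⌉₊) f s) := by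
  have ht : (n : ℝ) * τ ∈ Set.Icc 0 T := ⟨by positivity, hn⟩
  have hPθ : 0 ≤ ((q + ⌈θ⌉₊ - 1 : ℕ) : ℝ) - θ := by
    have h1 : (⌈θ⌉₊ : ℝ) ≤ (q + ⌈θ⌉₊ - 1 : ℕ) := by exact_mod_cast (by omega)
    linarith [Nat.le_ceil θ]
  rw [caputo_eq hT hq1 θ hf ht, lubichCaputo_eq hT hq1 θ hf hτ hn,
    ← integral_errKernel hPθ hτ n ((continuousOn_timeDeriv hT hf le_rfl).mono
      (Set.Icc_subset_Icc_right hn)), add_sub_add_comm, ← Finset.sum_sub_distrib, mul_sub]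
  congr 1
  refine Finset.sum_congr rfl fun i _ => ?_
  rw [← mul_sub, errKernel_natCast, lubichPow, Real.mul_rpow n.cast_nonneg hτ.le]
  have hτl : τ ^ (((⌈θ⌉₊ + i : ℕ) : ℝ) - θ) = τ ^ (⌈θ⌉₊ + i) * τ ^ (-θ) := by
    rw [sub_eq_add_neg, Real.rpow_add hτ, Real.rpow_natCast]
  have e : ∑ k ∈ range (n + 1), lubichCoeff q θ k * (((n - k : ℕ) : ℝ) * τ) ^ (⌈θ⌉₊ + i) =
      τ ^ (⌈θ⌉₊ + i) *
        ∑ k ∈ range (n + 1), lubichCoeff q θ k * ((n - k : ℕ) : ℝ) ^ (⌈θ⌉₊ + i) := by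
    rw [Finset.mul_sum]
    exact Finset.sum_congr rfl fun k _ => by rw [mul_pow]; ring
  rw [e, hτl]
  ring

/-! ### Error estimates -/

/-- The exponent `γ = m-1-θ` lies in `(-1, 0)`, so `((t-s)/τ)^γ` is integrable and its integral is
`τ^{-γ} t^{γ+1}/(γ+1)`, bounded by a constant times `τ^{-γ}` on `[0, T]`. -/
lemma exists_integral_errKernel_bound_of_not_int {q : ℕ} (hq1 : 1 ≤ q) (hq5 : q ≤ 5) {θ : ℝ}
    (hθ0 : 0 < θ) (hθ : ∀ k : ℤ, θ ≠ k) {m : ℕ} (hm1 : 1 ≤ m) (hmθ : (m : ℝ) - 1 < θ)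
    (hθm : θ < m) (T : ℝ) {g : ℝ → ℝ} {G : ℝ} (hg : ∀ s ∈ Set.Icc 0 T, |g s| ≤ G) :
    ∃ K, ∀ τ t : ℝ, 0 < τ → 0 ≤ t → t ≤ T →
      |∫ s in (0 : ℝ)..t, errKernel q θ (q + m - 1) ((t - s) / τ) * g s| ≤
        K * τ ^ (θ + 1 - m) := by
  obtain ⟨K, hK0, hK⟩ := exists_errKernel_bound_of_not_int hq1 hq5 hθ0 hθ hm1 hmθ hθm
  set γ := (m : ℝ) - 1 - θ with hγ
  have hγ1 : 0 < γ + 1 := by rw [hγ]; linarith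
  refine ⟨K * G * (T ^ (γ + 1) / (γ + 1)), fun τ t hτ ht0 htT => ?_⟩
  have hG0 : 0 ≤ G := (abs_nonneg _).trans (hg t ⟨ht0, htT⟩)
  have hint := (intervalIntegrable_sub_rpow (α := γ) (by linarith) t).const_mul
    (K * G * τ ^ (-γ))
  have hval : ∫ s in (0 : ℝ)..t, (t - s) ^ γ = t ^ (γ + 1) / (γ + 1) := by
    rw [intervalIntegral.integral_comp_sub_left (fun x => x ^ γ) t, sub_self, sub_zero,
      integral_rpow (Or.inl (by linarith)), Real.zero_rpow hγ1.ne', sub_zero]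
  have h := intervalIntegral.norm_integral_le_of_norm_le ht0
    (f := fun s => errKernel q θ (q + m - 1) ((t - s) / τ) * g s) (μ := volume) ?_ hint
  · rw [intervalIntegral.integral_const_mul, hval] at h
    refine h.trans ?_
    have e : θ + 1 - m = -γ := by rw [hγ]; ring
    rw [e]
    calc K * G * τ ^ (-γ) * (t ^ (γ + 1) / (γ + 1))
        ≤ K * G * τ ^ (-γ) * (T ^ (γ + 1) / (γ + 1)) := by gcongr
      _ = _ := by ring
  -- The kernel bound holds only for positive arguments; the end point `s = t` is a null set.
  · have hne : ∀ᵐ s : ℝ, s ≠ t := by simp [ae_iff]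
    filter_upwards [hne] with s hs hs'
    have hst : 0 < t - s := sub_pos.2 (lt_of_le_of_ne hs'.2 hs)
    rw [norm_mul, Real.norm_eq_abs, Real.norm_eq_abs]
    calc |errKernel q θ (q + m - 1) ((t - s) / τ)| * |g s|
        ≤ (K * ((t - s) / τ) ^ γ) * G :=
          mul_le_mul (hK _ (by positivity)) (hg s ⟨hs'.1.le, hs'.2.trans htT⟩) (abs_nonneg _)
            (by positivity)
      _ = _ := by
          rw [Real.div_rpow hst.le hτ.le, Real.rpow_neg hτ.le]
          field_simp

lemma exists_integral_errKernel_bound_of_int {q : ℕ} (hq1 : 1 ≤ q) (hq5 : q ≤ 5) {m : ℕ}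
    (hm1 : 1 ≤ m) (T : ℝ) {g : ℝ → ℝ} {G : ℝ} (hg : ∀ s ∈ Set.Icc 0 T, |g s| ≤ G) :
    ∃ K, ∀ τ t : ℝ, 0 < τ → 0 ≤ t → t ≤ T →
      |∫ s in (0 : ℝ)..t, errKernel q m (q + m - 1) ((t - s) / τ) * g s| ≤ K * τ := by
  obtain ⟨K, hK⟩ := exists_errKernel_bound_of_int hq1 hq5 hm1
  have hK0 : 0 ≤ K := (abs_nonneg _).trans (hK 0 le_rfl)
  set L : ℝ := ((m * q : ℕ) : ℝ) with hL
  -- The exponential majorises a bounded function supported in `[0, L]`, and its integral after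
  -- scaling by `τ` is at most a constant times `τ`, with no need to split the interval.
  have hexp : ∀ x : ℝ, 0 ≤ x → |errKernel q m (q + m - 1) x| ≤ K * Real.exp L * Real.exp (-x) := by
    intro x hx
    rcases le_or_gt L x with hLx | hLx
    · rw [errKernel_eq_zero hq1 hq5 hm1 (by omega) hLx, abs_zero]; positivity
    · rw [mul_assoc, ← Real.exp_add]
      exact (hK x hx).trans (le_mul_of_one_le_right hK0 (Real.one_le_exp (by linarith)))
  refine ⟨K * Real.exp L * G, fun τ t hτ ht0 htT => ?_⟩
  have hG0 : 0 ≤ G := (abs_nonneg _).trans (hg t ⟨ht0, htT⟩)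
  have hcont : Continuous fun s : ℝ => K * Real.exp L * G * Real.exp (-((t - s) / τ)) := by fun_prop
  have hval : ∫ s in (0 : ℝ)..t, Real.exp (-((t - s) / τ)) =
      τ * Real.exp (-((t - t) / τ)) - τ * Real.exp (-((t - 0) / τ)) := by
    refine intervalIntegral.integral_eq_sub_of_hasDerivAt
      (f := fun s => τ * Real.exp (-((t - s) / τ))) (fun s _ => ?_)
      (Continuous.intervalIntegrable (by fun_prop) _ _)
    have := (((((hasDerivAt_id s).const_sub t).div_const τ).neg).exp).const_mul τ
    refine this.congr_deriv ?_
    simp only [id, Pi.neg_apply]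
    field_simp
  have h := intervalIntegral.norm_integral_le_of_norm_le ht0
    (f := fun s => errKernel q m (q + m - 1) ((t - s) / τ) * g s) (μ := volume)
    (g := fun s => K * Real.exp L * G * Real.exp (-((t - s) / τ))) ?_
    (hcont.intervalIntegrable _ _)
  · rw [intervalIntegral.integral_const_mul, hval] at h
    refine h.trans ?_
    have h1 : τ * Real.exp (-((t - t) / τ)) - τ * Real.exp (-((t - 0) / τ)) ≤ τ := by
      rw [sub_self, zero_div, neg_zero, Real.exp_zero, mul_one]
      have : 0 ≤ τ * Real.exp (-((t - 0) / τ)) := by positivity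
      linarith
    exact mul_le_mul_of_nonneg_left h1 (by positivity)
  · refine ae_of_all _ fun s hs => ?_
    have hst : 0 ≤ t - s := sub_nonneg.2 hs.2
    rw [norm_mul, Real.norm_eq_abs, Real.norm_eq_abs]
    calc |errKernel q m (q + m - 1) ((t - s) / τ)| * |g s|
        ≤ (K * Real.exp L * Real.exp (-((t - s) / τ))) * G :=
          mul_le_mul (hexp _ (by positivity)) (hg s ⟨hs.1.le, hs.2.trans htT⟩) (abs_nonneg _)
            (by positivity)
      _ = _ := by ring

lemma exists_integral_errKernel_bound {q : ℕ} (hq1 : 1 ≤ q) (hq5 : q ≤ 5) {θ : ℝ}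
    (hθ0 : 0 < θ) {T : ℝ} {g : ℝ → ℝ} (hg : ContinuousOn g (Set.Icc 0 T)) :
    ∃ K, ∀ τ t : ℝ, 0 < τ → 0 ≤ t → t ≤ T →
      |∫ s in (0 : ℝ)..t, errKernel q θ (q + ⌈θ⌉₊ - 1) ((t - s) / τ) * g s| ≤
        K * τ ^ (θ + 1 - ⌈θ⌉₊) := by
  obtain ⟨G, hG⟩ := isCompact_Icc.exists_bound_of_continuousOn hg
  have hm1 : 1 ≤ ⌈θ⌉₊ := Nat.ceil_pos.2 hθ0
  by_cases hθ : θ = ⌈θ⌉₊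
  · obtain ⟨K, hK⟩ := exists_integral_errKernel_bound_of_int hq1 hq5 hm1 T hG
    refine ⟨K, fun τ t hτ ht0 htT => ?_⟩
    have h := hK τ t hτ ht0 htT
    rw [← hθ] at h
    have e : θ + 1 - ⌈θ⌉₊ = 1 := by rw [← hθ]; ring
    rwa [e, Real.rpow_one]
  · exact exists_integral_errKernel_bound_of_not_int hq1 hq5 hθ0 (ne_intCast_of_ne_ceil hθ0 hθ)
      hm1 (by linarith [Nat.ceil_lt_add_one hθ0.le])
      (lt_of_le_of_ne (Nat.le_ceil θ) hθ) T hG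

/-- The error of the corrected operator is `O(τ ^ q)` as soon as this holds for the contributions
of the derivatives at the initial time. -/
lemma exists_error_bound {T : ℝ} (hT : 0 < T) {q : ℕ} (hq1 : 1 ≤ q) (hq5 : q ≤ 5) {θ : ℝ}
    (hθ0 : 0 < θ) {f : ℝ → ℝ}
    (hf : ContDiffOn ℝ ((q + ⌈θ⌉₊ : ℕ) : WithTop ℕ∞) f (Set.Icc 0 T)) {S : ℕ → ℕ → Prop}
    (hS : ∀ N n, S N n → 1 ≤ N ∧ n ≤ N)
    (hmono : ∀ i < q, ∃ K, ∀ N n, S N n →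
      |timeDeriv T (⌈θ⌉₊ + i) f 0 * ((T / N) ^ (((⌈θ⌉₊ + i : ℕ) : ℝ) - θ) *
        errKernel q θ (⌈θ⌉₊ + i) n)| ≤ K * (T / N) ^ q) :
    ∃ C, ∀ N n, S N n →
      |caputo T θ f (n * (T / N)) - lubichCaputo T q θ (T / N) f n| ≤ C * (T / N) ^ q := by
  set m := ⌈θ⌉₊ with hm
  obtain ⟨K, hK⟩ := exists_integral_errKernel_bound hq1 hq5 hθ0
    (continuousOn_timeDeriv hT hf le_rfl)
  choose! L hL using hmono
  refine ⟨∑ i ∈ range q, 1 / ((m + i).factorial : ℝ) * L i + 1 / ((q + m - 1).factorial : ℝ) * K,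
    fun N n hNn => ?_⟩
  obtain ⟨hN, hnN⟩ := hS N n hNn
  have hN0 : (0 : ℝ) < N := by exact_mod_cast hN
  set τ := T / N with hτdef
  have hτ : 0 < τ := by positivity
  have hnτ : n * τ ≤ T := by
    have h1 : (n : ℝ) ≤ N := by exact_mod_cast hnN
    calc n * τ ≤ N * τ := by gcongr
      _ = T := by rw [hτdef]; field_simp
  rw [caputo_sub_lubichCaputo hT hq1 θ hf hτ hnτ, add_mul, Finset.sum_mul]
  refine (abs_add_le _ _).trans (add_le_add ?_ ?_)
  · refine (Finset.abs_sum_le_sum_abs _ _).trans (Finset.sum_le_sum fun i hi => ?_)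
    have h := hL i (Finset.mem_range.1 hi) N n hNn
    rw [div_mul_eq_mul_div, abs_div, Nat.abs_cast, one_div, inv_mul_eq_div, div_mul_eq_mul_div]
    gcongr
  · rw [abs_mul, abs_of_nonneg (by positivity : (0 : ℝ) ≤ 1 / ((q + m - 1).factorial : ℝ)),
      mul_assoc]
    refine mul_le_mul_of_nonneg_left ?_ (by positivity)
    rw [abs_mul, abs_of_nonneg (by positivity : (0 : ℝ) ≤ τ ^ (((q + m - 1 : ℕ) : ℝ) - θ))]
    refine (mul_le_mul_of_nonneg_left (hK τ (n * τ) hτ (by positivity) hnτ)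
      (by positivity)).trans (le_of_eq ?_)
    -- The prefactor `τ^{P-θ}` and the kernel integral of order `τ^{θ+1-m}` combine to exactly
    -- `τ^q`.
    have eP : ((q + m - 1 : ℕ) : ℝ) - θ + (θ + 1 - m) = (q : ℕ) := by
      rw [Nat.cast_sub (by omega)]; push_cast; ring
    rw [mul_left_comm, ← Real.rpow_add hτ, eP, Real.rpow_natCast]

/-- The error for `t ^ l` away from the initial time. -/
lemma exists_monomial_bound {T : ℝ} (hT : 0 < T) {q : ℕ} (hq1 : 1 ≤ q) (hq5 : q ≤ 5) {θ : ℝ}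
    (hθ0 : 0 < θ) {l : ℕ} (hl : l < q + ⌈θ⌉₊) (hql : q ≤ l + 1) {δ : ℝ} (hδ : 0 < δ) :
    ∃ K, ∀ N n : ℕ, 1 ≤ N → n ≤ N → δ ≤ n * (T / N) →
      |(T / N) ^ ((l : ℝ) - θ) * errKernel q θ l n| ≤ K * (T / N) ^ q := by
  obtain ⟨K, hK⟩ := exists_errKernel_natCast_bound hq1 hq5 hθ0 hl
  have hK0 : 0 ≤ K := by simpa using (abs_nonneg _).trans (hK 0)
  rw [min_eq_left hql] at hK
  set e := (l : ℝ) - θ - q with he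
  refine ⟨K * (δ ^ e + (2 * T) ^ e), fun N n hN hnN hδn => ?_⟩
  have hN0 : (0 : ℝ) < N := by exact_mod_cast hN
  set τ := T / N with hτdef
  have hτ : 0 < τ := by positivity
  have hNτ : N * τ = T := by rw [hτdef]; field_simp
  have h1 : (n : ℝ) ≤ N := by exact_mod_cast hnN
  have h2 : (1 : ℝ) ≤ N := by exact_mod_cast hN
  have hlow : δ ≤ ((n : ℝ) + 1) * τ := by linarith [hτ.le]
  have hup : ((n : ℝ) + 1) * τ ≤ 2 * T := by
    rw [← hNτ]; nlinarith
  -- The exponent `e = l - θ - q` may have either sign, so the values at both ends of `[δ, 2T]` are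
  -- added.
  have hpow : (((n : ℝ) + 1) * τ) ^ e ≤ δ ^ e + (2 * T) ^ e := by
    have p1 : 0 ≤ δ ^ e := by positivity
    have p2 : 0 ≤ (2 * T) ^ e := by positivity
    rcases le_total 0 e with he0 | he0
    · linarith [Real.rpow_le_rpow (by positivity) hup he0]
    · linarith [Real.rpow_le_rpow_of_nonpos hδ hlow he0]
  rw [abs_mul, abs_of_nonneg (by positivity : (0 : ℝ) ≤ τ ^ ((l : ℝ) - θ))]
  have eτ : (l : ℝ) - θ = e + (q : ℕ) := by rw [he]; ring
  calc τ ^ ((l : ℝ) - θ) * |errKernel q θ l n|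
      ≤ τ ^ ((l : ℝ) - θ) * (K * ((n : ℝ) + 1) ^ e) := by gcongr; exact hK n
    _ = K * (((n : ℝ) + 1) * τ) ^ e * τ ^ q := by
        rw [eτ, Real.rpow_add hτ, Real.rpow_natCast, Real.mul_rpow (by positivity) hτ.le]; ring
    _ ≤ K * (δ ^ e + (2 * T) ^ e) * τ ^ q := by gcongr

end CaputoLubich

end

theorem theorem3p1
    {d : ℕ} (Ω : Set (EuclideanSpace ℝ (Fin d)))
    (T : ℝ) (hT : 0 < T)
    (q : ℕ) (hq1 : 1 ≤ q) (hq5 : q ≤ 5)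
    (θ : ℝ) (hθ : 0 < θ)
    (u : EuclideanSpace ℝ (Fin d) → ℝ → ℝ)
    (x : EuclideanSpace ℝ (Fin d)) (hx : x ∈ Ω)
    (hu : ContDiffOn ℝ ((q + ⌈θ⌉₊ : ℕ) : WithTop ℕ∞) (u x) (Set.Icc 0 T)) :
    -- at times bounded away from the initial time
    ((∀ l : ℕ, ⌈θ⌉₊ ≤ l → l + 2 ≤ q → CaputoLubich.timeDeriv T l (u x) 0 = 0) →
      ∀ δ : ℝ, 0 < δ → ∃ C : ℝ, ∀ N n : ℕ, 1 ≤ N → n ≤ N →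
        δ ≤ (n : ℝ) * (T / N) →
        |CaputoLubich.caputo T θ (u x) ((n : ℝ) * (T / N))
          - CaputoLubich.lubichCaputo T q θ (T / N) (u x) n| ≤ C * (T / N) ^ q) ∧
    -- on the whole grid
    ((∀ l : ℕ, ⌈θ⌉₊ ≤ l → (l : ℝ) < θ + q → CaputoLubich.timeDeriv T l (u x) 0 = 0) →
      ∃ C : ℝ, ∀ N n : ℕ, 1 ≤ n → n ≤ N →
        |CaputoLubich.caputo T θ (u x) ((n : ℝ) * (T / N))
          - CaputoLubich.lubichCaputo T q θ (T / N) (u x) n| ≤ C * (T / N) ^ q) ∧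
    -- derivatives of integer order
    (θ = (⌈θ⌉₊ : ℝ) →
      ∃ C : ℝ, ∀ N n : ℕ, 1 ≤ N → ⌈θ⌉₊ * q ≤ n → n ≤ N →
        |CaputoLubich.caputo T θ (u x) ((n : ℝ) * (T / N))
          - CaputoLubich.lubichCaputo T q θ (T / N) (u x) n| ≤ C * (T / N) ^ q) := by
  refine ⟨fun h0 δ hδ => ?_, fun h0 => ?_, fun hint => ?_⟩
  · obtain ⟨C, hC⟩ := CaputoLubich.exists_error_bound hT hq1 hq5 hθ hu
      (S := fun N n => 1 ≤ N ∧ n ≤ N ∧ δ ≤ n * (T / N)) (fun N n h => ⟨h.1, h.2.1⟩) fun i hi => by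
        -- For `l ≤ q - 2` only `l + 1 < q` terms are known to cancel, which would give the order
        -- `τ^{l+1}`; these derivatives vanish by hypothesis.
        by_cases hl : ⌈θ⌉₊ + i + 2 ≤ q
        · refine ⟨0, fun N n _ => ?_⟩
          rw [h0 _ (Nat.le_add_right _ _) hl]
          simp
        · obtain ⟨K, hK⟩ := CaputoLubich.exists_monomial_bound hT hq1 hq5 hθ (l := ⌈θ⌉₊ + i)
            (by omega) (by omega) hδ
          refine ⟨|CaputoLubich.timeDeriv T (⌈θ⌉₊ + i) (u x) 0| * K, fun N n h => ?_⟩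
          rw [abs_mul, mul_assoc]
          exact mul_le_mul_of_nonneg_left (hK N n h.1 h.2.1 h.2.2) (abs_nonneg _)
    exact ⟨C, fun N n hN hn hδn => hC N n ⟨hN, hn, hδn⟩⟩
  · obtain ⟨C, hC⟩ := CaputoLubich.exists_error_bound hT hq1 hq5 hθ hu
      (S := fun N n => 1 ≤ n ∧ n ≤ N) (fun N n h => ⟨h.1.trans h.2, h.2⟩) fun i hi => by
        refine ⟨0, fun N n _ => ?_⟩
        -- Since `m < θ + 1`, all indices `m, …, m+q-1` lie below `θ + q`: every monomial term drops
        -- out and only the integral remains.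
        have hlt : ((⌈θ⌉₊ + i : ℕ) : ℝ) < θ + q := by
          have h1 := Nat.ceil_lt_add_one hθ.le
          have h2 : (i : ℝ) + 1 ≤ q := by exact_mod_cast hi
          push_cast
          linarith
        rw [h0 _ (Nat.le_add_right _ _) hlt]
        simp
    exact ⟨C, fun N n hn hnN => hC N n ⟨hn, hnN⟩⟩
  · obtain ⟨C, hC⟩ := CaputoLubich.exists_error_bound hT hq1 hq5 hθ hu
      (S := fun N n => 1 ≤ N ∧ ⌈θ⌉₊ * q ≤ n ∧ n ≤ N) (fun N n h => ⟨h.1, h.2.2⟩) fun i hi => by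
        refine ⟨0, fun N n h => ?_⟩
        have hz : CaputoLubich.errKernel q θ (⌈θ⌉₊ + i) n = 0 := by
          have := CaputoLubich.errKernel_natCast_eq_zero hq1 hq5 (m := ⌈θ⌉₊) (l := ⌈θ⌉₊ + i)
            (by omega) h.2.1
          rwa [← hint] at this
        rw [hz]
        simp
    exact ⟨C, fun N n hN hmq hn => hC N n ⟨hN, hmq, hn⟩⟩
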